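/- **Setting.** Consider three systems with parameters $\boldsymbol\lambda$: * Meixner (M): $\boldsymbol\lambda=(\beta,c)$, $\beta>0$, $0<c<1$; $B(x;\boldsymbol\lambda)=c(x+\beta)$, $D(x)=x$, $\mathcal E_n=(1-c)n$, $\eta(x)=x$, $\check P_n(x;\boldsymbol\lambda)={}_2F_1(-n,-x;\beta\,|\,1-c^{-1})$; $\boldsymbol\lambda+\boldsymbol\delta=(\beta+1,c)$, $\boldsymbol\lambda+M\tilde{\boldsymbol\delta}=(\beta+M,c)$, $\mathfrak t(\boldsymbol\lambda)=(\beta,c^{-1})$, $\alpha=c$, $\alpha'=-(1-c)\beta$. * little $q$-Jacobi (l$q$J), $0<q<1$: $q^{\boldsymbol\lambda}=(a,b)$, $0<a<q^{-1}$, $b<q^{-1}$; $B(x;\boldsymbol\lambda)=a(q^{-x}-bq)$, $D(x)=q^{-x}-1$, $\mathcal E_n=(q^{-n}-1)(1-abq^{n+1})$, $\eta(x)=1-q^x$, $\check P_n(x;\boldsymbol\lambda)={}_3\phi_1(q^{-n},abq^{n+1},q^{-x};bq\,|\,q;q^x/a)$; $q^{\boldsymbol\lambda+\boldsymbol\delta}=(aq,bq)$,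 $q^{\boldsymbol\lambda+M\tilde{\boldsymbol\delta}}=(aq^{-M},bq^M)$, $q^{\mathfrak t(\boldsymbol\lambda)}=(a^{-1},b)$, $\alpha=a$, $\alpha'=-(1-a)(1-bq)$. * little $q$-Laguerre (l$q$L), $0<q<1$: $q^{\boldsymbol\lambda}=a$, $0<a<q^{-1}$; $B(x;\boldsymbol\lambda)=aq^{-x}$, $D(x)=q^{-x}-1$, $\mathcal E_n=q^{-n}-1$, $\eta(x)=1-q^x$, $\check P_n(x;\boldsymbol\lambda)={}_2\phi_0(q^{-n},q^{-x};-\,|\,q;q^x/a)$; $q^{\boldsymbol\lambda+\boldsymbol\delta}=aq$, $q^{\boldsymbol\lambda+M\tilde{\boldsymbol\delta}}=aq^{-M}$, $q^{\mathfrak t(\boldsymbol\lambda)}=a^{-1}$, $\alpha=a$, $\alpha'=-(1-a)$. Put $B'(x;\boldsymbol\lambda)=B(x;\mathfrak t(\boldsymbol\lambda))$, $\check\xi_{\rm v}(x;\boldsymbol\lambda)=\check P_{\rm v}(x;\mathfrak t(\boldsymbol\lambda))$, $\tilde{\mathcal E}_{\rm v}=\alpha\,\mathcal E_{\rm v}(\mathfrak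 t(\boldsymbol\lambda))+\alpha'$, $\nu(x;\boldsymbol\lambda)=\alpha(\boldsymbol\lambda)^x$. Let $\mathcal D=(d_1,\dots,d_M)$ be mutually distinct integers $\ge1$, with $a<q^{d_j}$ for all $j$ in the cases l$q$J, l$q$L, and, in the case l$q$J, with $a\ne bq^{d_j+d_k+1}$ for $j\neq k$. With the Casoratian $\mathrm W_C[f_1,\dots,f_n](x)=\det(f_k(x+j-1))_{j,k}$ put, for $s\le M$, $$w_s=\mathrm W_C[\check\xi_{d_1},\dots,\check\xi_{d_s}],\qquad w''_{s,n}=\mathrm W_C[\check\xi_{d_1},\dots,\check\xi_{d_s},\nu\check P_n],\qquad \varphi_M(x)=\prod_{1\le j<k\le M}\frac{\eta(x+k-1)-\eta(x+j-1)}{\eta(k-j)},$$ $$\mathcal C_{\mathcal D}=\frac1{\varphi_M(0)}\prod_{1\le j<k\le M}\frac{\tilde{\mathcal E}_{d_j}-\tilde{\mathcal E}_{d_k}}{\alpha B'(j-1)},\qquad \mathcal C_{\mathcal D,n}=(-1)^M\mathcal C_{\mathcal D}\,\frac{\varphi_M(0)}{\varphi_{M+1}(0)}\prod_{j=1}^M\frac{\mathcal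 E_n-\tilde{\mathcal E}_{d_j}}{\alpha B'(j-1)},$$ and define the denominator polynomial $\check\Xi_{\mathcal D}$ and the multi-indexed polynomial $\check P_{\mathcal D,n}$ by $$w_M(x)=\mathcal C_{\mathcal D}\,\varphi_M(x)\,\check\Xi_{\mathcal D}(x;\boldsymbol\lambda),\qquad w''_{M,n}(x)=\mathcal C_{\mathcal D,n}\,\varphi_{M+1}(x)\,\check P_{\mathcal D,n}(x;\boldsymbol\lambda)\,\nu(x;\boldsymbol\lambda+M\tilde{\boldsymbol\delta}).$$ The deformed potentials are $$B_{\mathcal D}(x)=\alpha B'(x+M)\frac{w_M(x)}{w_M(x+1)}\frac{w''_{M,0}(x+1)}{w''_{M,0}(x)},\qquad D_{\mathcal D}(x)=\alpha D(x)\frac{w_M(x+1)}{w_M(x)}\frac{w''_{M,0}(x-1)}{w''_{M,0}(x)}.$$ On sequences on $\mathbb Z_{\ge0}$ let $e^{\pm\partial}$ be the matrices $(\delta_{x\pm1,y})$. For functions $f,g\ge0$ on $\mathbb Z_{\ge 0}$ let $\mathcal A[f,g]=\sqrt{f(x)}-e^{\partial}\sqrt{g(x)}$ and let $\mathcal A[f,g]^\dagger=\sqrt{f(x)}-\sqrt{g(x)}\,e^{-\partial}$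 be its transpose. For $M\ge1$ the deformed Hamiltonian is $\mathcal H_{\mathcal D}=\mathcal A[\hat B,\hat D]\,\mathcal A[\hat B,\hat D]^\dagger+\tilde{\mathcal E}_{d_M}$ with $$\hat B(x)=\alpha B'(x+M-1)\frac{w_{M-1}(x)}{w_{M-1}(x+1)}\frac{w_M(x+1)}{w_M(x)},\qquad \hat D(x)=\alpha D(x)\frac{w_{M-1}(x+1)}{w_{M-1}(x)}\frac{w_M(x-1)}{w_M(x)};$$ for $M=0$ it is $\mathcal H=-\sqrt{B}\,e^\partial\sqrt{D}-\sqrt{D}\,e^{-\partial}\sqrt{B}+B+D$. Let $\phi_0(x;\boldsymbol\lambda)=\prod_{y=0}^{x-1}\sqrt{B(y;\boldsymbol\lambda)/D(y+1)}$, $$\psi_{\mathcal D}(x;\boldsymbol\lambda)=\sqrt{\check\Xi_{\mathcal D}(1;\boldsymbol\lambda)}\,\frac{\phi_0(x;\boldsymbol\lambda+M\tilde{\boldsymbol\delta})}{\sqrt{\check\Xi_{\mathcal D}(x;\boldsymbol\lambda)\check\Xi_{\mathcal D}(x+1;\boldsymbol\lambda)}},\qquad \widetilde{\mathcal H}_{\mathcal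 D}=\psi_{\mathcal D}^{-1}\circ\mathcal H_{\mathcal D}\circ\psi_{\mathcal D},$$ and, with $\mathcal A_{\mathcal D}=\mathcal A[B_{\mathcal D},D_{\mathcal D}]$, $$\mathcal F_{\mathcal D}=\sqrt{B_{\mathcal D}(0)}\,\psi_{\mathcal D}(x;\boldsymbol\lambda+\boldsymbol\delta)^{-1}\circ\mathcal A_{\mathcal D}\circ\psi_{\mathcal D}(x;\boldsymbol\lambda),\qquad \mathcal B_{\mathcal D}=\frac1{\sqrt{B_{\mathcal D}(0)}}\,\psi_{\mathcal D}(x;\boldsymbol\lambda)^{-1}\circ\mathcal A_{\mathcal D}^\dagger\circ\psi_{\mathcal D}(x;\boldsymbol\lambda+\boldsymbol\delta).$$ **Theorem.** 1. $\check\Xi_{\mathcal D}(x;\boldsymbol\lambda)>0$ and $\check\Xi_{\mathcal D}(x;\boldsymbol\lambda+\boldsymbol\delta)>0$ for $x\in\mathbb Z_{\ge0}$; $\check\Xi_{\mathcal D}(x;\boldsymbol\lambda)$ and, for all $n\ge0$, $\check P_{\mathcal D,n}(x;\boldsymbol\lambda)$ are real polynomials in $\eta(x)$ with value $1$ at $x=0$.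 2. For all real or complex $x$ at which the denominators on the right do not vanish (in particular on $\mathbb Z_{\ge0}$), $$B_{\mathcal D}(x)=B(x;\boldsymbol\lambda+M\tilde{\boldsymbol\delta})\frac{\check\Xi_{\mathcal D}(x;\boldsymbol\lambda)}{\check\Xi_{\mathcal D}(x+1;\boldsymbol\lambda)}\frac{\check\Xi_{\mathcal D}(x+1;\boldsymbol\lambda+\boldsymbol\delta)}{\check\Xi_{\mathcal D}(x;\boldsymbol\lambda+\boldsymbol\delta)},\qquad D_{\mathcal D}(x)=D(x)\frac{\check\Xi_{\mathcal D}(x+1;\boldsymbol\lambda)}{\check\Xi_{\mathcal D}(x;\boldsymbol\lambda)}\frac{\check\Xi_{\mathcal D}(x-1;\boldsymbol\lambda+\boldsymbol\delta)}{\check\Xi_{\mathcal D}(x;\boldsymbol\lambda+\boldsymbol\delta)}.$$ 3. On sequences on $\mathbb Z_{\ge0}$, $\widetilde{\mathcal H}_{\mathcal D}=\mathcal B_{\mathcal D}\mathcal F_{\mathcal D}$ and $$\widetilde{\mathcal H}_{\mathcal D}=B(x;\boldsymbol\lambda+M\tilde{\boldsymbol\delta})\frac{\check\Xi_{\mathcal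 D}(x;\boldsymbol\lambda)}{\check\Xi_{\mathcal D}(x+1;\boldsymbol\lambda)}\Bigl(\frac{\check\Xi_{\mathcal D}(x+1;\boldsymbol\lambda+\boldsymbol\delta)}{\check\Xi_{\mathcal D}(x;\boldsymbol\lambda+\boldsymbol\delta)}-e^{\partial}\Bigr)+D(x)\frac{\check\Xi_{\mathcal D}(x+1;\boldsymbol\lambda)}{\check\Xi_{\mathcal D}(x;\boldsymbol\lambda)}\Bigl(\frac{\check\Xi_{\mathcal D}(x-1;\boldsymbol\lambda+\boldsymbol\delta)}{\check\Xi_{\mathcal D}(x;\boldsymbol\lambda+\boldsymbol\delta)}-e^{-\partial}\Bigr).$$ 4. For every $n\ge0$, $\widetilde{\mathcal H}_{\mathcal D}\,\check P_{\mathcal D,n}(x;\boldsymbol\lambda)=\mathcal E_n(\boldsymbol\lambda)\,\check P_{\mathcal D,n}(x;\boldsymbol\lambda)$ on $\mathbb Z_{\ge0}$; moreover, with the right side of 3 read as a difference operator on functions of a real or complex variable ($e^{\pm\partial}f(x)=f(x\pm1)$), the same equation holds at every real or complex $x$ at which its denominators do not vanish. -/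

import Mathlib

open Finset

/-- `r ^ x` for a positive real base `r` and a real or complex exponent `x`. -/
noncomputable def posPow {𝕜 : Type*} [RCLike 𝕜] (r : ℝ) (x : 𝕜) : 𝕜 :=
  NormedSpace.exp (((Real.log r : ℝ) : 𝕜) * x)

theorem posPow_real {r : ℝ} (hr : 0 < r) (x : ℝ) : posPow r x = r ^ x := by
  rw [posPow, Real.rpow_def_of_pos hr, ← Real.exp_eq_exp_ℝ]
  rfl

theorem posPow_complex {r : ℝ} (hr : 0 < r) (x : ℂ) : posPow r x = (r : ℂ) ^ x := by
  rw [posPow, Complex.cpow_def_of_ne_zero (by exact_mod_cast hr.ne'), ← Complex.exp_eq_exp_ℂ,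
    ← Complex.ofReal_log hr.le]
  rfl

/-- The q-shifted factorial `(a ; q)_k`. -/
def qPoch {R : Type*} [CommRing R] (a q : R) (k : ℕ) : R :=
  ∏ i ∈ range k, (1 - a * q ^ i)

/-- The Casorati determinant `W_C[f₁, …, f_n](x) = det (f_k (x + j - 1))`. -/
def casoratian {𝕜 : Type*} [CommRing 𝕜] {n : ℕ} (f : Fin n → 𝕜 → 𝕜) (x : 𝕜) : 𝕜 :=
  (Matrix.of fun j k : Fin n => f k (x + ((j : ℕ) : 𝕜))).det

/-- Operators on sequences on the lattice `x = 0, 1, 2, …`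
(matrices with finitely many nonzero entries in every row act on all sequences). -/
abbrev LatticeOp : Type := Module.End ℝ (ℕ → ℝ)

namespace LatticeOp

/-- The diagonal matrix with entries `g x`. -/
def diag (g : ℕ → ℝ) : LatticeOp := LinearMap.mulLeft ℝ g

/-- `e^∂`, the matrix `δ_{x+1,y}`. -/
def up : LatticeOp where
  toFun f := fun x => f (x + 1)
  map_add' _ _ := rfl
  map_smul' _ _ := rfl

/-- `e^{-∂}`, the matrix `δ_{x-1,y}`; its row `x = 0` vanishes. -/
def down : LatticeOp where
  toFun f := fun x => if x = 0 then 0 else f (x - 1)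
  map_add' f g := by
    funext x
    by_cases h : x = 0 <;> simp [h]
  map_smul' c f := by
    funext x
    by_cases h : x = 0 <;> simp [h]

/-- `𝒜 = √B(x) - e^∂ √D(x)`. -/
noncomputable def A (B D : ℕ → ℝ) : LatticeOp :=
  diag (fun x => √(B x)) - up * diag (fun x => √(D x))

/-- `𝒜† = √B(x) - √D(x) e^{-∂}`, the transpose of `𝒜`. -/
noncomputable def Adag (B D : ℕ → ℝ) : LatticeOp :=
  diag (fun x => √(B x)) - diag (fun x => √(D x)) * down

end LatticeOp

/-- The three systems with their parameters `𝝀`. In the `q`-cases the parameters are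
`q^𝝀 = (a, b)`, respectively `q^𝝀 = a`. -/
inductive MIParams : Type
  /-- Meixner, `𝝀 = (β, c)`. -/
  | meixner (β c : ℝ) : MIParams
  /-- little `q`-Jacobi, `q^𝝀 = (a, b)`. -/
  | littleQJacobi (q a b : ℝ) : MIParams
  /-- little `q`-Laguerre, `q^𝝀 = a`. -/
  | littleQLaguerre (q a : ℝ) : MIParams

namespace MIParams

/-- The parameter range. -/
def Admissible : MIParams → Prop
  | meixner β c => 0 < β ∧ 0 < c ∧ c < 1
  | littleQJacobi q a b => 0 < q ∧ q < 1 ∧ 0 < a ∧ a < q⁻¹ ∧ b < q⁻¹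
  | littleQLaguerre q a => 0 < q ∧ q < 1 ∧ 0 < a ∧ a < q⁻¹

/-- The index set `𝒱` of the virtual state vectors. -/
def virtualIndexSet : MIParams → Set ℕ
  | meixner _ _ => {v | 1 ≤ v}
  | littleQJacobi q a _ => {v | 1 ≤ v ∧ a < q ^ v}
  | littleQLaguerre q a => {v | 1 ≤ v ∧ a < q ^ v}

/-- `𝝀 + 𝜹`. -/
def shift : MIParams → MIParams
  | meixner β c => meixner (β + 1) c
  | littleQJacobi q a b => littleQJacobi q (a * q) (b * q)
  | littleQLaguerre q a => littleQLaguerre q (a * q)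

/-- `𝝀 + M 𝜹̃`, where `𝜹̃ = (1, 0)`, `(-1, 1)`, `-1` in the three cases. -/
noncomputable def tshift (M : ℕ) : MIParams → MIParams
  | meixner β c => meixner (β + M) c
  | littleQJacobi q a b => littleQJacobi q (a / q ^ M) (b * q ^ M)
  | littleQLaguerre q a => littleQLaguerre q (a / q ^ M)

/-- The twist `𝔱(𝝀)`. -/
noncomputable def twist : MIParams → MIParams
  | meixner β c => meixner β c⁻¹
  | littleQJacobi q a b => littleQJacobi q a⁻¹ b
  | littleQLaguerre q a => littleQLaguerre q a⁻¹

/-- The eigenvalue `ℰ_n(𝝀)`. -/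
noncomputable def E : MIParams → ℕ → ℝ
  | meixner _ c, n => (1 - c) * n
  | littleQJacobi q a b, n => ((q ^ n)⁻¹ - 1) * (1 - a * b * q ^ (n + 1))
  | littleQLaguerre q _, n => (q ^ n)⁻¹ - 1

/-- The constant `α(𝝀)`. -/
def alpha : MIParams → ℝ
  | meixner _ c => c
  | littleQJacobi _ a _ => a
  | littleQLaguerre _ a => a

/-- The constant `α'(𝝀)`. -/
def alpha' : MIParams → ℝ
  | meixner β c => -(1 - c) * β
  | littleQJacobi q a b => -(1 - a) * (1 - b * q)
  | littleQLaguerre _ a => -(1 - a)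

/-- The virtual state energy `ℰ̃_v(𝝀) = α(𝝀) ℰ_v(𝔱(𝝀)) + α'(𝝀)`. -/
noncomputable def tE (l : MIParams) (v : ℕ) : ℝ :=
  l.alpha * l.twist.E v + l.alpha'

section Functions

variable {𝕜 : Type*} [RCLike 𝕜]

/-- The potential function `B(x; 𝝀)`. -/
noncomputable def B : MIParams → 𝕜 → 𝕜
  | meixner β c, x => (c : 𝕜) * (x + (β : 𝕜))
  | littleQJacobi q a b, x => (a : 𝕜) * (posPow q (-x) - (b : 𝕜) * (q : 𝕜))
  | littleQLaguerre q a, x => (a : 𝕜) * posPow q (-x)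

/-- The potential function `D(x)`. -/
noncomputable def D : MIParams → 𝕜 → 𝕜
  | meixner _ _, x => x
  | littleQJacobi q _ _, x => posPow q (-x) - 1
  | littleQLaguerre q _, x => posPow q (-x) - 1

/-- `B'(x; 𝝀) = B(x; 𝔱(𝝀))`; moreover `D'(x) = D(x)`. -/
noncomputable def B' (l : MIParams) (x : 𝕜) : 𝕜 := l.twist.B x

/-- The sinusoidal coordinate `η(x)`. -/
noncomputable def eta : MIParams → 𝕜 → 𝕜
  | meixner _ _, x => x
  | littleQJacobi q _ _, x => 1 - posPow q x
  | littleQLaguerre q _, x => 1 - posPow q x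

/-- The polynomials `P̌_n(x; 𝝀)`: the terminating series
`₂F₁(-n, -x; β | 1 - c⁻¹)`,
`₃φ₁(q^{-n}, a b q^{n+1}, q^{-x}; b q | q; q^x / a)` and
`₂φ₀(q^{-n}, q^{-x}; - | q; q^x / a)`. -/
noncomputable def P : MIParams → ℕ → 𝕜 → 𝕜
  | meixner β c, n, x => ∑ k ∈ range (n + 1),
      (ascPochhammer 𝕜 k).eval (-(n : 𝕜)) * (ascPochhammer 𝕜 k).eval (-x)
        / ((ascPochhammer 𝕜 k).eval (β : 𝕜) * (k.factorial : 𝕜)) * (1 - (c : 𝕜)⁻¹) ^ k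
  | littleQJacobi q a b, n, x => ∑ k ∈ range (n + 1),
      qPoch ((q : 𝕜) ^ n)⁻¹ (q : 𝕜) k * qPoch ((a : 𝕜) * b * (q : 𝕜) ^ (n + 1)) (q : 𝕜) k
          * qPoch (posPow q (-x)) (q : 𝕜) k
        / (qPoch ((b : 𝕜) * q) (q : 𝕜) k * qPoch (q : 𝕜) (q : 𝕜) k)
        * ((-1) ^ k * (q : 𝕜) ^ k.choose 2)⁻¹ * (posPow q x / (a : 𝕜)) ^ k
  | littleQLaguerre q a, n, x => ∑ k ∈ range (n + 1),
      qPoch ((q : 𝕜) ^ n)⁻¹ (q : 𝕜) k * qPoch (posPow q (-x)) (q : 𝕜) k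
        / qPoch (q : 𝕜) (q : 𝕜) k
        * ((-1) ^ k * (q : 𝕜) ^ k.choose 2)⁻¹ * (posPow q x / (a : 𝕜)) ^ k

/-- The virtual state polynomials `ξ̌_v(x; 𝝀) = P̌_v(x; 𝔱(𝝀))`. -/
noncomputable def xi (l : MIParams) (v : ℕ) (x : 𝕜) : 𝕜 := l.twist.P v x

/-- `ν(x; 𝝀) = c^x`, respectively `a^x`. -/
noncomputable def nu (l : MIParams) (x : 𝕜) : 𝕜 := posPow l.alpha x

/-- The auxiliary function
`φ_M(x) = ∏_{1 ≤ j < k ≤ M} (η(x + k - 1) - η(x + j - 1)) / η(k - j)`. -/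
noncomputable def phiAux (l : MIParams) (M : ℕ) (x : 𝕜) : 𝕜 :=
  ∏ k ∈ range M, ∏ j ∈ range k,
    (l.eta (x + (k : 𝕜)) - l.eta (x + (j : 𝕜))) / l.eta ((k : 𝕜) - (j : 𝕜))

variable {M : ℕ}

/-- `w_M(x) = W_C[ξ̌_{d₁}, …, ξ̌_{d_M}](x; 𝝀)`. -/
noncomputable def w (l : MIParams) (d : Fin M → ℕ) (x : 𝕜) : 𝕜 :=
  casoratian (fun j => l.xi (d j)) x

/-- `w''_{M,n}(x) = W_C[ξ̌_{d₁}, …, ξ̌_{d_M}, ν P̌_n](x; 𝝀)`. -/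
noncomputable def w'' (l : MIParams) (d : Fin M → ℕ) (n : ℕ) (x : 𝕜) : 𝕜 :=
  casoratian (Fin.snoc (α := fun _ => 𝕜 → 𝕜) (fun j => l.xi (d j))
    (fun y => l.nu y * l.P n y)) x

end Functions

section Deformed

variable {𝕜 : Type*} [RCLike 𝕜] {M : ℕ}

/-- The normalisation constant `𝒞_𝒟(𝝀)`. -/
noncomputable def cD (l : MIParams) (d : Fin M → ℕ) : ℝ :=
  1 / l.phiAux M (0 : ℝ) *
    ∏ k : Fin M, ∏ j ∈ Finset.Iio k,
      (l.tE (d j) - l.tE (d k)) / (l.alpha * l.B' ((j : ℕ) : ℝ))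

/-- The constant `d̃_{𝒟,n}(𝝀)²`. -/
noncomputable def dSq (l : MIParams) (d : Fin M → ℕ) (n : ℕ) : ℝ :=
  l.phiAux M (0 : ℝ) / l.phiAux (M + 1) (0 : ℝ) *
    ∏ j : Fin M, (l.E n - l.tE (d j)) / (l.alpha * l.B' ((j : ℕ) : ℝ))

/-- The normalisation constant `𝒞_{𝒟,n}(𝝀) = (-1)^M 𝒞_𝒟(𝝀) d̃_{𝒟,n}(𝝀)²`. -/
noncomputable def cDn (l : MIParams) (d : Fin M → ℕ) (n : ℕ) : ℝ :=
  (-1) ^ M * l.cD d * l.dSq d n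

/-- The denominator polynomial `Ξ̌_𝒟(x; 𝝀)`. -/
noncomputable def Xi (l : MIParams) (d : Fin M → ℕ) (x : 𝕜) : 𝕜 :=
  l.w d x / ((l.cD d : 𝕜) * l.phiAux M x)

/-- The multi-indexed polynomial `P̌_{𝒟,n}(x; 𝝀)`. -/
noncomputable def PD (l : MIParams) (d : Fin M → ℕ) (n : ℕ) (x : 𝕜) : 𝕜 :=
  l.w'' d n x / ((l.cDn d n : 𝕜) * l.phiAux (M + 1) x * (l.tshift M).nu x)

/-- The deformed potential function
`B_𝒟(x) = α B'(x + M) (w_M(x) / w_M(x+1)) (w''_{M,0}(x+1) / w''_{M,0}(x))`. -/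
noncomputable def BD (l : MIParams) (d : Fin M → ℕ) (x : 𝕜) : 𝕜 :=
  (l.alpha : 𝕜) * l.B' (x + (M : 𝕜)) * (l.w d x / l.w d (x + 1))
    * (l.w'' d 0 (x + 1) / l.w'' d 0 x)

/-- The deformed potential function
`D_𝒟(x) = α D'(x) (w_M(x+1) / w_M(x)) (w''_{M,0}(x-1) / w''_{M,0}(x))`. -/
noncomputable def DD (l : MIParams) (d : Fin M → ℕ) (x : 𝕜) : 𝕜 :=
  (l.alpha : 𝕜) * l.D x * (l.w d (x + 1) / l.w d x)
    * (l.w'' d 0 (x - 1) / l.w'' d 0 x)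

/-- `B̂_{d₁…d_s}(x) = α B'(x+s-1) (w_{s-1}(x) / w_{s-1}(x+1)) (w_s(x+1) / w_s(x))`,
with `s = m + 1`. -/
noncomputable def hatB {m : ℕ} (l : MIParams) (d : Fin (m + 1) → ℕ) (x : 𝕜) : 𝕜 :=
  (l.alpha : 𝕜) * l.B' (x + (m : 𝕜))
    * (l.w (fun j : Fin m => d j.castSucc) x / l.w (fun j : Fin m => d j.castSucc) (x + 1))
    * (l.w d (x + 1) / l.w d x)

/-- `D̂_{d₁…d_s}(x) = α D'(x) (w_{s-1}(x+1) / w_{s-1}(x)) (w_s(x-1) / w_s(x))`,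
with `s = m + 1`. -/
noncomputable def hatD {m : ℕ} (l : MIParams) (d : Fin (m + 1) → ℕ) (x : 𝕜) : 𝕜 :=
  (l.alpha : 𝕜) * l.D x
    * (l.w (fun j : Fin m => d j.castSucc) (x + 1) / l.w (fun j : Fin m => d j.castSucc) x)
    * (l.w d (x - 1) / l.w d x)

end Deformed

section Lattice

open LatticeOp

variable {M : ℕ}

/-- The undeformed Hamiltonian
`ℋ = -√B(x) e^∂ √D(x) - √D(x) e^{-∂} √B(x) + B(x) + D(x)`. -/
noncomputable def H (l : MIParams) : LatticeOp :=
  - (diag (fun x => √(l.B (x : ℝ))) * up * diag (fun x => √(l.D (x : ℝ))))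
    - diag (fun x => √(l.D (x : ℝ))) * down * diag (fun x => √(l.B (x : ℝ)))
    + diag (fun x => l.B (x : ℝ) + l.D (x : ℝ))

/-- The Hamiltonian `ℋ_{d₁…d_M} = Â_{d₁…d_M} Â_{d₁…d_M}† + ℰ̃_{d_M}` after `M ≥ 1` deletions of
virtual state vectors, and `ℋ` for `M = 0`. -/
noncomputable def HD (l : MIParams) : {M : ℕ} → (Fin M → ℕ) → LatticeOp
  | 0, _ => l.H
  | m + 1, d =>
      A (fun x => l.hatB d (x : ℝ)) (fun x => l.hatD d (x : ℝ))
          * Adag (fun x => l.hatB d (x : ℝ)) (fun x => l.hatD d (x : ℝ))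
        + l.tE (d (Fin.last m)) • 1

/-- The ground state eigenvector `φ₀(x; 𝝀) = ∏_{y < x} √(B(y) / D(y+1))`. -/
noncomputable def phi0 (l : MIParams) (x : ℕ) : ℝ :=
  ∏ y ∈ range x, √(l.B (y : ℝ) / l.D ((y : ℝ) + 1))

/-- `ψ_𝒟(x; 𝝀) = √Ξ̌_𝒟(1; 𝝀) φ₀(x; 𝝀 + M 𝜹̃) / √(Ξ̌_𝒟(x; 𝝀) Ξ̌_𝒟(x+1; 𝝀))`. -/
noncomputable def psi (l : MIParams) (d : Fin M → ℕ) (x : ℕ) : ℝ :=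
  √(l.Xi d (1 : ℝ)) * ((l.tshift M).phi0 x / √(l.Xi d (x : ℝ) * l.Xi d ((x : ℝ) + 1)))

/-- The forward shift operator
`ℱ_𝒟(𝝀) = √B_𝒟(0; 𝝀) ψ_𝒟(x; 𝝀 + 𝜹)⁻¹ ∘ 𝒜_𝒟(𝝀) ∘ ψ_𝒟(x; 𝝀)`. -/
noncomputable def forwardD (l : MIParams) (d : Fin M → ℕ) : LatticeOp :=
  √(l.BD d (0 : ℝ)) • (diag (fun x => (l.shift.psi d x)⁻¹)
    * A (fun x => l.BD d (x : ℝ)) (fun x => l.DD d (x : ℝ)) * diag (l.psi d))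

/-- The backward shift operator
`ℬ_𝒟(𝝀) = B_𝒟(0; 𝝀)^{-1/2} ψ_𝒟(x; 𝝀)⁻¹ ∘ 𝒜_𝒟(𝝀)† ∘ ψ_𝒟(x; 𝝀 + 𝜹)`. -/
noncomputable def backwardD (l : MIParams) (d : Fin M → ℕ) : LatticeOp :=
  (1 / √(l.BD d (0 : ℝ))) • (diag (fun x => (l.psi d x)⁻¹)
    * Adag (fun x => l.BD d (x : ℝ)) (fun x => l.DD d (x : ℝ)) * diag (l.shift.psi d))

/-- The similarity transformed Hamiltonian `ℋ̃_𝒟 = ψ_𝒟(x)⁻¹ ∘ ℋ_𝒟 ∘ ψ_𝒟(x)`. -/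
noncomputable def HtD (l : MIParams) (d : Fin M → ℕ) : LatticeOp :=
  diag (fun x => (l.psi d x)⁻¹) * l.HD d * diag (l.psi d)

end Lattice

/-- The virtual state energies of `𝒟` are pairwise distinct. This can fail only for little
`q`-Jacobi, and there it means that `a ≠ b q^{d_j + d_k + 1}` for `j ≠ k`; otherwise
the Casoratian `w_M` vanishes identically and `Ξ̌_𝒟` is not defined. -/
def NonDegenerate {M : ℕ} (l : MIParams) (d : Fin M → ℕ) : Prop :=
  ∀ j k : Fin M, j ≠ k → match l with
    | meixner _ _ => True
    | littleQJacobi q a b => a ≠ b * q ^ (d j + d k + 1)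
    | littleQLaguerre _ _ => True

end MIParams

/-! # Multi-indexed Meixner and little q-Jacobi, q-Laguerre polynomials on the lattice -/

/-! On the lattice the virtual states ξ_v and the products ν P_n solve one and the same three-term
recurrence, with off-diagonal coefficients αB' and αD and diagonal B + D; only the energy differs,
being ℰ̃_v or ℰ_n. For ν P_n this is the gauge effect of ν(x+1) = αν(x); for ξ_v it rests on the
identity B + D = α(B' + D) + α'. Dividing one solution by another and taking forward differences is
a Darboux transformation (`ThreeTerm.darboux`), and it is also the way a Casorati determinant loses
one order (`latticeCasoratian_succ`). Iterated, this shows that the determinants w''_{M,n} solve a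
three-term recurrence again (`latticeCasoratian_threeTerm`).

Since D(0) = 0, a solution is determined by its value at 0, and a Sturm comparison holds: below the
energy of a positive solution u, a solution f with f(0) > 0 stays positive and so does its Wronskian
with u. The energies ℰ̃_v are negative, while ν is positive with energy 0. Sorting the energies in
decreasing order and reducing the order repeatedly, w_M never changes sign (`w_mul_w_zero_pos`). At
x = 0 the determinants are of Vandermonde type in the energies, and the normalisation constants are
chosen to match. This gives Ξ̌_𝒟 > 0 and the value 1 at the origin.

Because η(x+j) is affine in η(x), w_M and w''_{M,n}/ν are polynomials in η(x). They are divisible by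
the power of ρ^x = 1 - κη(x) that must be removed, by an expansion of the determinant into monomials
(`X_pow_dvd_det_dilation`). As η takes infinitely many values on the lattice, polynomial identities
in η proved there hold for all real or complex x.

The link between 𝝀 and 𝝀 + 𝜹 is `xi_forward`: ξ_v(x+1) - αξ_v(x) is a multiple of the virtual state
at 𝝀 + 𝜹. Reducing w''_{M,0} by ν therefore gives a multiple of ν times the shifted w_M, so P̌_{𝒟,0}
is Ξ̌_𝒟 at 𝝀 + 𝜹, and the formulas for B_𝒟 and D_𝒟 follow. For n = 0 the recurrence has energy 0,
which forces its diagonal to be B_𝒟 + D_𝒟; hence ℋ_𝒟 = 𝒜_𝒟†𝒜_𝒟. Conjugation by ψ_𝒟 gives the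
difference operator, and the recurrence for general n becomes the eigenvalue equation. -/

/-- The Casorati determinant of sequences on the lattice. -/
def latticeCasoratian {n : ℕ} (f : Fin n → ℕ → ℝ) (x : ℕ) : ℝ :=
  (Matrix.of fun j k : Fin n => f k (x + (j : ℕ))).det

/-! ### Three-term recurrences on the lattice: order reduction, Darboux transformation, comparison
-/

/-- `f` solves the three-term recurrence with coefficients `a`, `b`, `c` and energy `e`. -/
def ThreeTerm (a b c : ℕ → ℝ) (e : ℝ) (f : ℕ → ℝ) : Prop :=
  ∀ x, a x * f (x + 1) + b x * f (x - 1) = (c x - e) * f x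

/-- The forward differences of the ratios `f_k / f_0`. -/
noncomputable def ratioDiff (u f : ℕ → ℝ) (x : ℕ) : ℝ := f (x + 1) / u (x + 1) - f x / u x

theorem latticeCasoratian_mul {n : ℕ} (f : Fin n → ℕ → ℝ) (u : ℕ → ℝ) (r : Fin n → ℝ) (x : ℕ) :
    latticeCasoratian (fun k y => r k * (u y * f k y)) x
      = (∏ k, r k) * ((∏ j ∈ range n, u (x + j)) * latticeCasoratian f x) := by
  rw [latticeCasoratian, latticeCasoratian, ← Fin.prod_univ_eq_prod_range (fun j => u (x + j)),
    ← Matrix.det_mul_column, ← Matrix.det_mul_row]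
  rfl

theorem latticeCasoratian_perm {n : ℕ} (f : Fin n → ℕ → ℝ) (σ : Equiv.Perm (Fin n)) (x : ℕ) :
    latticeCasoratian (fun k => f (σ k)) x
      = ((Equiv.Perm.sign σ : ℤ) : ℝ) * latticeCasoratian f x :=
  Matrix.det_permute' σ (Matrix.of fun j k : Fin n => f k (x + (j : ℕ)))

theorem latticeCasoratian_zero (f : Fin 0 → ℕ → ℝ) (x : ℕ) : latticeCasoratian f x = 1 := by
  simp [latticeCasoratian]

theorem latticeCasoratian_one (f : Fin 1 → ℕ → ℝ) (x : ℕ) : latticeCasoratian f x = f 0 x := by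
  simp [latticeCasoratian]

/-- Reduction of the order of a Casorati determinant. -/
theorem latticeCasoratian_succ {n : ℕ} (f : Fin (n + 1) → ℕ → ℝ) (h0 : ∀ x, f 0 x ≠ 0) (x : ℕ) :
    latticeCasoratian f x = (∏ j ∈ range (n + 1), f 0 (x + j))
      * latticeCasoratian (fun k : Fin n => ratioDiff (f 0) (f k.succ)) x := by
  have h1 : latticeCasoratian f x = (∏ j ∈ range (n + 1), f 0 (x + j))
      * latticeCasoratian (fun k y => f k y / f 0 y) x := by
    have := latticeCasoratian_mul (fun k y => f k y / f 0 y) (f 0) (fun _ => 1) x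
    simp only [prod_const_one, one_mul] at this
    rw [← this]
    congr 1
    funext k y
    field_simp [h0 y]
  rw [h1]
  congr 1
  -- After dividing by f₀, subtracting from each row its predecessor turns the first column into (1,
  -- 0, …, 0) and leaves the forward differences in the remaining block.
  let N : Matrix (Fin (n + 1)) (Fin (n + 1)) ℝ := Matrix.of fun j k =>
    Fin.cases (f k x / f 0 x) (fun i : Fin n => ratioDiff (f 0) (f k) (x + i)) j
  have h2 : latticeCasoratian (fun k y => f k y / f 0 y) x = N.det := by
    refine Matrix.det_eq_of_forall_row_eq_smul_add_pred (fun _ => 1) ?_ ?_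
    · intro j
      simp [N]
    · intro i j
      simp [N, ratioDiff, add_assoc]
  have hz : ∀ i : Fin n, N i.succ 0 = 0 := by
    intro i
    simp [N, ratioDiff, div_self (h0 _)]
  rw [h2, Matrix.det_succ_column_zero, Fin.sum_univ_succ]
  simp only [hz, mul_zero, zero_mul, sum_const_zero, add_zero]
  have : N 0 0 = 1 := by simp [N, div_self (h0 _)]
  rw [this]
  simp only [Fin.val_zero, pow_zero, one_mul]
  rfl

theorem ThreeTerm.wronskian {a b c : ℕ → ℝ} {e₀ e : ℝ} {u f : ℕ → ℝ}
    (hu : ThreeTerm a b c e₀ u) (hf : ThreeTerm a b c e f) (x : ℕ) :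
    a x * (u x * f (x + 1) - u (x + 1) * f x)
      = b x * (u (x - 1) * f x - u x * f (x - 1)) + (e₀ - e) * (u x * f x) := by
  linear_combination u x * hf x - f x * hu x

/-- The Darboux transformation of a three-term recurrence. -/
theorem ThreeTerm.darboux {a b c : ℕ → ℝ} {e₀ e : ℝ} {u f : ℕ → ℝ} (hb : b 0 = 0)
    (hu0 : ∀ x, u x ≠ 0) (hu : ThreeTerm a b c e₀ u) (hf : ThreeTerm a b c e f) :
    ThreeTerm (fun x => a (x + 1) * (u (x + 2) / u (x + 1))) (fun x => b x * (u (x - 1) / u x))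
      (fun x => a x * (u (x + 1) / u x) + b (x + 1) * (u x / u (x + 1)) + e₀) e
      (ratioDiff u f) := by
  have key : ∀ x, ratioDiff u f x = (u x * f (x + 1) - u (x + 1) * f x) / (u x * u (x + 1)) := by
    intro x
    rw [ratioDiff]
    field_simp [hu0 x, hu0 (x + 1)]
  intro x
  have h1 := hu.wronskian hf x
  have h2 := hu.wronskian hf (x + 1)
  simp only [Nat.add_sub_cancel] at h2
  have hx := hu0 x
  have hx1 := hu0 (x + 1)
  have hx2 := hu0 (x + 2)
  have h3 : b x * (u (x - 1) / u x) * ratioDiff u f (x - 1)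
      = b x * (u (x - 1) * f x - u x * f (x - 1)) / u x ^ 2 := by
    cases x with
    | zero => simp [hb]
    | succ y =>
      rw [key]
      simp only [Nat.add_sub_cancel]
      field_simp [hu0 y]
  simp only
  rw [h3, key, key]
  -- The Wronskian identity at x removes the b x term and the one at x + 1 removes the a (x + 1)
  -- term; what is left are multiples of the Wronskian at x, which form the new diagonal.
  have h4 : b x * (u (x - 1) * f x - u x * f (x - 1))
      = a x * (u x * f (x + 1) - u (x + 1) * f x) - (e₀ - e) * (u x * f x) := by linarith
  rw [h4]
  have h5 : a (x + 1) * (u (x + 2) / u (x + 1)) *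
      ((u (x + 1) * f (x + 1 + 1) - u (x + 1 + 1) * f (x + 1)) / (u (x + 1) * u (x + 1 + 1)))
      = (a (x + 1) * (u (x + 1) * f (x + 1 + 1) - u (x + 1 + 1) * f (x + 1))) / u (x + 1) ^ 2 := by
    field_simp
  rw [h5, h2]
  field_simp
  ring

/-- Sturm comparison. In the Wronskian identity both terms on the right are nonnegative, the first
by induction and the second because e < e₀; the induction starts because b 0 = 0. A positive
Wronskian in turn carries the positivity of f to the next point. -/
theorem ThreeTerm.comparison {a b c : ℕ → ℝ} {e₀ e : ℝ} {u f : ℕ → ℝ} (ha : ∀ x, 0 < a x)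
    (hb0 : b 0 = 0) (hb : ∀ x, 0 ≤ b x) (hupos : ∀ x, 0 < u x) (hu : ThreeTerm a b c e₀ u)
    (hf : ThreeTerm a b c e f) (he : e < e₀) (hf0 : 0 < f 0) (x : ℕ) :
    0 < f x ∧ 0 < u x * f (x + 1) - u (x + 1) * f x := by
  induction x with
  | zero =>
    refine ⟨hf0, ?_⟩
    have h := hu.wronskian hf 0
    rw [hb0, zero_mul, zero_add (_ * _)] at h
    have : 0 < (e₀ - e) * (u 0 * f 0) := mul_pos (by linarith) (mul_pos (hupos 0) hf0)
    exact pos_of_mul_pos_right (show 0 < a 0 * _ by rw [h]; exact this) (ha 0).le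
  | succ y ih =>
    have h1 : 0 < f (y + 1) := by
      have : 0 < u (y + 1) * f y := mul_pos (hupos _) ih.1
      exact pos_of_mul_pos_right (show 0 < u y * f (y + 1) by linarith [ih.2]) (hupos y).le
    refine ⟨h1, ?_⟩
    have h := hu.wronskian hf (y + 1)
    simp only [Nat.add_sub_cancel] at h
    have h2 : 0 < (e₀ - e) * (u (y + 1) * f (y + 1)) :=
      mul_pos (by linarith) (mul_pos (hupos _) h1)
    have h3 : 0 ≤ b (y + 1) * (u y * f (y + 1) - u (y + 1) * f y) := mul_nonneg (hb _) ih.2.le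
    exact pos_of_mul_pos_right (show 0 < a (y + 1) * _ by rw [h]; linarith) (ha _).le

theorem ratioDiff_pos {u f : ℕ → ℝ} (hu : ∀ x, 0 < u x) {x : ℕ}
    (h : 0 < u x * f (x + 1) - u (x + 1) * f x) : 0 < ratioDiff u f x := by
  rw [ratioDiff, div_sub_div _ _ (hu _).ne' (hu _).ne']
  exact div_pos (by linarith) (mul_pos (hu _) (hu _))

/-- The first solution has the highest energy, so by comparison all its ratio differences with the
others are positive. These solve the Darboux-transformed recurrence with the remaining energies,
still in decreasing order, and the induction applies to them; this is why the coefficients vary with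
the induction. -/
theorem latticeCasoratian_pos_of_strictAnti {n : ℕ} : ∀ {a b c : ℕ → ℝ} {e : Fin (n + 1) → ℝ}
    {f : Fin (n + 1) → ℕ → ℝ}, (∀ x, 0 < a x) → b 0 = 0 → (∀ x, 0 ≤ b x) →
    (∀ k, ThreeTerm a b c (e k) (f k)) → StrictAnti e → (∀ k, 0 < f k 0) → (∀ x, 0 < f 0 x) →
    ∀ x, 0 < latticeCasoratian f x := by
  induction n with
  | zero =>
    intro a b c e f _ _ _ _ _ _ hpos x
    rw [latticeCasoratian_one]
    exact hpos x
  | succ n ih =>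
    intro a b c e f ha hb0 hb hf he hf0 hpos x
    rw [latticeCasoratian_succ f (fun x => (hpos x).ne')]
    refine mul_pos (prod_pos fun j _ => hpos _) ?_
    have hcmp : ∀ (k : Fin (n + 1)) (x : ℕ), 0 < ratioDiff (f 0) (f k.succ) x := fun k x =>
      ratioDiff_pos hpos ((hf 0).comparison ha hb0 hb hpos (hf k.succ)
        (he (Fin.succ_pos k)) (hf0 _) x).2
    refine ih (e := fun k => e k.succ) ?_ ?_ ?_
      (fun k => (hf 0).darboux hb0 (fun x => (hpos x).ne') (hf k.succ)) ?_
      (fun k => hcmp k 0) (hcmp 0) x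
    · exact fun y => mul_pos (ha _) (div_pos (hpos _) (hpos _))
    · simp [hb0]
    · exact fun y => mul_nonneg (hb _) (div_pos (hpos _) (hpos _)).le
    · exact fun i j hij => he (Fin.succ_lt_succ_iff.2 hij)

/-- The sign of the Casorati determinant of solutions with energies below that of a positive
solution does not change on the lattice. -/
theorem latticeCasoratian_mul_zero_pos {n : ℕ} {a b c : ℕ → ℝ} {e : Fin n → ℝ}
    {f : Fin n → ℕ → ℝ} {e₀ : ℝ} {u : ℕ → ℝ} (ha : ∀ x, 0 < a x) (hb0 : b 0 = 0)
    (hb : ∀ x, 0 ≤ b x) (hf : ∀ k, ThreeTerm a b c (e k) (f k)) (he : Function.Injective e)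
    (hf0 : ∀ k, 0 < f k 0) (hu : ThreeTerm a b c e₀ u) (hupos : ∀ x, 0 < u x)
    (hlt : ∀ k, e k < e₀) (x : ℕ) :
    0 < latticeCasoratian f x * latticeCasoratian f 0 := by
  cases n with
  | zero => simp [latticeCasoratian_zero]
  | succ n =>
    obtain ⟨σ, hσ⟩ : ∃ σ : Equiv.Perm (Fin (n + 1)), StrictAnti (e ∘ σ) := by
      refine ⟨Tuple.sort (fun k => - e k), ?_⟩
      have hm := Tuple.monotone_sort (fun k => - e k)
      have hs : StrictMono ((fun k => - e k) ∘ Tuple.sort (fun k => - e k)) :=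
        hm.strictMono_of_injective
          ((neg_injective.comp he).comp (Tuple.sort (fun k => - e k)).injective)
      intro i j hij
      have := hs hij
      simpa using this
    have hp := latticeCasoratian_pos_of_strictAnti (f := fun k => f (σ k)) ha hb0 hb
      (fun k => hf (σ k)) hσ (fun k => hf0 _)
      (fun y => (hu.comparison ha hb0 hb hupos (hf _) (hlt _) (hf0 _) y).1)
    -- The sign of the sorting permutation occurs twice in the product of the values at x and 0, and
    -- so drops out.
    have h := mul_pos (hp x) (hp 0)
    rw [latticeCasoratian_perm, latticeCasoratian_perm] at h
    have hs : ((Equiv.Perm.sign σ : ℤ) : ℝ) * ((Equiv.Perm.sign σ : ℤ) : ℝ) = 1 := by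
      rw [← Int.cast_mul, ← Units.val_mul, Int.units_mul_self]; simp
    calc (0 : ℝ) < _ := h
      _ = (((Equiv.Perm.sign σ : ℤ) : ℝ) * ((Equiv.Perm.sign σ : ℤ) : ℝ))
          * (latticeCasoratian f x * latticeCasoratian f 0) := by ring
      _ = _ := by rw [hs, one_mul]

theorem prod_shift_div {u : ℕ → ℝ} (h0 : ∀ x, u x ≠ 0) (n y : ℕ) :
    ∏ j ∈ range n, u (y + 1 + j) = (∏ j ∈ range n, u (y + j)) * (u (y + n) / u y) := by
  rw [mul_div_assoc', eq_div_iff (h0 y), ← prod_range_succ (fun j => u (y + j)), prod_range_succ']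
  simp only [add_zero]
  congr 1
  exact prod_congr rfl fun j _ => by rw [add_assoc, add_comm 1 j]

/-- The equation satisfied by the Casorati determinants of solutions of a three-term recurrence. -/
theorem latticeCasoratian_threeTerm {m : ℕ} : ∀ {a b c : ℕ → ℝ} {e : Fin (m + 2) → ℝ}
    {f : Fin (m + 2) → ℕ → ℝ}, b 0 = 0 → (∀ k, ThreeTerm a b c (e k) (f k)) →
    (∀ (s : ℕ) (hs : s ≤ m + 2) (x : ℕ), s < m + 2 →
      latticeCasoratian (fun k => f (Fin.castLE hs k)) x ≠ 0) →
    ThreeTerm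
      (fun x => a (x + (m + 1)) * (latticeCasoratian (fun k => f k.castSucc) x
        / latticeCasoratian (fun k => f k.castSucc) (x + 1)))
      (fun x => b x * (latticeCasoratian (fun k => f k.castSucc) (x + 1)
        / latticeCasoratian (fun k => f k.castSucc) x))
      (fun x => a (x + m) * (latticeCasoratian (fun k => f k.castSucc.castSucc) x
          / latticeCasoratian (fun k => f k.castSucc.castSucc) (x + 1))
          * (latticeCasoratian (fun k => f k.castSucc) (x + 1)
          / latticeCasoratian (fun k => f k.castSucc) x)
        + b (x + 1) * (latticeCasoratian (fun k => f k.castSucc.castSucc) (x + 2)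
          / latticeCasoratian (fun k => f k.castSucc.castSucc) (x + 1))
          * (latticeCasoratian (fun k => f k.castSucc) x
          / latticeCasoratian (fun k => f k.castSucc) (x + 1))
        + e (Fin.last m).castSucc)
      (e (Fin.last (m + 1))) (latticeCasoratian f) := by
  induction m with
  | zero =>
    intro a b c e f hb hf hne x
    have h0 : ∀ x, f 0 x ≠ 0 := by
      intro x
      have := hne 1 (by norm_num) x (by norm_num)
      rw [latticeCasoratian_one] at this
      exact this
    have hG : ∀ x, latticeCasoratian f x
        = f 0 x * f 0 (x + 1) * ratioDiff (f 0) (f 1) x := by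
      intro x
      rw [latticeCasoratian_succ f h0, latticeCasoratian_one]
      simp [prod_range_succ]
    have hd := (hf 0).darboux hb h0 (hf 1) x
    simp only [latticeCasoratian_one, latticeCasoratian_zero, hG] at hd ⊢
    simp only [Fin.castSucc_zero, zero_add, add_zero, Fin.isValue, div_one, mul_one,
      Fin.last_zero] at hd ⊢
    have e1 : (Fin.last 1) = (1 : Fin 2) := rfl
    rw [e1]
    have hx := h0 x
    have hx1 := h0 (x + 1)
    have hx2 := h0 (x + 2)
    have h3 : b x * (f 0 (x + 1) / f 0 x)
        * (f 0 (x - 1) * f 0 (x - 1 + 1) * ratioDiff (f 0) (f 1) (x - 1))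
        = f 0 x * f 0 (x + 1)
          * (b x * (f 0 (x - 1) / f 0 x) * ratioDiff (f 0) (f 1) (x - 1)) := by
      cases x with
      | zero => simp [hb]
      | succ y =>
        simp only [Nat.add_sub_cancel]
        field_simp
    rw [h3]
    have h4 : a (x + 1) * (f 0 x / f 0 (x + 1))
        * (f 0 (x + 1) * f 0 (x + 1 + 1) * ratioDiff (f 0) (f 1) (x + 1))
        = f 0 x * f 0 (x + 1)
          * (a (x + 1) * (f 0 (x + 2) / f 0 (x + 1)) * ratioDiff (f 0) (f 1) (x + 1)) := by
      field_simp
    rw [h4, ← mul_add, hd]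
    ring
  | succ m ih =>
    intro a b c e f hb hf hne x
    have h0 : ∀ x, f 0 x ≠ 0 := by
      intro x
      have := hne 1 (by omega) x (by omega)
      rw [latticeCasoratian_one] at this
      exact this
    set h : Fin (m + 2) → ℕ → ℝ := fun k => ratioDiff (f 0) (f k.succ) with hh
    have hd := fun k : Fin (m + 2) => (hf 0).darboux hb h0 (hf k.succ)
    have hG : ∀ x, latticeCasoratian f x
        = (∏ j ∈ range (m + 3), f 0 (x + j)) * latticeCasoratian h x :=
      fun x => latticeCasoratian_succ f h0 x
    have hW : ∀ x, latticeCasoratian (fun k : Fin (m + 2) => f k.castSucc) x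
        = (∏ j ∈ range (m + 2), f 0 (x + j))
          * latticeCasoratian (fun k : Fin (m + 1) => h k.castSucc) x :=
      fun x => latticeCasoratian_succ (fun k : Fin (m + 2) => f k.castSucc) h0 x
    have hV : ∀ x, latticeCasoratian (fun k : Fin (m + 1) => f k.castSucc.castSucc) x
        = (∏ j ∈ range (m + 1), f 0 (x + j))
          * latticeCasoratian (fun k : Fin m => h k.castSucc.castSucc) x :=
      fun x => latticeCasoratian_succ (fun k : Fin (m + 1) => f k.castSucc.castSucc) h0 x
    have hhne : ∀ (s : ℕ) (hs : s ≤ m + 2) (x : ℕ), s < m + 2 →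
        latticeCasoratian (fun k => h (Fin.castLE hs k)) x ≠ 0 := by
      intro s hs x hlt
      have h1 := hne (s + 1) (by omega) x (by omega)
      rw [latticeCasoratian_succ _ (by exact h0)] at h1
      exact (mul_ne_zero_iff.1 h1).2
    -- The reduced family has one member fewer and solves the Darboux-transformed recurrence. It
    -- remains to compare, term by term, the coefficients belonging to f and to h: the prefactors ∏
    -- f₀(x + j) telescope to the quotients of values of f₀ that the transformation has introduced.
    have key := ih (e := fun k => e k.succ) (f := h) (by simp [hb]) hd hhne x
    have hh1 : ∀ y, latticeCasoratian (fun k : Fin (m + 1) => h k.castSucc) y ≠ 0 :=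
      fun y => hhne (m + 1) (by omega) y (by omega)
    have hh0 : ∀ y, latticeCasoratian (fun k : Fin m => h k.castSucc.castSucc) y ≠ 0 :=
      fun y => hhne m (by omega) y (by omega)
    have hpne : ∀ (n y : ℕ), (∏ j ∈ range n, f 0 (y + j)) ≠ 0 :=
      fun n y => prod_ne_zero_iff.2 fun j _ => h0 _
    have hprod : ∀ (n y : ℕ), (∏ j ∈ range n, f 0 (y + 1 + j))
        = (∏ j ∈ range n, f 0 (y + j)) * (f 0 (y + n) / f 0 y) :=
      prod_shift_div h0
    have t1 : a (x + (m + 1 + 1)) * (latticeCasoratian (fun k => f k.castSucc) x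
          / latticeCasoratian (fun k => f k.castSucc) (x + 1)) * latticeCasoratian f (x + 1)
        = (∏ j ∈ range (m + 3), f 0 (x + j)) * (a (x + (m + 1) + 1)
          * (f 0 (x + (m + 1) + 2) / f 0 (x + (m + 1) + 1))
          * (latticeCasoratian (fun k => h k.castSucc) x
            / latticeCasoratian (fun k => h k.castSucc) (x + 1)) * latticeCasoratian h (x + 1)) := by
      rw [hG, hW, hW, hprod, hprod]
      have i1 := hh1 (x + 1)
      have i2 := hpne (m + 2) x
      have i3 := h0 x
      have i4 := h0 (x + (m + 2))
      simp only [← add_assoc] at i4 ⊢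
      field_simp
    have t2 : b x * (latticeCasoratian (fun k => f k.castSucc) (x + 1)
          / latticeCasoratian (fun k => f k.castSucc) x) * latticeCasoratian f (x - 1)
        = (∏ j ∈ range (m + 3), f 0 (x + j)) * (b x * (f 0 (x - 1) / f 0 x)
          * (latticeCasoratian (fun k => h k.castSucc) (x + 1)
            / latticeCasoratian (fun k => h k.castSucc) x) * latticeCasoratian h (x - 1)) := by
      cases x with
      | zero => simp [hb]
      | succ y =>
        rw [hG, hW, hW, hprod (m + 2), hprod (m + 3)]
        simp only [Nat.add_sub_cancel]
        have i1 := hh1 (y + 1)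
        have i2 := hpne (m + 2) (y + 1)
        have i3 := h0 y
        have i5 := h0 (y + 1)
        have i4 := h0 (y + (m + 3))
        rw [show y + 1 + (m + 2) = y + (m + 3) by ring]
        field_simp
    have t3 : a (x + (m + 1)) * (latticeCasoratian (fun k => f k.castSucc.castSucc) x
          / latticeCasoratian (fun k => f k.castSucc.castSucc) (x + 1))
          * (latticeCasoratian (fun k => f k.castSucc) (x + 1)
          / latticeCasoratian (fun k => f k.castSucc) x)
        = a (x + m + 1) * (f 0 (x + m + 2) / f 0 (x + m + 1))
          * (latticeCasoratian (fun k => h k.castSucc.castSucc) x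
            / latticeCasoratian (fun k => h k.castSucc.castSucc) (x + 1))
          * (latticeCasoratian (fun k => h k.castSucc) (x + 1)
            / latticeCasoratian (fun k => h k.castSucc) x) := by
      rw [hV, hV, hW, hW, hprod, hprod]
      have i0 := hh0 (x + 1)
      have i1 := hh1 x
      have i2 := hpne (m + 2) x
      have i6 := hpne (m + 1) x
      have i3 := h0 x
      have i4 := h0 (x + (m + 1))
      simp only [← add_assoc] at i4 ⊢
      field_simp
    have t4 : b (x + 1) * (latticeCasoratian (fun k => f k.castSucc.castSucc) (x + 2)
          / latticeCasoratian (fun k => f k.castSucc.castSucc) (x + 1))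
          * (latticeCasoratian (fun k => f k.castSucc) x
          / latticeCasoratian (fun k => f k.castSucc) (x + 1))
        = b (x + 1) * (f 0 (x + 1 - 1) / f 0 (x + 1))
          * (latticeCasoratian (fun k => h k.castSucc.castSucc) (x + 2)
            / latticeCasoratian (fun k => h k.castSucc.castSucc) (x + 1))
          * (latticeCasoratian (fun k => h k.castSucc) x
            / latticeCasoratian (fun k => h k.castSucc) (x + 1)) := by
      rw [hV, hV, hW, hW, hprod (m + 2) x, hprod (m + 1) (x + 1)]
      have i0 := hh0 (x + 1)
      have i1 := hh1 (x + 1)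
      have i2 := hpne (m + 2) x
      have i6 := hpne (m + 1) (x + 1)
      have i3 := h0 x
      have i5 := h0 (x + 1)
      have i4 := h0 (x + (m + 2))
      rw [show x + 1 + (m + 1) = x + (m + 2) by ring, Nat.add_sub_cancel]
      field_simp
    simp only at key ⊢
    rw [t1, t2, t3, t4, ← mul_add, key, hG]
    simp only [Fin.succ_castSucc, Fin.succ_last]
    ring

/-! ### Uniqueness of solutions and Casorati determinants at the origin -/

theorem ThreeTerm.unique {a b c : ℕ → ℝ} {e r : ℝ} {f g : ℕ → ℝ} (ha : ∀ x, a x ≠ 0)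
    (hb0 : b 0 = 0) (hf : ThreeTerm a b c e f) (hg : ThreeTerm a b c e g)
    (h0 : f 0 = r * g 0) (x : ℕ) : f x = r * g x := by
  suffices f x = r * g x ∧ f (x + 1) = r * g (x + 1) from this.1
  induction x with
  | zero =>
    refine ⟨h0, mul_left_cancel₀ (ha 0) ?_⟩
    have h1 := hf 0
    have h2 := hg 0
    rw [hb0] at h1 h2
    linear_combination h1 - r * h2 + (c 0 - e) * h0
  | succ y ih =>
    refine ⟨ih.2, mul_left_cancel₀ (ha (y + 1)) ?_⟩
    have h1 := hf (y + 1)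
    have h2 := hg (y + 1)
    simp only [Nat.add_sub_cancel] at h1 h2
    linear_combination h1 - r * h2 + (c (y + 1) - e) * ih.2 - b (y + 1) * ih.1

/-- The monic polynomials in the energy attached to a three-term recurrence. -/
noncomputable def energyPoly (a b c : ℕ → ℝ) : ℕ → Polynomial ℝ
  | 0 => 1
  | 1 => Polynomial.X - Polynomial.C (c 0)
  | x + 2 => (Polynomial.X - Polynomial.C (c (x + 1))) * energyPoly a b c (x + 1)
      - Polynomial.C (a x * b (x + 1)) * energyPoly a b c x

theorem energyPoly_monic (a b c : ℕ → ℝ) (x : ℕ) :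
    (energyPoly a b c x).Monic ∧ (energyPoly a b c x).natDegree = x := by
  suffices ((energyPoly a b c x).Monic ∧ (energyPoly a b c x).natDegree = x)
    ∧ ((energyPoly a b c (x + 1)).Monic ∧ (energyPoly a b c (x + 1)).natDegree = x + 1) from this.1
  induction x with
  | zero =>
    simp only [energyPoly]
    exact ⟨⟨Polynomial.monic_one, Polynomial.natDegree_one⟩,
      Polynomial.monic_X_sub_C _, Polynomial.natDegree_X_sub_C _⟩
  | succ y ih =>
    refine ⟨ih.2, ?_⟩
    have hm : ((Polynomial.X - Polynomial.C (c (y + 1))) * energyPoly a b c (y + 1)).Monic :=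
      (Polynomial.monic_X_sub_C _).mul ih.2.1
    have hdeg : ((Polynomial.X - Polynomial.C (c (y + 1))) * energyPoly a b c (y + 1)).natDegree
        = y + 2 := by
      rw [(Polynomial.monic_X_sub_C _).natDegree_mul ih.2.1, Polynomial.natDegree_X_sub_C, ih.2.2]
      ring
    have hlt : (Polynomial.C (a y * b (y + 1)) * energyPoly a b c y).natDegree < y + 2 := by
      refine (Polynomial.natDegree_C_mul_le _ _).trans_lt ?_
      rw [ih.1.2]; omega
    rw [energyPoly]
    have hlt' : (Polynomial.C (a y * b (y + 1)) * energyPoly a b c y).degree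
        < ((Polynomial.X - Polynomial.C (c (y + 1))) * energyPoly a b c (y + 1)).degree := by
      rw [Polynomial.degree_eq_natDegree hm.ne_zero, hdeg]
      exact Polynomial.degree_le_natDegree.trans_lt (by exact_mod_cast hlt)
    refine ⟨hm.sub_of_left hlt', ?_⟩
    rw [Polynomial.natDegree_sub_eq_left_of_natDegree_lt (by rw [hdeg]; exact hlt), hdeg]

/-- With b 0 = 0 the value at x is a polynomial of degree x in the energy, with leading coefficient
∏ (-1 / a i). This dependence on e is what makes the determinant at the origin a Vandermonde
determinant. -/
theorem ThreeTerm.eq_energyPoly {a b c : ℕ → ℝ} {e : ℝ} {f : ℕ → ℝ} (ha : ∀ x, a x ≠ 0)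
    (hb0 : b 0 = 0) (hf : ThreeTerm a b c e f) (h0 : f 0 = 1) (x : ℕ) :
    f x = (∏ i ∈ range x, (-1 / a i)) * (energyPoly a b c x).eval e := by
  suffices f x = (∏ i ∈ range x, (-1 / a i)) * (energyPoly a b c x).eval e
    ∧ f (x + 1) = (∏ i ∈ range (x + 1), (-1 / a i)) * (energyPoly a b c (x + 1)).eval e from this.1
  induction x with
  | zero =>
    have h1 := hf 0
    rw [hb0, h0] at h1
    have := ha 0
    refine ⟨by simp [energyPoly, h0], ?_⟩
    simp only [energyPoly, zero_add, prod_range_one, Polynomial.eval_sub, Polynomial.eval_X,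
      Polynomial.eval_C]
    field_simp
    linarith
  | succ y ih =>
    refine ⟨ih.2, mul_left_cancel₀ (ha (y + 1)) ?_⟩
    have h1 := hf (y + 1)
    simp only [Nat.add_sub_cancel] at h1
    have e1 : a (y + 1) * f (y + 1 + 1) = (c (y + 1) - e) * f (y + 1) - b (y + 1) * f y := by
      linarith
    rw [e1, ih.1, ih.2, prod_range_succ _ (y + 1), prod_range_succ _ y]
    simp only [energyPoly, Polynomial.eval_sub, Polynomial.eval_X, Polynomial.eval_C,
      Polynomial.eval_mul]
    have := ha y
    have := ha (y + 1)
    field_simp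
    ring

/-- Row j consists of the values at the energies of one polynomial of degree j, up to a common
factor. For monic polynomials such a determinant is the Vandermonde determinant, and the factors -1
/ a i are distributed over the pairs j < k. -/
theorem latticeCasoratian_at_zero {n : ℕ} {a b c : ℕ → ℝ} {e : Fin n → ℝ} {f : Fin n → ℕ → ℝ}
    (ha : ∀ x, a x ≠ 0) (hb0 : b 0 = 0) (hf : ∀ k, ThreeTerm a b c (e k) (f k))
    (h0 : ∀ k, f k 0 = 1) :
    latticeCasoratian f 0 = ∏ k : Fin n, ∏ j ∈ Finset.Iio k, (e j - e k) / a j := by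
  have h1 : latticeCasoratian f 0 = (∏ j : Fin n, ∏ i ∈ range (j : ℕ), (-1 / a i))
      * (Matrix.of fun j k : Fin n => (energyPoly a b c j).eval (e k)).det := by
    rw [← Matrix.det_mul_column, latticeCasoratian]
    congr 1
    ext j k
    simp only [Matrix.of_apply, zero_add]
    exact (hf k).eq_energyPoly ha hb0 (h0 k) j
  have h2 : (Matrix.of fun j k : Fin n => (energyPoly a b c j).eval (e k)).det
      = (Matrix.vandermonde e).det := by
    rw [Matrix.det_eval_matrixOfPolynomials_eq_det_vandermonde e (fun i => energyPoly a b c i)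
      (fun i => (energyPoly_monic a b c i).2) (fun i => (energyPoly_monic a b c i).1),
      ← Matrix.det_transpose]
    rfl
  rw [h1, h2, Matrix.det_vandermonde, Finset.prod_comm' (t' := univ) (s' := fun k => Finset.Iio k)
    (by simp), ← prod_mul_distrib]
  refine prod_congr rfl fun k _ => ?_
  have h3 : ∏ i ∈ range (k : ℕ), (-1 / a i) = ∏ j ∈ Finset.Iio k, (-1 / a j) := by
    rw [← Fin.prod_univ_eq_prod_range (fun i => -1 / a i)]
    refine prod_bij (fun i _ => Fin.castLE k.2.le i) ?_ ?_ ?_ ?_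
    · intro i _
      simp [Fin.lt_def]
    · intro i _ j _ h
      simpa using h
    · intro j hj
      exact ⟨⟨j, by simpa using hj⟩, by simp, by simp⟩
    · simp
  rw [h3, ← prod_mul_distrib]
  refine prod_congr rfl fun j _ => ?_
  ring

/-! ### Powers with a real or complex exponent -/

section PosPow

variable {𝕜 : Type*} [RCLike 𝕜]

theorem posPow_add (r : ℝ) (x y : 𝕜) : posPow r (x + y) = posPow r x * posPow r y := by
  have : CharZero 𝕜 := RCLike.charZero_rclike
  let _ : NormedAlgebra ℚ 𝕜 := NormedAlgebra.restrictScalars ℚ ℝ 𝕜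
  rw [posPow, mul_add, NormedSpace.exp_add]
  rfl

theorem posPow_zero (r : ℝ) : posPow r (0 : 𝕜) = 1 := by
  rw [posPow, mul_zero, NormedSpace.exp_zero]

theorem posPow_neg_mul (r : ℝ) (x : 𝕜) : posPow r (-x) * posPow r x = 1 := by
  rw [← posPow_add, neg_add_cancel, posPow_zero]

theorem posPow_ne_zero (r : ℝ) (x : 𝕜) : posPow r x ≠ 0 :=
  right_ne_zero_of_mul_eq_one (posPow_neg_mul r x)

theorem posPow_neg (r : ℝ) (x : 𝕜) : posPow r (-x) = (posPow r x)⁻¹ :=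
  eq_inv_of_mul_eq_one_left (posPow_neg_mul r x)

theorem posPow_one_base (x : 𝕜) : posPow 1 x = 1 := by
  rw [posPow, Real.log_one, RCLike.ofReal_zero, zero_mul, NormedSpace.exp_zero]

theorem posPow_mul_base {r s : ℝ} (hr : r ≠ 0) (hs : s ≠ 0) (x : 𝕜) :
    posPow (r * s) x = posPow r x * posPow s x := by
  have : CharZero 𝕜 := RCLike.charZero_rclike
  let _ : NormedAlgebra ℚ 𝕜 := NormedAlgebra.restrictScalars ℚ ℝ 𝕜
  rw [posPow, posPow, posPow, Real.log_mul hr hs, RCLike.ofReal_add, add_mul, NormedSpace.exp_add]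

theorem posPow_ofReal (r x : ℝ) : posPow r (x : 𝕜) = ((posPow r x : ℝ) : 𝕜) := by
  rw [posPow, posPow, ← RCLike.ofReal_mul]
  exact (NormedSpace.algebraMap_exp_comm (𝕂 := ℝ) (𝔸 := 𝕜) _).symm

theorem posPow_natCast {r : ℝ} (hr : 0 < r) (n : ℕ) : posPow r (n : 𝕜) = (r : 𝕜) ^ n := by
  have h := posPow_ofReal (𝕜 := 𝕜) r n
  rw [posPow_real hr, Real.rpow_natCast] at h
  simpa using h

theorem posPow_pos {r : ℝ} (hr : 0 < r) (x : ℝ) : 0 < posPow r x := by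
  rw [posPow_real hr]
  exact Real.rpow_pos_of_pos hr x

end PosPow

/-! ### The three systems in the common notation ρ, κ, slope, base -/

namespace MIParams

/-- The parameters for which the polynomials `P̌_n` are well defined. -/
def Regular : MIParams → Prop
  | meixner β c => 0 < β ∧ c ≠ 0
  | littleQJacobi q a b => 0 < q ∧ q < 1 ∧ a ≠ 0 ∧ b * q < 1
  | littleQLaguerre q a => 0 < q ∧ q < 1 ∧ a ≠ 0

/-- The base `1` or `q`. -/
def rho : MIParams → ℝ
  | meixner _ _ => 1
  | littleQJacobi q _ _ => q
  | littleQLaguerre q _ => q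

/-- The constant `κ` with `ρ^x = 1 - κ η(x)`. -/
def kap : MIParams → ℝ
  | meixner _ _ => 0
  | littleQJacobi _ _ _ => 1
  | littleQLaguerre _ _ => 1

/-- The slope of `ρ^x B(x) / α` as a function of `η(x)`. -/
def slope : MIParams → ℝ
  | meixner _ _ => 1
  | littleQJacobi q _ b => b * q
  | littleQLaguerre _ _ => 0

/-- The value of `B / α` at the origin. -/
def base : MIParams → ℝ
  | meixner β _ => β
  | littleQJacobi q _ b => 1 - b * q
  | littleQLaguerre _ _ => 1

theorem Admissible.regular {l : MIParams} (h : l.Admissible) : l.Regular := by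
  cases l with
  | meixner β c => exact ⟨h.1, h.2.1.ne'⟩
  | littleQJacobi q a b =>
    obtain ⟨h1, h2, h3, h4, h5⟩ := h
    exact ⟨h1, h2, h3.ne', by rwa [← lt_inv_mul_iff₀' h1, mul_one]⟩
  | littleQLaguerre q a => exact ⟨h.1, h.2.1, h.2.2.1.ne'⟩

/-- The reason for a range wider than the admissible one: the twist inverts c or a and can leave the
admissible range, yet ξ_v is P̌_v at the twisted parameters. -/
theorem Regular.twist {l : MIParams} (h : l.Regular) : l.twist.Regular := by
  cases l with
  | meixner β c => exact ⟨h.1, inv_ne_zero h.2⟩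
  | littleQJacobi q a b => exact ⟨h.1, h.2.1, inv_ne_zero h.2.2.1, h.2.2.2⟩
  | littleQLaguerre q a => exact ⟨h.1, h.2.1, inv_ne_zero h.2.2⟩

theorem Admissible.alpha_pos {l : MIParams} (h : l.Admissible) : 0 < l.alpha := by
  cases l with
  | meixner β c => exact h.2.1
  | littleQJacobi q a b => exact h.2.2.1
  | littleQLaguerre q a => exact h.2.2.1

theorem Regular.alpha_ne_zero {l : MIParams} (h : l.Regular) : l.alpha ≠ 0 := by
  cases l with
  | meixner β c => exact h.2
  | littleQJacobi q a b => exact h.2.2.1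
  | littleQLaguerre q a => exact h.2.2

theorem Regular.rho_pos {l : MIParams} (h : l.Regular) : 0 < l.rho := by
  cases l with
  | meixner β c => exact one_pos
  | littleQJacobi q a b => exact h.1
  | littleQLaguerre q a => exact h.1

theorem alpha_twist (l : MIParams) : l.twist.alpha = l.alpha⁻¹ := by cases l <;> rfl
theorem slope_twist (l : MIParams) : l.twist.slope = l.slope := by cases l <;> rfl
theorem base_twist (l : MIParams) : l.twist.base = l.base := by cases l <;> rfl
theorem rho_twist (l : MIParams) : l.twist.rho = l.rho := by cases l <;> rfl
theorem rho_shift (l : MIParams) : l.shift.rho = l.rho := by cases l <;> rfl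
theorem alpha_shift (l : MIParams) : l.shift.alpha = l.alpha * l.rho := by
  cases l <;> simp [shift, alpha, rho]
theorem alpha_tshift (l : MIParams) (M : ℕ) : (l.tshift M).alpha = l.alpha / l.rho ^ M := by
  cases l <;> simp [tshift, alpha, rho]
theorem alpha'_eq (l : MIParams) : l.alpha' = -(1 - l.alpha) * l.base := by
  cases l <;> simp [alpha', alpha, base]

section

variable {𝕜 : Type*} [RCLike 𝕜]

theorem eta_twist (l : MIParams) (x : 𝕜) : l.twist.eta x = l.eta x := by cases l <;> rfl
theorem eta_shift (l : MIParams) (x : 𝕜) : l.shift.eta x = l.eta x := by cases l <;> rfl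
theorem D_twist (l : MIParams) (x : 𝕜) : l.twist.D x = l.D x := by cases l <;> rfl
theorem D_shift (l : MIParams) (x : 𝕜) : l.shift.D x = l.D x := by cases l <;> rfl
theorem D_tshift (l : MIParams) (M : ℕ) (x : 𝕜) : (l.tshift M).D x = l.D x := by cases l <;> rfl

theorem posPow_rho (l : MIParams) (x : 𝕜) : posPow l.rho x = 1 - l.kap * l.eta x := by
  cases l <;> simp [rho, kap, eta, posPow_one_base]

/-- The addition law makes η(x + y) affine in η(x). The polynomiality of the Casorati determinants
and the shape of φ_M both come from it. -/
theorem eta_add (l : MIParams) (x y : 𝕜) : l.eta (x + y) = l.eta x + posPow l.rho x * l.eta y := by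
  cases l <;> simp only [rho, eta, posPow_one_base, posPow_add] <;> ring

theorem eta_zero (l : MIParams) : l.eta (0 : 𝕜) = 0 := by
  cases l <;> simp [eta, posPow_zero]

theorem eta_ofReal (l : MIParams) (x : ℝ) : l.eta (x : 𝕜) = ((l.eta x : ℝ) : 𝕜) := by
  cases l <;> simp [eta, posPow_ofReal]

theorem eta_natCast (l : MIParams) (n : ℕ) : l.eta (n : 𝕜) = ((l.eta (n : ℝ) : ℝ) : 𝕜) := by
  rw [← eta_ofReal, RCLike.ofReal_natCast]

theorem B_eq (l : MIParams) (x : 𝕜) :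
    l.B x = l.alpha * posPow l.rho (-x) * (l.slope * l.eta x + l.base) := by
  cases l with
  | meixner β c => simp [B, alpha, rho, slope, eta, base, posPow_one_base]
  | littleQJacobi q a b =>
    simp only [B, alpha, rho, slope, eta, base]
    push_cast
    linear_combination (a : 𝕜) * b * q * posPow_neg_mul q x
  | littleQLaguerre q a => simp [B, alpha, rho, slope, eta, base]

theorem D_eq (l : MIParams) (x : 𝕜) : l.D x = posPow l.rho (-x) * l.eta x := by
  cases l with
  | meixner β c => simp [D, rho, eta, posPow_one_base]
  | littleQJacobi q a b =>
    simp only [D, rho, eta]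
    linear_combination posPow_neg_mul q x
  | littleQLaguerre q a =>
    simp only [D, rho, eta]
    linear_combination posPow_neg_mul q x

end

theorem Regular.eta_natCast {l : MIParams} (h : l.Regular) (n : ℕ) :
    l.eta (n : ℝ) = match l with
      | meixner _ _ => (n : ℝ)
      | littleQJacobi q _ _ => 1 - q ^ n
      | littleQLaguerre q _ => 1 - q ^ n := by
  cases l with
  | meixner β c => rfl
  | littleQJacobi q a b => simp [eta, posPow_natCast h.1]
  | littleQLaguerre q a => simp [eta, posPow_natCast h.1]

theorem Regular.E_eq {l : MIParams} (h : l.Regular) (n : ℕ) :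
    l.E n = l.eta (n : ℝ) * ((l.rho ^ n)⁻¹ - l.alpha * l.slope) := by
  rw [h.eta_natCast]
  cases l with
  | meixner β c => simp [E, rho, alpha, slope, mul_comm]
  | littleQJacobi q a b =>
    have := pow_ne_zero n h.1.ne'
    simp only [E, rho, alpha, slope]
    field_simp
    ring
  | littleQLaguerre q a =>
    have := pow_ne_zero n h.1.ne'
    simp only [E, rho, alpha, slope]
    field_simp
    ring

theorem Regular.eta_strictMono {l : MIParams} (h : l.Regular) :
    StrictMono fun n : ℕ => l.eta (n : ℝ) := by
  intro m n hmn
  simp only [h.eta_natCast]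
  cases l with
  | meixner β c => simpa using hmn
  | littleQJacobi q a b =>
    have := pow_lt_pow_right_of_lt_one₀ h.1 h.2.1 hmn
    simp only
    linarith
  | littleQLaguerre q a =>
    have := pow_lt_pow_right_of_lt_one₀ h.1 h.2.1 hmn
    simp only
    linarith

theorem Regular.eta_pos {l : MIParams} (h : l.Regular) (n : ℕ) : 0 < l.eta ((n : ℝ) + 1) := by
  have := h.eta_strictMono (Nat.succ_pos n)
  simpa [eta_zero] using this

theorem Regular.slope_base_pos {l : MIParams} (h : l.Regular) (n : ℕ) :
    0 < l.slope * l.eta (n : ℝ) + l.base := by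
  rw [h.eta_natCast]
  cases l with
  | meixner β c =>
    simp only [slope, base]
    have := h.1
    positivity
  | littleQJacobi q a b =>
    simp only [slope, base]
    have h1 : q ^ n ≤ 1 := pow_le_one₀ h.1.le h.2.1.le
    have h2 : 0 < q ^ n := pow_pos h.1 n
    nlinarith [h.2.2.2, mul_pos h2 (sub_pos.2 h.2.2.2)]
  | littleQLaguerre q a => simp [slope, base]

/-! ### Newton expansion of P̌_n and its difference equation -/

/-- The coefficients of `P̌_n` in the Newton basis. -/
noncomputable def newtonCoeff (l : MIParams) (n k : ℕ) : ℝ :=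
  ∏ i ∈ range k, (l.E i - l.E n)
    / (l.alpha * l.eta ((i : ℝ) + 1) * (l.slope * l.eta (i : ℝ) + l.base))

/-- The Newton basis in the sinusoidal coordinate. -/
noncomputable def newtonPoly (l : MIParams) (k : ℕ) : Polynomial ℝ :=
  ∏ i ∈ range k, (Polynomial.X - Polynomial.C (l.eta (i : ℝ)))

/-- `P̌_n` as a polynomial in the sinusoidal coordinate. -/
noncomputable def Ppoly (l : MIParams) (n : ℕ) : Polynomial ℝ :=
  ∑ k ∈ range (n + 1), Polynomial.C (l.newtonCoeff n k) * l.newtonPoly k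

theorem ascPochhammer_eval_eq_prod {R : Type*} [CommRing R] (x : R) (k : ℕ) :
    (ascPochhammer R k).eval x = ∏ i ∈ range k, (x + i) := by
  induction k with
  | zero => simp
  | succ k ih => rw [ascPochhammer_succ_eval, ih, prod_range_succ]

/-- Every q-shifted or ordinary factorial is a product over i < k, so the k-th terms can be compared
factor by factor. Little q-Laguerre is left out because it is little q-Jacobi with b = 0. -/
theorem P_eq_aeval_of_ne_laguerre {𝕜 : Type*} [RCLike 𝕜] {l : MIParams} (h : l.Regular) (n : ℕ)
    (x : 𝕜) (hl : ∀ q a, l ≠ littleQLaguerre q a) :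
    l.P n x = Polynomial.aeval (l.eta x) (l.Ppoly n) := by
  have key : ∀ k, ∏ i ∈ range k, ((((l.E i - l.E n)
      / (l.alpha * l.eta ((i : ℝ) + 1) * (l.slope * l.eta (i : ℝ) + l.base)) : ℝ) : 𝕜)
        * (l.eta x - ((l.eta (i : ℝ) : ℝ) : 𝕜)))
      = Polynomial.aeval (l.eta x) (Polynomial.C (l.newtonCoeff n k) * l.newtonPoly k) := by
    intro k
    rw [prod_mul_distrib, map_mul, Polynomial.aeval_C, newtonCoeff, newtonPoly, map_prod, map_prod]
    congr 1
    refine prod_congr rfl fun i _ => ?_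
    simp
  rw [Ppoly, map_sum]
  have hE := h.eta_natCast
  cases l with
  | littleQLaguerre q a => exact absurd rfl (hl q a)
  | meixner β c =>
    simp only [P]
    refine sum_congr rfl fun k _ => ?_
    rw [← key]
    simp only [ascPochhammer_eval_eq_prod]
    have hf : (k.factorial : 𝕜) = ∏ i ∈ range k, ((i : 𝕜) + 1) := by
      rw [← Finset.prod_range_add_one_eq_factorial]; push_cast; rfl
    have hpow : (1 - (c : 𝕜)⁻¹) ^ k = ∏ i ∈ range k, (1 - (c : 𝕜)⁻¹) := by simp
    rw [hf, hpow, ← prod_mul_distrib, ← prod_mul_distrib, ← prod_div_distrib, ← prod_mul_distrib]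
    refine prod_congr rfl fun i _ => ?_
    simp only [E, alpha, eta, slope, base]
    have h1 : (c : 𝕜) ≠ 0 := by exact_mod_cast h.2
    have h2 : (i : 𝕜) + 1 ≠ 0 := by exact_mod_cast Nat.succ_ne_zero i
    have h3 : (β : 𝕜) + (i : 𝕜) ≠ 0 := by
      have : (β : ℝ) + (i : ℝ) ≠ 0 := by have := h.1; positivity
      exact_mod_cast this
    push_cast
    rw [one_mul, add_comm (i : 𝕜) (β : 𝕜)]
    field_simp
    ring
  | littleQJacobi q a b =>
    simp only [P]
    refine sum_congr rfl fun k _ => ?_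
    rw [← key]
    have hch : (q : 𝕜) ^ k.choose 2 = ∏ i ∈ range k, (q : 𝕜) ^ i := by
      rw [prod_pow_eq_pow_sum, sum_range_id, Nat.choose_two_right]
    have hsg : (-1 : 𝕜) ^ k = ∏ i ∈ range k, (-1 : 𝕜) := by simp
    have hpw : (posPow q x / (a : 𝕜)) ^ k = ∏ i ∈ range k, (posPow q x / (a : 𝕜)) := by
      rw [prod_const, card_range]
    simp only [qPoch]
    rw [hch, hsg, hpw]
    simp only [← prod_mul_distrib, ← prod_div_distrib, ← prod_inv_distrib]
    refine prod_congr rfl fun i _ => ?_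
    have e1 := hE i
    have e2 := hE (i + 1)
    simp only [Nat.cast_add, Nat.cast_one] at e2
    simp only at e1 e2
    rw [e1, e2]
    simp only [E, alpha, eta, slope, base]
    have hq : (q : 𝕜) ≠ 0 := by exact_mod_cast h.1.ne'
    have ha : (a : 𝕜) ≠ 0 := by exact_mod_cast h.2.2.1
    have hqn := pow_ne_zero n hq
    have hqi := pow_ne_zero i hq
    have hz := posPow_ne_zero q x
    have hi1 : 1 - (q : 𝕜) * (q : 𝕜) ^ i ≠ 0 := by
      have : 1 - q * q ^ i ≠ 0 := by
        have := pow_lt_one₀ h.1.le h.2.1 (Nat.succ_ne_zero i)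
        rw [pow_succ'] at this
        linarith
      exact_mod_cast this
    have hi2 : 1 - (b : 𝕜) * q * (q : 𝕜) ^ i ≠ 0 := by
      have : 1 - b * q * q ^ i ≠ 0 := by
        have := h.slope_base_pos i
        rw [e1] at this
        simp only [slope, base] at this
        linarith
      exact_mod_cast this
    push_cast
    rw [posPow_neg, pow_succ (q : 𝕜) i, mul_comm ((q : 𝕜) ^ i) q,
      show (b : 𝕜) * q * (1 - (q : 𝕜) ^ i) + (1 - b * q) = 1 - b * q * (q : 𝕜) ^ i by ring]
    field_simp
    ring

theorem Regular.P_eq_aeval {𝕜 : Type*} [RCLike 𝕜] {l : MIParams} (h : l.Regular) (n : ℕ) (x : 𝕜) :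
    l.P n x = Polynomial.aeval (l.eta x) (l.Ppoly n) := by
  cases l with
  | meixner β c => exact P_eq_aeval_of_ne_laguerre h n x (by simp)
  | littleQJacobi q a b => exact P_eq_aeval_of_ne_laguerre h n x (by simp)
  | littleQLaguerre q a =>
    have h1 := P_eq_aeval_of_ne_laguerre (l := littleQJacobi q a 0)
      ⟨h.1, h.2.1, h.2.2, by simp⟩ n x (by simp)
    have h2 : (littleQLaguerre q a).P n x = (littleQJacobi q a 0).P n x := by
      simp [P, qPoch]
    have h3 : (littleQLaguerre q a).Ppoly n = (littleQJacobi q a 0).Ppoly n := by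
      simp [Ppoly, newtonPoly, newtonCoeff, E, alpha, eta, slope, base]
    rw [h2, h1, h3]
    rfl

theorem Regular.posPow_rho_natCast {𝕜 : Type*} [RCLike 𝕜] {l : MIParams} (h : l.Regular) (n : ℕ) :
    posPow l.rho (n : 𝕜) = (l.rho : 𝕜) ^ n := posPow_natCast h.rho_pos n

theorem Regular.posPow_rho_one {𝕜 : Type*} [RCLike 𝕜] {l : MIParams} (h : l.Regular) :
    posPow l.rho (1 : 𝕜) = (l.rho : 𝕜) := by
  simpa using h.posPow_rho_natCast (𝕜 := 𝕜) 1

theorem Regular.eta_add_one {𝕜 : Type*} [RCLike 𝕜] {l : MIParams} (h : l.Regular) (x : 𝕜) :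
    l.eta (x + 1) = l.rho * l.eta x + l.eta 1 := by
  rw [add_comm, eta_add, h.posPow_rho_one, add_comm]

/-- Since η(x+1) - η(i+1) = ρ(η(x) - η(i)), a unit shift moves the nodes by one, up to powers of ρ.
-/
theorem newton_succ_shift {l : MIParams} (h : l.Regular) (k : ℕ) (x : ℝ) :
    ∏ i ∈ range (k + 1), (l.eta (x + 1) - l.eta (i : ℝ))
      = l.rho ^ k * l.eta (x + 1) * ∏ i ∈ range k, (l.eta x - l.eta (i : ℝ)) := by
  rw [prod_range_succ']
  have : ∏ i ∈ range k, (l.eta (x + 1) - l.eta ((i + 1 : ℕ) : ℝ))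
      = l.rho ^ k * ∏ i ∈ range k, (l.eta x - l.eta (i : ℝ)) := by
    rw [← card_range k, ← prod_const, card_range, ← prod_mul_distrib]
    refine prod_congr rfl fun i _ => ?_
    rw [Nat.cast_add, Nat.cast_one, h.eta_add_one, h.eta_add_one, RCLike.ofReal_real_eq_id]
    simp only [id]
    ring
  rw [this]
  simp only [Nat.cast_zero, eta_zero, sub_zero]
  ring

/-- Writing the factor slope · η(x) + base as slope · (η(x) - η(k)) plus its value at k, the right
side is a combination of the Newton polynomials of degrees k + 1 and k. By `newton_D` the D-part is
diagonal in this basis, so the whole difference operator is bidiagonal in it, with diagonal entries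
ℰ_k. -/
theorem newton_B {l : MIParams} (h : l.Regular) (k : ℕ) (x : ℝ) :
    l.B x * (∏ i ∈ range (k + 1), (l.eta x - l.eta (i : ℝ))
        - ∏ i ∈ range (k + 1), (l.eta (x + 1) - l.eta (i : ℝ)))
      = - l.alpha * l.eta ((k : ℝ) + 1) * (l.slope * l.eta x + l.base)
        * ∏ i ∈ range k, (l.eta x - l.eta (i : ℝ)) := by
  have h1 := posPow_rho l (k : ℝ)
  have h2 := posPow_rho l x
  rw [newton_succ_shift h, prod_range_succ, B_eq, eta_add, eta_add l (k : ℝ), h1, posPow_neg, h2]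
  rw [h.posPow_rho_natCast] at h1
  simp only [RCLike.ofReal_real_eq_id, id] at h1 h2 ⊢
  have h3 := posPow_ne_zero l.rho x
  rw [h2] at h3
  rw [h1]
  field_simp
  ring

theorem newton_D {l : MIParams} (h : l.Regular) (k : ℕ) (x : ℝ) :
    l.D x * (∏ i ∈ range k, (l.eta x - l.eta (i : ℝ))
        - ∏ i ∈ range k, (l.eta (x - 1) - l.eta (i : ℝ)))
      = (l.rho ^ k)⁻¹ * l.eta (k : ℝ) * ∏ i ∈ range k, (l.eta x - l.eta (i : ℝ)) := by
  have h1 := posPow_rho l (k : ℝ)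
  have h2 := posPow_rho l x
  have h4 := newton_succ_shift h k (x - 1)
  rw [sub_add_cancel, prod_range_succ] at h4
  have h5 : l.rho ^ k ≠ 0 := pow_ne_zero k h.rho_pos.ne'
  have h6 : l.eta x * ∏ i ∈ range k, (l.eta (x - 1) - l.eta (i : ℝ))
      = (l.rho ^ k)⁻¹ * ((∏ i ∈ range k, (l.eta x - l.eta (i : ℝ))) * (l.eta x - l.eta (k : ℝ))) := by
    rw [h4]
    field_simp
  rw [h.posPow_rho_natCast] at h1
  simp only [RCLike.ofReal_real_eq_id, id] at h1 h2
  have h3 := posPow_ne_zero l.rho x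
  rw [D_eq, mul_assoc, mul_sub, h6, posPow_neg]
  field_simp
  rw [h1, h2]
  ring

/-- The difference equation of the polynomials `P̌_n`. -/
theorem Regular.P_difference {l : MIParams} (h : l.Regular) (n : ℕ) (x : ℝ) :
    l.B x * (l.P n x - l.P n (x + 1)) + l.D x * (l.P n x - l.P n (x - 1)) = l.E n * l.P n x := by
  have hP : ∀ y : ℝ, l.P n y = ∑ k ∈ range (n + 1), l.newtonCoeff n k
      * ∏ i ∈ range k, (l.eta y - l.eta (i : ℝ)) := by
    intro y
    rw [h.P_eq_aeval, Ppoly, map_sum]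
    refine sum_congr rfl fun k _ => ?_
    rw [map_mul, Polynomial.aeval_C, newtonPoly, map_prod]
    simp
  -- For the series truncated after the term of index m, the two-term recursion of the coefficients
  -- cancels everything except a defect with the factor ℰ_m - ℰ_n, which vanishes at m = n.
  have key : ∀ m : ℕ,
      l.B x * (∑ k ∈ range (m + 1), l.newtonCoeff n k
          * ∏ i ∈ range k, (l.eta x - l.eta (i : ℝ))
        - ∑ k ∈ range (m + 1), l.newtonCoeff n k
          * ∏ i ∈ range k, (l.eta (x + 1) - l.eta (i : ℝ)))
      + l.D x * (∑ k ∈ range (m + 1), l.newtonCoeff n k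
          * ∏ i ∈ range k, (l.eta x - l.eta (i : ℝ))
        - ∑ k ∈ range (m + 1), l.newtonCoeff n k
          * ∏ i ∈ range k, (l.eta (x - 1) - l.eta (i : ℝ)))
      - l.E n * ∑ k ∈ range (m + 1), l.newtonCoeff n k
          * ∏ i ∈ range k, (l.eta x - l.eta (i : ℝ))
      = (l.E m - l.E n) * (l.newtonCoeff n m * ∏ i ∈ range m, (l.eta x - l.eta (i : ℝ))) := by
    intro m
    induction m with
    | zero =>
      have : l.E 0 = 0 := by rw [h.E_eq]; simp [eta_zero]
      simp [this]
    | succ m ih =>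
      have hb := newton_B h m x
      have hd := newton_D h (m + 1) x
      have hc : l.newtonCoeff n (m + 1)
          * (l.alpha * l.eta ((m : ℝ) + 1) * (l.slope * l.eta (m : ℝ) + l.base))
          = (l.E m - l.E n) * l.newtonCoeff n m := by
        rw [newtonCoeff, prod_range_succ, ← newtonCoeff]
        have i1 := h.alpha_ne_zero
        have i2 := (h.eta_pos m).ne'
        have i3 := (h.slope_base_pos m).ne'
        field_simp
      have hE := h.E_eq (m + 1)
      have hN := prod_range_succ (fun i : ℕ => l.eta x - l.eta (i : ℝ)) m
      simp only [sum_range_succ _ (m + 1)]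
      push_cast at hE hd
      rw [hE]
      linear_combination ih + l.newtonCoeff n (m + 1) * hb + l.newtonCoeff n (m + 1) * hd
        - (∏ i ∈ range m, (l.eta x - l.eta (i : ℝ))) * hc
        + l.alpha * l.eta ((m : ℝ) + 1) * l.slope * l.newtonCoeff n (m + 1) * hN
  have := key n
  rw [← hP, ← hP, ← hP] at this
  linarith

theorem slope_eq (l : MIParams) : l.slope = 1 - l.kap * l.base := by
  cases l <;> simp [slope, kap, base]

theorem P_zero_index {𝕜 : Type*} [RCLike 𝕜] (l : MIParams) (x : 𝕜) : l.P 0 x = 1 := by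
  cases l <;> simp [P, qPoch]

theorem Regular.P_at_zero {𝕜 : Type*} [RCLike 𝕜] {l : MIParams} (h : l.Regular) (n : ℕ) :
    l.P n (0 : 𝕜) = 1 := by
  rw [h.P_eq_aeval, Ppoly, map_sum, sum_range_succ', sum_eq_zero]
  · simp [newtonCoeff, newtonPoly]
  · intro k _
    rw [map_mul, newtonPoly, map_prod, prod_range_succ']
    simp [eta_zero]

theorem Regular.E_zero {l : MIParams} (h : l.Regular) : l.E 0 = 0 := by
  rw [h.E_eq]; simp [eta_zero]

theorem alpha_mul_B' {l : MIParams} (h : l.Regular) {𝕜 : Type*} [RCLike 𝕜] (x : 𝕜) :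
    (l.alpha : 𝕜) * l.B' x = posPow l.rho (-x) * (l.slope * l.eta x + l.base) := by
  have : (l.alpha : 𝕜) ≠ 0 := by exact_mod_cast h.alpha_ne_zero
  rw [B', B_eq, alpha_twist, rho_twist, slope_twist, base_twist, eta_twist]
  push_cast
  field_simp

theorem B_eq_alpha_mul {l : MIParams} (h : l.Regular) {𝕜 : Type*} [RCLike 𝕜] (x : 𝕜) :
    l.B x = l.alpha * (l.alpha * l.B' x) := by
  rw [alpha_mul_B' h, B_eq]; ring

/-! ### Virtual states and eigenpolynomials as solutions of one recurrence -/

/-- The coefficient `α B'` on the lattice. -/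
noncomputable def upCoeff (l : MIParams) (x : ℕ) : ℝ := l.alpha * l.B' (x : ℝ)

/-- The coefficient `α D` on the lattice. -/
noncomputable def downCoeff (l : MIParams) (x : ℕ) : ℝ := l.alpha * l.D (x : ℝ)

/-- The diagonal coefficient `B + D` on the lattice. -/
noncomputable def diagCoeff (l : MIParams) (x : ℕ) : ℝ := l.B (x : ℝ) + l.D (x : ℝ)

theorem D_zero {𝕜 : Type*} [RCLike 𝕜] (l : MIParams) : l.D (0 : 𝕜) = 0 := by
  rw [D_eq, eta_zero, mul_zero]

theorem Regular.D_pos {l : MIParams} (h : l.Regular) (n : ℕ) : 0 < l.D ((n : ℝ) + 1) := by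
  rw [D_eq]
  exact mul_pos (posPow_pos h.rho_pos _) (h.eta_pos n)

theorem Regular.D_nonneg {l : MIParams} (h : l.Regular) (n : ℕ) : 0 ≤ l.D (n : ℝ) := by
  cases n with
  | zero => simp [D_zero]
  | succ n => exact_mod_cast (h.D_pos n).le

theorem Regular.upCoeff_pos {l : MIParams} (h : l.Regular) (n : ℕ) : 0 < l.upCoeff n := by
  have := alpha_mul_B' h (n : ℝ)
  simp only [RCLike.ofReal_real_eq_id, id] at this
  rw [upCoeff, this]
  exact mul_pos (posPow_pos h.rho_pos _) (h.slope_base_pos n)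

theorem downCoeff_zero (l : MIParams) : l.downCoeff 0 = 0 := by
  simp [downCoeff, D_zero]

theorem Admissible.downCoeff_nonneg {l : MIParams} (h : l.Admissible) (n : ℕ) :
    0 ≤ l.downCoeff n :=
  mul_nonneg h.alpha_pos.le (h.regular.D_nonneg n)

theorem Admissible.B_pos {l : MIParams} (h : l.Admissible) (n : ℕ) : 0 < l.B (n : ℝ) := by
  rw [B_eq_alpha_mul h.regular]
  exact mul_pos h.alpha_pos (h.regular.upCoeff_pos n)

/-- Truncated subtraction on ℕ differs from subtraction on ℝ only at x = 0, where the coefficient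
vanishes. -/
theorem downCoeff_mul_pred (l : MIParams) (f : ℝ → ℝ) (x : ℕ) :
    l.downCoeff x * f ((x - 1 : ℕ) : ℝ) = l.downCoeff x * f ((x : ℝ) - 1) := by
  cases x with
  | zero => simp [downCoeff_zero]
  | succ y => simp

/-- The virtual state vectors solve the three-term recurrence of the system. -/
theorem Regular.xi_threeTerm {l : MIParams} (h : l.Regular) (v : ℕ) :
    ThreeTerm l.upCoeff l.downCoeff l.diagCoeff (l.tE v) (fun x => l.xi v (x : ℝ)) := by
  intro x
  simp only
  rw [downCoeff_mul_pred l (l.xi v), upCoeff, downCoeff, diagCoeff, B_eq_alpha_mul h, tE]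
  have h1 := h.twist.P_difference v (x : ℝ)
  rw [D_twist] at h1
  have h3 := alpha_mul_B' h (x : ℝ)
  have h4 := posPow_neg_mul l.rho (x : ℝ)
  have h5 := posPow_rho l (x : ℝ)
  -- With B = α · αB', the difference of B + D and α(B' + D) is (α - 1)ρ^{-x}((slope - 1)η + base).
  -- By slope = 1 - κ · base it equals (α - 1) · base = α'.
  have h6 : l.alpha * (l.alpha * l.B' (x : ℝ)) + l.D (x : ℝ)
      = l.alpha * (l.B' (x : ℝ) + l.D (x : ℝ)) + l.alpha' := by
    simp only [RCLike.ofReal_real_eq_id, id] at h3 h5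
    rw [mul_add, h3, alpha'_eq, D_eq, slope_eq]
    rw [h5] at h4
    linear_combination (l.alpha - 1) * l.base * h4
  simp only [xi, B', RCLike.ofReal_real_eq_id, id] at h6 ⊢
  push_cast
  rw [h6]
  linear_combination - l.alpha * h1

theorem Admissible.nu_natCast {l : MIParams} (h : l.Admissible) (n : ℕ) :
    l.nu (n : ℝ) = l.alpha ^ n := posPow_natCast h.alpha_pos n

/-- By ν(x ± 1) = α^{±1}ν(x), the factor ν replaces the coefficients B and D of the difference
equation by αB' and αD and leaves the diagonal alone. -/
theorem Admissible.nu_P_threeTerm {l : MIParams} (h : l.Admissible) (n : ℕ) :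
    ThreeTerm l.upCoeff l.downCoeff l.diagCoeff (l.E n) (fun x => l.nu (x : ℝ) * l.P n (x : ℝ)) := by
  intro x
  simp only
  have hnu : ∀ y : ℝ, l.nu (y + 1) = l.nu y * l.alpha := by
    intro y
    rw [nu, posPow_add, nu]
    congr 1
    simpa using posPow_natCast (𝕜 := ℝ) h.alpha_pos 1
  have h2 := hnu ((x : ℝ) - 1)
  rw [sub_add_cancel] at h2
  rw [downCoeff_mul_pred l (fun y => l.nu y * l.P n y), upCoeff, downCoeff, diagCoeff]
  have h1 := h.regular.P_difference n (x : ℝ)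
  have h3 := B_eq_alpha_mul h.regular (x : ℝ)
  simp only [RCLike.ofReal_real_eq_id, id] at h3
  push_cast
  rw [hnu]
  linear_combination (-l.nu (x : ℝ)) * h1 - l.D (x : ℝ) * l.P n ((x : ℝ) - 1) * h2
    - l.nu (x : ℝ) * l.P n ((x : ℝ) + 1) * h3

/-! ### Energies -/

/-- In product form the sign can be read off from a < q^v and b q^{v+1} < 1. -/
theorem tE_littleQJacobi {q a b : ℝ} (hq : q ≠ 0) (ha : a ≠ 0) (v : ℕ) :
    (littleQJacobi q a b).tE v = -((1 - a * (q ^ v)⁻¹) * (1 - b * q * q ^ v)) := by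
  have := pow_ne_zero v hq
  simp only [tE, alpha, twist, E, alpha']
  field_simp
  ring

theorem tE_littleQLaguerre (q a : ℝ) (v : ℕ) :
    (littleQLaguerre q a).tE v = -(1 - a * (q ^ v)⁻¹) := by
  simp only [tE, alpha, twist, E, alpha']
  ring

theorem tE_meixner {β c : ℝ} (hc : c ≠ 0) (v : ℕ) :
    (meixner β c).tE v = -((1 - c) * (v + β)) := by
  simp only [tE, alpha, twist, E, alpha']
  field_simp
  ring

theorem tE_neg {l : MIParams} (h : l.Admissible) {v : ℕ} (hv : v ∈ l.virtualIndexSet) :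
    l.tE v < 0 := by
  have hr := h.regular
  cases l with
  | meixner β c =>
    rw [tE_meixner hr.2]
    have := mul_pos (sub_pos.2 h.2.2) (add_pos_of_nonneg_of_pos (Nat.cast_nonneg (α := ℝ) v) h.1)
    linarith
  | littleQJacobi q a b =>
    rw [tE_littleQJacobi hr.1.ne' hr.2.2.1]
    have h1 : 0 < q ^ v := pow_pos hr.1 v
    have h2 : a * (q ^ v)⁻¹ < 1 := by
      rw [← div_eq_mul_inv, div_lt_one h1]
      exact hv.2
    have h3 : b * q * q ^ v < 1 := by
      have := hr.slope_base_pos v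
      rw [hr.eta_natCast] at this
      simp only [slope, base] at this
      linarith
    have := mul_pos (sub_pos.2 h2) (sub_pos.2 h3)
    linarith
  | littleQLaguerre q a =>
    rw [tE_littleQLaguerre]
    have h1 : 0 < q ^ v := pow_pos hr.1 v
    have h2 : a * (q ^ v)⁻¹ < 1 := by
      rw [← div_eq_mul_inv, div_lt_one h1]
      exact hv.2
    linarith

theorem E_nonneg {l : MIParams} (h : l.Admissible) (n : ℕ) : 0 ≤ l.E n := by
  have hr := h.regular
  cases l with
  | meixner β c => exact mul_nonneg (sub_nonneg.2 h.2.2.le) (Nat.cast_nonneg n)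
  | littleQJacobi q a b =>
    cases n with
    | zero => simp [E]
    | succ n =>
      obtain ⟨h1, h2, h3, h4, -⟩ := h
      have h5 : a * q < 1 := by rwa [← lt_inv_mul_iff₀' h1, mul_one]
      have h6 : b * q * q ^ n < 1 := by
        have := hr.slope_base_pos n
        rw [hr.eta_natCast] at this
        simp only [slope, base] at this
        linarith
      refine mul_nonneg (sub_nonneg.2 ?_) ?_
      · exact (one_le_inv₀ (pow_pos h1 _)).2 (pow_le_one₀ h1.le h2.le)
      · have h7 : 0 < a * q := mul_pos h3 h1
        have : a * b * q ^ (n + 1 + 1) = (a * q) * (b * q * q ^ n) := by ring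
        rw [this]
        nlinarith [mul_pos h7 (sub_pos.2 h6)]
  | littleQLaguerre q a =>
    exact sub_nonneg.2 ((one_le_inv₀ (pow_pos h.1 _)).2 (pow_le_one₀ h.1.le h.2.1.le))

theorem tE_injective {l : MIParams} (h : l.Admissible) {M : ℕ} {d : Fin M → ℕ}
    (hinj : Function.Injective d) (hnd : l.NonDegenerate d) :
    Function.Injective fun j => l.tE (d j) := by
  have hr := h.regular
  intro j k hjk
  by_contra hne
  have hdne : d j ≠ d k := fun hh => hne (hinj hh)
  have hn := hnd j k hne
  simp only at hjk
  cases l with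
  | meixner β c =>
    rw [tE_meixner hr.2, tE_meixner hr.2] at hjk
    have h1 := mul_left_cancel₀ (sub_pos.2 h.2.2).ne' (neg_injective hjk)
    exact hdne (by exact_mod_cast add_right_cancel h1)
  | littleQJacobi q a b =>
    rw [tE_littleQJacobi hr.1.ne' hr.2.2.1, tE_littleQJacobi hr.1.ne' hr.2.2.1] at hjk
    have h1 : q ^ d j ≠ 0 := pow_ne_zero _ hr.1.ne'
    have h2 : q ^ d k ≠ 0 := pow_ne_zero _ hr.1.ne'
    -- The difference of two energies factors this way up to a nonzero factor, so equal energies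
    -- force equal indices or the excluded relation between a and b.
    have h3 : (q ^ d j - q ^ d k) * (a - b * q ^ (d j + d k + 1)) = 0 := by
      field_simp at hjk
      rw [pow_add, pow_add, pow_one]
      linear_combination -hjk
    rcases mul_eq_zero.1 h3 with h4 | h4
    · exact hdne ((pow_right_strictAnti₀ hr.1 hr.2.1).injective (sub_eq_zero.1 h4))
    · exact hn (sub_eq_zero.1 h4)
  | littleQLaguerre q a =>
    rw [tE_littleQLaguerre, tE_littleQLaguerre] at hjk
    have h1 : q ^ d j ≠ 0 := pow_ne_zero _ hr.1.ne'
    have h2 : q ^ d k ≠ 0 := pow_ne_zero _ hr.1.ne'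
    have h3 : a * (q ^ d j - q ^ d k) = 0 := by
      field_simp at hjk
      linear_combination -hjk
    rcases mul_eq_zero.1 h3 with h4 | h4
    · exact hr.2.2 h4
    · exact hdne ((pow_right_strictAnti₀ hr.1 hr.2.1).injective (sub_eq_zero.1 h4))

/-! ### The shifted parameters -/

theorem Admissible.shift {l : MIParams} (h : l.Admissible) : l.shift.Admissible := by
  cases l with
  | meixner β c => exact ⟨add_pos h.1 one_pos, h.2⟩
  | littleQJacobi q a b =>
    have hb := h.regular.2.2.2
    obtain ⟨h1, h2, h3, h4, h5⟩ := h
    have h6 : 1 < q⁻¹ := (one_lt_inv₀ h1).2 h2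
    refine ⟨h1, h2, mul_pos h3 h1, ?_, hb.trans h6⟩
    have : a * q < 1 := by rwa [← lt_inv_mul_iff₀' h1, mul_one]
    exact this.trans h6
  | littleQLaguerre q a =>
    obtain ⟨h1, h2, h3, h4⟩ := h
    have h6 : 1 < q⁻¹ := (one_lt_inv₀ h1).2 h2
    refine ⟨h1, h2, mul_pos h3 h1, ?_⟩
    have : a * q < 1 := by rwa [← lt_inv_mul_iff₀' h1, mul_one]
    exact this.trans h6

theorem Admissible.mem_shift {l : MIParams} (h : l.Admissible) {v : ℕ}
    (hv : v ∈ l.virtualIndexSet) : v ∈ l.shift.virtualIndexSet := by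
  cases l with
  | meixner β c => exact hv
  | littleQJacobi q a b => exact ⟨hv.1, (mul_lt_of_lt_one_right h.2.2.1 h.2.1).trans hv.2⟩
  | littleQLaguerre q a => exact ⟨hv.1, (mul_lt_of_lt_one_right h.2.2.1 h.2.1).trans hv.2⟩

theorem NonDegenerate.shift {l : MIParams} (h : l.Admissible) {M : ℕ} {d : Fin M → ℕ}
    (hnd : l.NonDegenerate d) : l.shift.NonDegenerate d := by
  intro j k hjk
  have := hnd j k hjk
  cases l with
  | meixner β c => trivial
  | littleQJacobi q a b =>
    intro hh
    refine this (mul_right_cancel₀ h.1.ne' ?_)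
    linear_combination hh
  | littleQLaguerre q a => trivial

section

variable {𝕜 : Type*} [RCLike 𝕜]

theorem shift_B_eq {l : MIParams} (h : l.Regular) (x : 𝕜) :
    l.shift.B x = l.rho ^ 2 * l.B (x + 1) := by
  cases l with
  | meixner β c => simp only [B, MIParams.shift, rho]; push_cast; ring
  | littleQJacobi q a b =>
    have h2 : posPow q (1 : 𝕜) = q := by simpa using posPow_natCast (𝕜 := 𝕜) h.1 1
    have h3 := posPow_ne_zero q x
    have h4 : (q : 𝕜) ≠ 0 := by exact_mod_cast h.1.ne'
    simp only [B, MIParams.shift, rho, posPow_neg, posPow_add, h2]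
    push_cast
    field_simp
  | littleQLaguerre q a =>
    have h2 : posPow q (1 : 𝕜) = q := by simpa using posPow_natCast (𝕜 := 𝕜) h.1 1
    have h3 := posPow_ne_zero q x
    have h4 : (q : 𝕜) ≠ 0 := by exact_mod_cast h.1.ne'
    simp only [B, MIParams.shift, rho, posPow_neg, posPow_add, h2]
    push_cast
    field_simp

theorem tshift_B_eq {l : MIParams} (h : l.Regular) (M : ℕ) (x : 𝕜) :
    (l.tshift M).B x = l.B (x + M) := by
  cases l with
  | meixner β c => simp only [B, MIParams.tshift]; push_cast; ring
  | littleQJacobi q a b =>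
    have h2 := posPow_natCast (𝕜 := 𝕜) h.1 M
    have h3 := posPow_ne_zero q x
    have h4 : (q : 𝕜) ^ M ≠ 0 := pow_ne_zero _ (by exact_mod_cast h.1.ne')
    simp only [B, MIParams.tshift, posPow_neg, posPow_add, h2]
    push_cast
    field_simp
  | littleQLaguerre q a =>
    have h2 := posPow_natCast (𝕜 := 𝕜) h.1 M
    have h3 := posPow_ne_zero q x
    have h4 : (q : 𝕜) ^ M ≠ 0 := pow_ne_zero _ (by exact_mod_cast h.1.ne')
    simp only [B, MIParams.tshift, posPow_neg, posPow_add, h2]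
    push_cast
    field_simp

/-- Passing to 𝝀 + M𝜹̃ multiplies ν by ρ^{-Mx}. This compensates the exponent difference M between
φ_{M+1} and φ_M, so that P̌_{𝒟,n} needs no more divisibility than the M virtual-state columns
supply. -/
theorem tshift_nu_mul {l : MIParams} (h : l.Regular) (M : ℕ) (x : 𝕜) :
    (l.tshift M).nu x * posPow l.rho x ^ M = l.nu x := by
  have hρ := h.rho_pos.ne'
  have hM : ∀ n : ℕ, posPow (l.rho ^ n) x = posPow l.rho x ^ n := by
    intro n
    induction n with
    | zero => simp [posPow_one_base]
    | succ n ih => rw [pow_succ, posPow_mul_base (pow_ne_zero _ hρ) hρ, ih, pow_succ]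
  rw [nu, nu, ← hM, ← posPow_mul_base _ (pow_ne_zero _ hρ), alpha_tshift,
    div_mul_cancel₀ _ (pow_ne_zero _ hρ)]
  rw [alpha_tshift]
  exact div_ne_zero h.alpha_ne_zero (pow_ne_zero _ hρ)

end

/-- The shifted virtual state energy. -/
theorem tE_shift {l : MIParams} (h : l.Admissible) (v : ℕ) (x : ℝ) :
    l.rho * l.D (x + 1) + l.shift.alpha * (l.alpha * l.B' x) - l.rho * l.tE v
      = l.shift.B x + l.D x - l.shift.tE v := by
  have hr := h.regular
  have hrs := h.shift.regular
  have h0 := alpha_mul_B' hr x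
  simp only [RCLike.ofReal_real_eq_id, id] at h0
  rw [h0]
  cases l with
  | meixner β c =>
    simp only [MIParams.shift] at hrs ⊢
    rw [tE_meixner hr.2, tE_meixner hr.2]
    simp only [rho, D, alpha, B, slope, base, eta, posPow_one_base, RCLike.ofReal_real_eq_id, id]
    ring
  | littleQJacobi q a b =>
    simp only [MIParams.shift] at hrs ⊢
    rw [tE_littleQJacobi hr.1.ne' hr.2.2.1, tE_littleQJacobi hr.1.ne' hrs.2.2.1]
    have h2 : posPow q (1 : ℝ) = q := by simpa using posPow_natCast (𝕜 := ℝ) hr.1 1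
    have h3 := posPow_ne_zero q x
    have h4 := hr.1.ne'
    have h5 := pow_ne_zero v h4
    simp only [rho, D, alpha, B, slope, base, eta, posPow_neg, posPow_add, h2,
      RCLike.ofReal_real_eq_id, id]
    field_simp
    ring
  | littleQLaguerre q a =>
    simp only [MIParams.shift] at hrs ⊢
    rw [tE_littleQLaguerre, tE_littleQLaguerre]
    have h2 : posPow q (1 : ℝ) = q := by simpa using posPow_natCast (𝕜 := ℝ) hr.1 1
    have h3 := posPow_ne_zero q x
    have h4 := hr.1.ne'
    have h5 := pow_ne_zero v h4
    simp only [rho, D, alpha, B, slope, base, eta, posPow_neg, posPow_add, h2,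
      RCLike.ofReal_real_eq_id, id]
    field_simp
    ring

end MIParams

/-! ### Polynomiality in η: divisibility of Casorati determinants -/

theorem choose_card_two_le_sum (T : Finset ℕ) : T.card.choose 2 ≤ ∑ t ∈ T, t := by
  induction T using Finset.induction_on_max with
  | empty => simp
  | insert a s h ih =>
    have ha : a ∉ s := fun hh => lt_irrefl a (h a hh)
    have hc : s.card ≤ a := by
      simpa using card_le_card (show s ⊆ range a from fun x hx => mem_range.2 (h x hx))
    rw [card_insert_of_notMem ha, sum_insert ha,
      show (s.card + 1).choose 2 = s.card.choose 1 + s.card.choose 2 from Nat.choose_succ_succ' _ _,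
      Nat.choose_one_right]
    exact add_le_add hc ih

/-- Divisibility of a determinant of `q`-dilated polynomials by a power of the variable. -/
theorem X_pow_dvd_det_dilation {R : Type*} [CommRing R] {n : ℕ} (p : Fin n → Polynomial R)
    (u : Fin n → R) (q : R) (S : Finset (Fin n)) (hu : ∀ k ∈ S, u k = 1) :
    Polynomial.X ^ (S.card.choose 2) ∣ (Matrix.of fun j k : Fin n =>
      Polynomial.C (u k ^ (j : ℕ)) * (p k).comp (Polynomial.C (q ^ (j : ℕ)) * Polynomial.X)).det := by
  rw [← Matrix.det_transpose]
  -- The determinant is expanded multilinearly in the monomials of each p k; choosing the exponents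
  -- r k contributes X to the power of their sum.
  let v : Fin n → ℕ → Fin n → Polynomial R := fun k m =>
    (Polynomial.C ((p k).coeff m) * Polynomial.X ^ m) •
      fun j : Fin n => Polynomial.C ((u k * q ^ m) ^ (j : ℕ))
  have hM : (Matrix.of fun j k : Fin n => Polynomial.C (u k ^ (j : ℕ))
      * (p k).comp (Polynomial.C (q ^ (j : ℕ)) * Polynomial.X)).transpose
      = fun k => ∑ m ∈ range ((p k).natDegree + 1), v k m := by
    funext k j
    rw [Finset.sum_apply, Matrix.transpose_apply, Matrix.of_apply, Polynomial.comp,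
      Polynomial.eval₂_eq_sum_range, mul_sum]
    refine sum_congr rfl fun m _ => ?_
    simp only [v, Pi.smul_apply, smul_eq_mul, mul_pow, map_mul, map_pow]
    ring
  rw [hM]
  change _ ∣ (Matrix.detRowAlternating (R := Polynomial R) (n := Fin n)).toMultilinearMap _
  rw [MultilinearMap.map_sum_finset]
  refine dvd_sum fun r _ => ?_
  simp only [v]
  rw [MultilinearMap.map_smul_univ]
  -- Two members of S with the same exponent give proportional rows, so the term vanishes. Otherwise
  -- the exponents on S are distinct and sum to at least 0 + 1 + … + (|S| - 1).
  by_cases hr : Set.InjOn r S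
  · have h1 : S.card.choose 2 ≤ ∑ k, r k := by
      calc S.card.choose 2 = (S.image r).card.choose 2 := by rw [card_image_of_injOn hr]
        _ ≤ ∑ t ∈ S.image r, t := choose_card_two_le_sum _
        _ = ∑ k ∈ S, r k := sum_image hr
        _ ≤ ∑ k, r k := sum_le_sum_of_subset (subset_univ S)
    rw [prod_mul_distrib, prod_pow_eq_pow_sum, smul_eq_mul]
    exact ((pow_dvd_pow _ h1).mul_left _).mul_right _
  · rw [Set.InjOn] at hr
    push Not at hr
    obtain ⟨i, hi, j, hj, hij, hne⟩ := hr
    have : (Matrix.detRowAlternating (R := Polynomial R) (n := Fin n)).toMultilinearMap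
        (fun k => fun j : Fin n => Polynomial.C ((u k * q ^ r k) ^ (j : ℕ))) = 0 := by
      refine (Matrix.detRowAlternating (R := Polynomial R) (n := Fin n)).map_eq_zero_of_eq _ ?_ hne
      funext m
      rw [hu i hi, hu j hj, hij]
    rw [this, smul_zero]
    exact dvd_zero _

namespace MIParams

theorem kap_eq (l : MIParams) : l.kap = 0 ∨ l.kap = 1 := by
  cases l <;> simp [kap]

theorem Regular.rho_pow {l : MIParams} (h : l.Regular) (n : ℕ) :
    l.rho ^ n = 1 - l.kap * l.eta (n : ℝ) := by
  have := posPow_rho l (n : ℝ)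
  rw [h.posPow_rho_natCast] at this
  simpa using this

/-- The Casorati determinant of polynomials in the sinusoidal coordinate, with weights. -/
noncomputable def casoratiPoly (l : MIParams) {n : ℕ} (p : Fin n → Polynomial ℝ)
    (u : Fin n → ℝ) : Polynomial ℝ :=
  (Matrix.of fun j k : Fin n => Polynomial.C (u k ^ (j : ℕ))
    * (p k).comp (Polynomial.C (l.rho ^ (j : ℕ)) * Polynomial.X
      + Polynomial.C (l.eta ((j : ℕ) : ℝ)))).det

theorem Regular.dvd_casoratiPoly {l : MIParams} (h : l.Regular) {n : ℕ} (p : Fin n → Polynomial ℝ)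
    (u : Fin n → ℝ) (S : Finset (Fin n)) (hu : ∀ k ∈ S, u k = 1) :
    (1 - Polynomial.C l.kap * Polynomial.X) ^ (S.card.choose 2) ∣ l.casoratiPoly p u := by
  rcases l.kap_eq with hk | hk
  · simp [hk]
  · have h1 := X_pow_dvd_det_dilation (fun k => (p k).comp (1 - Polynomial.X)) u l.rho S hu
    have h2 := map_dvd (Polynomial.compRingHom (1 - Polynomial.X : Polynomial ℝ)) h1
    rw [hk, map_one, one_mul]
    rw [map_pow, RingHom.map_det] at h2
    simp only [Polynomial.coe_compRingHom, Polynomial.X_comp] at h2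
    refine h2.trans (dvd_of_eq ?_)
    rw [casoratiPoly]
    congr 1
    ext1 j k
    have h3 : l.eta ((j : ℕ) : ℝ) = 1 - l.rho ^ (j : ℕ) := by
      rw [h.rho_pow, hk]; ring
    simp only [RingHom.mapMatrix_apply, Matrix.map_apply, Matrix.of_apply,
      Polynomial.coe_compRingHom_apply, Polynomial.mul_comp, Polynomial.C_comp,
      Polynomial.comp_assoc, Polynomial.sub_comp, Polynomial.X_comp, Polynomial.one_comp]
    rw [h3]
    congr 2
    simp only [map_sub, map_one]
    ring

section

variable {𝕜 : Type*} [RCLike 𝕜]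

theorem Regular.eta_add_nat {l : MIParams} (h : l.Regular) (x : 𝕜) (j : ℕ) :
    l.eta (x + j) = (l.rho : 𝕜) ^ j * l.eta x + ((l.eta (j : ℝ) : ℝ) : 𝕜) := by
  rw [add_comm, eta_add, h.posPow_rho_natCast, MIParams.eta_natCast, add_comm]

theorem Regular.aeval_casoratiPoly {l : MIParams} (h : l.Regular) {n : ℕ} (p : Fin n → Polynomial ℝ)
    (u : Fin n → ℝ) (x : 𝕜) :
    Polynomial.aeval (l.eta x) (l.casoratiPoly p u)
      = (Matrix.of fun j k : Fin n => ((u k : 𝕜) ^ (j : ℕ))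
        * Polynomial.aeval (l.eta (x + (j : ℕ))) (p k)).det := by
  rw [casoratiPoly, AlgHom.map_det]
  congr 1
  ext1 j k
  simp only [AlgHom.mapMatrix_apply, Matrix.map_apply, Matrix.of_apply, map_mul,
    Polynomial.aeval_comp, map_add, Polynomial.aeval_C, Polynomial.aeval_X, h.eta_add_nat]
  simp

theorem w_eq_aeval {l : MIParams} (h : l.Regular) {M : ℕ} (d : Fin M → ℕ) (x : 𝕜) :
    l.w d x = Polynomial.aeval (l.eta x)
      (l.casoratiPoly (fun k => l.twist.Ppoly (d k)) (fun _ => 1)) := by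
  rw [h.aeval_casoratiPoly, w, casoratian]
  congr 1
  ext1 j k
  simp only [Matrix.of_apply, xi, h.twist.P_eq_aeval, eta_twist]
  simp

theorem nu_add_nat {l : MIParams} (h : l.Admissible) (x : 𝕜) (j : ℕ) :
    l.nu (x + j) = l.nu x * (l.alpha : 𝕜) ^ j := by
  rw [nu, posPow_add, posPow_natCast h.alpha_pos, nu]

theorem w''_eq_aeval {l : MIParams} (h : l.Admissible) {M : ℕ} (d : Fin M → ℕ) (n : ℕ) (x : 𝕜) :
    l.w'' d n x = l.nu x * Polynomial.aeval (l.eta x)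
      (l.casoratiPoly (Fin.snoc (α := fun _ => Polynomial ℝ) (fun k => l.twist.Ppoly (d k))
        (l.Ppoly n)) (Fin.snoc (α := fun _ => ℝ) (fun _ => 1) l.alpha)) := by
  have hr := h.regular
  rw [hr.aeval_casoratiPoly, w'', casoratian]
  have hprod : l.nu x = ∏ k : Fin (M + 1), Fin.snoc (α := fun _ => 𝕜) (fun _ => 1) (l.nu x) k := by
    rw [Fin.prod_univ_castSucc]
    simp
  rw [hprod, ← Matrix.det_mul_row]
  congr 1
  ext1 j k
  simp only [Matrix.of_apply]
  refine Fin.lastCases ?_ (fun i => ?_) k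
  · simp only [Fin.snoc_last, hr.P_eq_aeval, nu_add_nat h]
    ring
  · simp only [Fin.snoc_castSucc, xi, hr.twist.P_eq_aeval, eta_twist]
    simp

/-- The value of `φ_M` at the origin. -/
noncomputable def phiConst (l : MIParams) (M : ℕ) : ℝ :=
  ∏ k ∈ range M, ∏ j ∈ range k, l.rho ^ j

theorem Regular.phiConst_pos {l : MIParams} (h : l.Regular) (M : ℕ) : 0 < l.phiConst M :=
  prod_pos fun _ _ => prod_pos fun _ _ => pow_pos h.rho_pos _

/-- By the addition law, η(x+k) - η(x+j) = ρ^{x+j} η(k-j), so each factor of φ_M is just ρ^{x+j}. In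
particular φ_M is constant for Meixner. -/
theorem Regular.phiAux_eq {l : MIParams} (h : l.Regular) (M : ℕ) (x : 𝕜) :
    l.phiAux M x = (l.phiConst M : 𝕜) * posPow l.rho x ^ (M.choose 2) := by
  have hc : M.choose 2 = ∑ k ∈ range M, k := by rw [sum_range_id, Nat.choose_two_right]
  rw [hc, ← prod_pow_eq_pow_sum, phiConst, RCLike.ofReal_prod, ← prod_mul_distrib, phiAux]
  refine prod_congr rfl fun k _ => ?_
  rw [RCLike.ofReal_prod]
  have : posPow l.rho x ^ k = ∏ j ∈ range k, posPow l.rho x := by simp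
  rw [this, ← prod_mul_distrib]
  refine prod_congr rfl fun j hj => ?_
  have hjk := mem_range.1 hj
  have h1 : (k : 𝕜) = (j : 𝕜) + ((k : 𝕜) - (j : 𝕜)) := by ring
  have h2 : l.eta ((k : 𝕜) - (j : 𝕜)) ≠ 0 := by
    rw [← Nat.cast_sub hjk.le, MIParams.eta_natCast]
    have := h.eta_pos (k - j - 1)
    have h3 : ((k - j - 1 : ℕ) : ℝ) + 1 = ((k - j : ℕ) : ℝ) := by
      rw [← Nat.cast_add_one]; congr 1; omega
    rw [h3] at this
    exact_mod_cast this.ne'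
  have h4 : l.eta (x + k) - l.eta (x + j)
      = posPow l.rho x * ((l.rho : 𝕜) ^ j * l.eta ((k : 𝕜) - (j : 𝕜))) := by
    rw [eta_add, eta_add l x (j : 𝕜), h1, eta_add l (j : 𝕜), ← h1, h.posPow_rho_natCast]
    ring
  rw [h4, RCLike.ofReal_pow]
  field_simp

theorem aeval_one_sub_kap {l : MIParams} (x : 𝕜) :
    Polynomial.aeval (l.eta x) (1 - Polynomial.C l.kap * Polynomial.X) = posPow l.rho x := by
  rw [posPow_rho]
  simp

theorem Xi_eq_aeval {l : MIParams} (h : l.Regular) {M : ℕ} (d : Fin M → ℕ) {Q : Polynomial ℝ}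
    (hQ : l.casoratiPoly (fun k => l.twist.Ppoly (d k)) (fun _ => 1)
      = (1 - Polynomial.C l.kap * Polynomial.X) ^ (M.choose 2) * Q) (x : 𝕜) :
    l.Xi d x = Polynomial.aeval (l.eta x)
      (Polynomial.C (1 / (l.cD d * l.phiConst M)) * Q) := by
  rw [Xi, w_eq_aeval h, hQ, h.phiAux_eq, map_mul, map_pow, aeval_one_sub_kap, map_mul,
    Polynomial.aeval_C, ← mul_assoc, mul_comm _ (posPow l.rho x ^ _),
    mul_div_mul_left _ _ (pow_ne_zero (M.choose 2) (posPow_ne_zero l.rho x))]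
  simp only [RCLike.algebraMap_eq_ofReal]
  push_cast
  ring

theorem PD_eq_aeval {l : MIParams} (h : l.Admissible) {M : ℕ} (d : Fin M → ℕ) (n : ℕ)
    {Q : Polynomial ℝ}
    (hQ : l.casoratiPoly (Fin.snoc (α := fun _ => Polynomial ℝ) (fun k => l.twist.Ppoly (d k))
        (l.Ppoly n)) (Fin.snoc (α := fun _ => ℝ) (fun _ => 1) l.alpha)
      = (1 - Polynomial.C l.kap * Polynomial.X) ^ (M.choose 2) * Q) (x : 𝕜) :
    l.PD d n x = Polynomial.aeval (l.eta x)
      (Polynomial.C (1 / (l.cDn d n * l.phiConst (M + 1))) * Q) := by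
  have hr := h.regular
  have hz := posPow_ne_zero l.rho x
  have hnu : (l.tshift M).nu x ≠ 0 := posPow_ne_zero _ _
  rw [PD, w''_eq_aeval h, hQ, hr.phiAux_eq, map_mul, map_pow, aeval_one_sub_kap, map_mul,
    Polynomial.aeval_C, ← tshift_nu_mul hr M, Nat.choose_succ_succ', Nat.choose_one_right, pow_add]
  simp only [RCLike.algebraMap_eq_ofReal]
  push_cast
  field_simp

end

/-- A single real polynomial serves for ℝ and for 𝕜; this is what allows identities checked on the
lattice to be transferred to 𝕜. -/
theorem exists_Xi_poly (𝕜 : Type*) [RCLike 𝕜] {l : MIParams} (h : l.Regular) {M : ℕ}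
    (d : Fin M → ℕ) : ∃ p : Polynomial ℝ, (∀ x : ℝ, l.Xi d x = Polynomial.aeval (l.eta x) p) ∧
      ∀ x : 𝕜, l.Xi d x = Polynomial.aeval (l.eta x) p := by
  obtain ⟨Q, hQ⟩ := h.dvd_casoratiPoly (fun k => l.twist.Ppoly (d k)) (fun _ => 1) univ
    (fun _ _ => rfl)
  rw [card_univ, Fintype.card_fin] at hQ
  exact ⟨_, Xi_eq_aeval h d hQ, Xi_eq_aeval h d hQ⟩

theorem exists_PD_poly (𝕜 : Type*) [RCLike 𝕜] {l : MIParams} (h : l.Admissible) {M : ℕ}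
    (d : Fin M → ℕ) (n : ℕ) :
    ∃ p : Polynomial ℝ, (∀ x : ℝ, l.PD d n x = Polynomial.aeval (l.eta x) p) ∧
      ∀ x : 𝕜, l.PD d n x = Polynomial.aeval (l.eta x) p := by
  obtain ⟨Q, hQ⟩ := h.regular.dvd_casoratiPoly
    (Fin.snoc (α := fun _ => Polynomial ℝ) (fun k => l.twist.Ppoly (d k)) (l.Ppoly n))
    (Fin.snoc (α := fun _ => ℝ) (fun _ => 1) l.alpha) (univ.map Fin.castSuccEmb) (by simp)
  rw [card_map, card_univ, Fintype.card_fin] at hQ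
  exact ⟨_, PD_eq_aeval h d n hQ, PD_eq_aeval h d n hQ⟩

/-- Polynomials in the sinusoidal coordinate are determined by their values on the lattice. -/
theorem Regular.poly_ext {l : MIParams} (h : l.Regular) {p r : Polynomial ℝ}
    (hpr : ∀ n : ℕ, p.eval (l.eta (n : ℝ)) = r.eval (l.eta (n : ℝ))) : p = r := by
  refine Polynomial.eq_of_infinite_eval_eq p r ?_
  refine (Set.infinite_range_of_injective h.eta_strictMono.injective).mono ?_
  rintro _ ⟨n, rfl⟩
  exact hpr n

variable {M : ℕ}

/-! ### Casorati determinants of the system on the lattice: values at the origin and signs -/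

/-- The family of solutions entering the Casorati determinants on the lattice. -/
noncomputable def latticeFamily (l : MIParams) (d : Fin M → ℕ) (n : ℕ) : Fin (M + 1) → ℕ → ℝ :=
  Fin.snoc (α := fun _ => ℕ → ℝ) (fun k x => l.xi (d k) (x : ℝ))
    (fun x => l.nu (x : ℝ) * l.P n (x : ℝ))

/-- The energies of the family of solutions. -/
noncomputable def latticeEnergy (l : MIParams) (d : Fin M → ℕ) (n : ℕ) : Fin (M + 1) → ℝ :=
  Fin.snoc (α := fun _ => ℝ) (fun k => l.tE (d k)) (l.E n)

theorem w_natCast (l : MIParams) (d : Fin M → ℕ) (x : ℕ) :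
    l.w d (x : ℝ) = latticeCasoratian (fun k y => l.xi (d k) (y : ℝ)) x := by
  simp [w, casoratian, latticeCasoratian]

theorem w''_natCast (l : MIParams) (d : Fin M → ℕ) (n x : ℕ) :
    l.w'' d n (x : ℝ) = latticeCasoratian (l.latticeFamily d n) x := by
  rw [w'', casoratian, latticeCasoratian]
  congr 1
  ext1 j k
  simp only [Matrix.of_apply, latticeFamily]
  refine Fin.lastCases ?_ (fun i => ?_) k
  · simp only [Fin.snoc_last]; push_cast; rfl
  · simp only [Fin.snoc_castSucc]; push_cast; rfl

theorem latticeFamily_threeTerm {l : MIParams} (h : l.Admissible) (d : Fin M → ℕ) (n : ℕ)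
    (k : Fin (M + 1)) :
    ThreeTerm l.upCoeff l.downCoeff l.diagCoeff (l.latticeEnergy d n k) (l.latticeFamily d n k) := by
  refine Fin.lastCases ?_ (fun i => ?_) k
  · simp only [latticeFamily, latticeEnergy, Fin.snoc_last]
    exact h.nu_P_threeTerm n
  · simp only [latticeFamily, latticeEnergy, Fin.snoc_castSucc]
    exact h.regular.xi_threeTerm _

theorem Regular.xi_at_zero {𝕜 : Type*} [RCLike 𝕜] {l : MIParams} (h : l.Regular) (v : ℕ) :
    l.xi v (0 : 𝕜) = 1 := h.twist.P_at_zero v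

theorem nu_zero {𝕜 : Type*} [RCLike 𝕜] (l : MIParams) : l.nu (0 : 𝕜) = 1 := posPow_zero _

theorem Regular.phiAux_zero_pos {l : MIParams} (h : l.Regular) (M : ℕ) :
    0 < l.phiAux M (0 : ℝ) := by
  rw [h.phiAux_eq, posPow_zero, one_pow, mul_one]
  exact h.phiConst_pos M

theorem Regular.phiAux_pos {l : MIParams} (h : l.Regular) (M : ℕ) (x : ℝ) :
    0 < l.phiAux M x := by
  rw [h.phiAux_eq]
  exact mul_pos (h.phiConst_pos M) (pow_pos (posPow_pos h.rho_pos _) _)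

theorem w_at_zero {l : MIParams} (h : l.Regular) (d : Fin M → ℕ) :
    l.w d (0 : ℝ) = l.cD d * l.phiAux M (0 : ℝ) := by
  have h1 := w_natCast l d 0
  rw [Nat.cast_zero] at h1
  rw [h1, latticeCasoratian_at_zero (fun x => (h.upCoeff_pos x).ne') l.downCoeff_zero
    (fun k => h.xi_threeTerm (d k)) (fun k => by simp [h.xi_at_zero]), cD]
  simp only [upCoeff]
  have := (h.phiAux_zero_pos M).ne'
  field_simp

theorem w''_at_zero {l : MIParams} (h : l.Admissible) (d : Fin M → ℕ) (n : ℕ) :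
    l.w'' d n (0 : ℝ) = l.cDn d n * l.phiAux (M + 1) (0 : ℝ) := by
  have hr := h.regular
  have h1 := w''_natCast l d n 0
  rw [Nat.cast_zero] at h1
  have h0 : ∀ k, l.latticeFamily d n k 0 = 1 := by
    intro k
    refine Fin.lastCases ?_ (fun i => ?_) k
    · simp [latticeFamily, hr.P_at_zero, nu_zero]
    · simp [latticeFamily, hr.xi_at_zero]
  rw [h1, latticeCasoratian_at_zero (fun x => (hr.upCoeff_pos x).ne') l.downCoeff_zero
    (latticeFamily_threeTerm h d n) h0, Fin.prod_univ_castSucc, cDn, cD, dSq]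
  have e1 : ∀ k : Fin M, ∏ j ∈ Finset.Iio k.castSucc,
      (l.latticeEnergy d n j - l.latticeEnergy d n k.castSucc) / l.upCoeff j
      = ∏ j ∈ Finset.Iio k, (l.tE (d j) - l.tE (d k)) / (l.alpha * l.B' ((j : ℕ) : ℝ)) := by
    intro k
    rw [Fin.Iio_castSucc, prod_map]
    simp [latticeEnergy, upCoeff]
  have e2 : ∏ j ∈ Finset.Iio (Fin.last M),
      (l.latticeEnergy d n j - l.latticeEnergy d n (Fin.last M)) / l.upCoeff j
      = (-1) ^ M * ∏ j : Fin M, (l.E n - l.tE (d j)) / (l.alpha * l.B' ((j : ℕ) : ℝ)) := by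
    rw [Fin.Iio_last_eq_map, prod_map]
    have : (-1 : ℝ) ^ M = ∏ j : Fin M, (-1 : ℝ) := by simp
    rw [this, ← prod_mul_distrib]
    refine prod_congr rfl fun j _ => ?_
    simp [latticeEnergy, upCoeff]
    ring
  rw [prod_congr rfl fun k _ => e1 k, e2]
  have h2 := (hr.phiAux_zero_pos M).ne'
  have h3 := (hr.phiAux_zero_pos (M + 1)).ne'
  field_simp

theorem cD_ne_zero {l : MIParams} (h : l.Admissible) {d : Fin M → ℕ}
    (hinj : Function.Injective d) (hnd : l.NonDegenerate d) : l.cD d ≠ 0 := by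
  refine mul_ne_zero (one_div_ne_zero (h.regular.phiAux_zero_pos M).ne') ?_
  refine prod_ne_zero_iff.2 fun k _ => prod_ne_zero_iff.2 fun j hj => div_ne_zero ?_
    (h.regular.upCoeff_pos j).ne'
  rw [sub_ne_zero]
  exact fun hh => (mem_Iio.1 hj).ne (tE_injective h hinj hnd hh)

theorem cDn_ne_zero {l : MIParams} (h : l.Admissible) {d : Fin M → ℕ}
    (hd : ∀ j, d j ∈ l.virtualIndexSet) (hinj : Function.Injective d) (hnd : l.NonDegenerate d)
    (n : ℕ) : l.cDn d n ≠ 0 := by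
  refine mul_ne_zero (mul_ne_zero (pow_ne_zero _ (by norm_num)) (cD_ne_zero h hinj hnd)) ?_
  refine mul_ne_zero (div_ne_zero (h.regular.phiAux_zero_pos M).ne'
    (h.regular.phiAux_zero_pos (M + 1)).ne') (prod_ne_zero_iff.2 fun j _ => div_ne_zero ?_
    (h.regular.upCoeff_pos j).ne')
  have h1 := tE_neg h (hd j)
  have h2 := E_nonneg h n
  linarith

theorem Xi_at_zero_real {l : MIParams} (h : l.Admissible) {d : Fin M → ℕ}
    (hinj : Function.Injective d) (hnd : l.NonDegenerate d) : l.Xi d (0 : ℝ) = 1 := by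
  rw [Xi, w_at_zero h.regular]
  exact div_self (mul_ne_zero (cD_ne_zero h hinj hnd) (h.regular.phiAux_zero_pos M).ne')

theorem PD_at_zero_real {l : MIParams} (h : l.Admissible) {d : Fin M → ℕ}
    (hd : ∀ j, d j ∈ l.virtualIndexSet) (hinj : Function.Injective d) (hnd : l.NonDegenerate d)
    (n : ℕ) : l.PD d n (0 : ℝ) = 1 := by
  rw [PD, w''_at_zero h, nu_zero, mul_one]
  exact div_self (mul_ne_zero (cDn_ne_zero h hd hinj hnd n) (h.regular.phiAux_zero_pos _).ne')

/-- The comparison solution is ν = ν P̌_0: it is positive with energy ℰ_0 = 0, above all virtual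
state energies. -/
theorem w_mul_w_zero_pos {l : MIParams} (h : l.Admissible) {d : Fin M → ℕ}
    (hd : ∀ j, d j ∈ l.virtualIndexSet) (hinj : Function.Injective d) (hnd : l.NonDegenerate d)
    (x : ℕ) : 0 < l.w d (x : ℝ) * l.w d (0 : ℝ) := by
  have hr := h.regular
  have h1 := w_natCast l d 0
  rw [Nat.cast_zero] at h1
  rw [h1, w_natCast]
  refine latticeCasoratian_mul_zero_pos hr.upCoeff_pos l.downCoeff_zero h.downCoeff_nonneg
    (fun k => hr.xi_threeTerm (d k)) (tE_injective h hinj hnd)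
    (fun k => by simp [hr.xi_at_zero]) (h.nu_P_threeTerm 0) (fun y => ?_)
    (fun k => (tE_neg h (hd k)).trans_le (E_nonneg h 0)) x
  rw [P_zero_index, mul_one]
  exact posPow_pos h.alpha_pos _

theorem w_div_w_pos {l : MIParams} (h : l.Admissible) {d : Fin M → ℕ}
    (hd : ∀ j, d j ∈ l.virtualIndexSet) (hinj : Function.Injective d) (hnd : l.NonDegenerate d)
    (x y : ℕ) : 0 < l.w d (x : ℝ) / l.w d (y : ℝ) := by
  have h1 := w_mul_w_zero_pos h hd hinj hnd x
  have h2 := w_mul_w_zero_pos h hd hinj hnd y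
  have h3 := div_pos h1 h2
  rwa [mul_div_mul_right] at h3
  exact right_ne_zero_of_mul h1.ne'

theorem w_ne_zero {l : MIParams} (h : l.Admissible) {d : Fin M → ℕ}
    (hd : ∀ j, d j ∈ l.virtualIndexSet) (hinj : Function.Injective d) (hnd : l.NonDegenerate d)
    (x : ℕ) : l.w d (x : ℝ) ≠ 0 :=
  left_ne_zero_of_mul (w_mul_w_zero_pos h hd hinj hnd x).ne'

/-- The sign of `cD` is not determined, but it is the sign of w_M at 0, hence that of w_M on the
whole lattice. -/
theorem Xi_pos {l : MIParams} (h : l.Admissible) {d : Fin M → ℕ}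
    (hd : ∀ j, d j ∈ l.virtualIndexSet) (hinj : Function.Injective d) (hnd : l.NonDegenerate d)
    (x : ℕ) : 0 < l.Xi d (x : ℝ) := by
  have h1 := w_div_w_pos h hd hinj hnd x 0
  rw [Nat.cast_zero, w_at_zero h.regular] at h1
  have h2 := div_pos (h.regular.phiAux_zero_pos M) (h.regular.phiAux_pos M x)
  have h3 := mul_pos h1 h2
  have h4 := cD_ne_zero h hinj hnd
  have h5 := (h.regular.phiAux_zero_pos M).ne'
  have h6 := (h.regular.phiAux_pos M x).ne'
  have e : l.w d (x : ℝ) / (l.cD d * l.phiAux M (x : ℝ)) = l.w d (x : ℝ)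
      / (l.cD d * l.phiAux M 0) * (l.phiAux M 0 / l.phiAux M (x : ℝ)) := by
    field_simp
  exact lt_of_lt_of_eq h3 e.symm

theorem NonDegenerate.comp {l : MIParams} {d : Fin M → ℕ} (hnd : l.NonDegenerate d) {s : ℕ}
    {g : Fin s → Fin M} (hg : Function.Injective g) : l.NonDegenerate fun k => d (g k) :=
  fun _ _ hjk => hnd _ _ (hg.ne hjk)

/-! ### The forward shift of the virtual state vectors -/

theorem upCoeff_shift {l : MIParams} (h : l.Admissible) (x : ℕ) :
    l.shift.upCoeff x = l.rho * l.upCoeff (x + 1) := by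
  have h1 := shift_B_eq h.regular (x : ℝ)
  rw [B_eq_alpha_mul h.regular, B_eq_alpha_mul h.shift.regular, alpha_shift] at h1
  simp only [RCLike.ofReal_real_eq_id, id] at h1
  rw [upCoeff, upCoeff, alpha_shift]
  refine mul_left_cancel₀ (mul_pos h.alpha_pos h.regular.rho_pos).ne' ?_
  push_cast
  linear_combination h1

/-- The recurrence of ξ_v factors into two first-order steps. With g(x) = ξ_v(x+1) - αξ_v(x) it
reads ℰ̃_v ξ_v(x) = -αB'(x) g(x) + D(x) g(x-1). Composing the steps in the other order gives the
recurrence at 𝝀 + 𝜹 for g, and uniqueness leaves only the value at 0 to compare. -/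
theorem xi_forward {l : MIParams} (h : l.Admissible) (v x : ℕ) :
    l.xi v ((x : ℝ) + 1) - l.alpha * l.xi v (x : ℝ)
      = (l.xi v (1 : ℝ) - l.alpha) * l.shift.xi v (x : ℝ) := by
  have hr := h.regular
  set g : ℕ → ℝ := fun x => l.xi v ((x : ℝ) + 1) - l.alpha * l.xi v (x : ℝ) with hg
  have hB : ∀ y : ℕ, l.B (y : ℝ) = l.alpha * l.upCoeff y := fun y => B_eq_alpha_mul hr (y : ℝ)
  have h1 : ∀ y : ℕ, l.tE v * l.xi v (y : ℝ) = - l.upCoeff y * g y + l.D (y : ℝ) * g (y - 1) := by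
    intro y
    have h2 := hr.xi_threeTerm v y
    simp only [diagCoeff, hB] at h2
    cases y with
    | zero =>
      simp only [hg, D_zero, downCoeff_zero, CharP.cast_eq_zero] at h2 ⊢
      push_cast at h2
      rw [zero_add]
      linear_combination h2
    | succ y =>
      simp only [hg, downCoeff, Nat.add_sub_cancel] at h2 ⊢
      push_cast at h2 ⊢
      linear_combination h2
  -- Applying the map ξ ↦ g to `h1` gives an equation in g alone; multiplied by ρ it has the shifted
  -- coefficients, and `tE_shift` matches the diagonal.
  have h3 : ThreeTerm l.shift.upCoeff l.shift.downCoeff l.shift.diagCoeff (l.shift.tE v) g := by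
    intro y
    have e1 := h1 y
    have e2 := h1 (y + 1)
    have e3 := tE_shift h v (y : ℝ)
    rw [← upCoeff] at e3
    rw [upCoeff_shift h, downCoeff, diagCoeff, D_shift, alpha_shift]
    rw [alpha_shift] at e3
    simp only [Nat.add_sub_cancel] at e2
    push_cast at e2
    have e4 : g y = l.xi v ((y : ℝ) + 1) - l.alpha * l.xi v (y : ℝ) := rfl
    clear_value g
    linear_combination l.rho * (e2 - l.alpha * e1) + g y * e3 + l.rho * l.tE v * e4
  refine h3.unique (fun y => (h.shift.regular.upCoeff_pos y).ne') l.shift.downCoeff_zero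
    (h.shift.regular.xi_threeTerm v) ?_ x
  simp [hg, hr.xi_at_zero, h.shift.regular.xi_at_zero]

/-- With ν moved to the front by a cyclic permutation and used to reduce the order, each remaining
column is (ξ_v(x+1) - αξ_v(x)) / α^{x+1}, a multiple of the virtual state at 𝝀 + 𝜹. The powers of α
combine to α^x. -/
theorem exists_w''_zero_eq {l : MIParams} (h : l.Admissible) (d : Fin M → ℕ) :
    ∃ K : ℝ, ∀ x : ℕ, l.w'' d 0 (x : ℝ) = K * l.alpha ^ x * l.shift.w d (x : ℝ) := by
  refine ⟨((Equiv.Perm.sign (finRotate (M + 1)) : ℤ) : ℝ)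
    * ∏ k : Fin M, (l.xi (d k) (1 : ℝ) - l.alpha), fun x => ?_⟩
  have hα := h.alpha_pos.ne'
  rw [w''_natCast, latticeFamily, Fin.snoc_eq_cons_rotate, latticeCasoratian_perm,
    latticeCasoratian_succ]
  · simp only [Fin.cons_zero, Fin.cons_succ, P_zero_index, mul_one, h.nu_natCast]
    have h1 : (fun k : Fin M => ratioDiff (fun x => l.alpha ^ x) fun x => l.xi (d k) (x : ℝ))
        = fun (k : Fin M) (y : ℕ) => (l.xi (d k) (1 : ℝ) - l.alpha)
          * ((l.alpha ^ (y + 1))⁻¹ * l.shift.xi (d k) (y : ℝ)) := by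
      funext k y
      have := xi_forward h (d k) y
      rw [ratioDiff]
      push_cast
      field_simp
      linear_combination l.alpha ^ y * this
    rw [h1, latticeCasoratian_mul _ (fun y => (l.alpha ^ (y + 1))⁻¹), prod_range_succ', w_natCast]
    have h2 : (∏ j ∈ range M, l.alpha ^ (x + (j + 1)))
        * ∏ j ∈ range M, (l.alpha ^ (x + j + 1))⁻¹ = 1 := by
      rw [← prod_mul_distrib]
      refine prod_eq_one fun j _ => ?_
      rw [← add_assoc]
      exact mul_inv_cancel₀ (pow_ne_zero _ hα)
    rw [add_zero]
    linear_combination ((Equiv.Perm.sign (finRotate (M + 1)) : ℤ) : ℝ)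
      * (∏ k : Fin M, (l.xi (d k) (1 : ℝ) - l.alpha)) * l.alpha ^ x
      * latticeCasoratian (fun k y => l.shift.xi (d k) (y : ℝ)) x * h2
  · intro y
    simp only [Fin.cons_zero, P_zero_index, mul_one]
    exact posPow_ne_zero _ _

theorem w_eq_Xi {𝕜 : Type*} [RCLike 𝕜] {l : MIParams} (h : l.Admissible) {d : Fin M → ℕ}
    (hinj : Function.Injective d) (hnd : l.NonDegenerate d) (x : 𝕜) :
    l.w d x = (l.cD d : 𝕜) * l.phiConst M * posPow l.rho x ^ M.choose 2 * l.Xi d x := by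
  have h1 : (l.cD d : 𝕜) ≠ 0 := by exact_mod_cast cD_ne_zero h hinj hnd
  have h2 : (l.phiConst M : 𝕜) ≠ 0 := by exact_mod_cast (h.regular.phiConst_pos M).ne'
  have h3 := posPow_ne_zero l.rho x
  rw [Xi, h.regular.phiAux_eq]
  field_simp

theorem w''_eq_PD {𝕜 : Type*} [RCLike 𝕜] {l : MIParams} (h : l.Admissible) {d : Fin M → ℕ}
    (hd : ∀ j, d j ∈ l.virtualIndexSet) (hinj : Function.Injective d) (hnd : l.NonDegenerate d)
    (n : ℕ) (x : 𝕜) :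
    l.w'' d n x = (l.cDn d n : 𝕜) * l.phiConst (M + 1) * posPow l.rho x ^ M.choose 2 * l.nu x
      * l.PD d n x := by
  have h1 : (l.cDn d n : 𝕜) ≠ 0 := by exact_mod_cast cDn_ne_zero h hd hinj hnd n
  have h2 : (l.phiConst (M + 1) : 𝕜) ≠ 0 := by exact_mod_cast (h.regular.phiConst_pos _).ne'
  have h3 := posPow_ne_zero l.rho x
  have h4 : (l.tshift M).nu x ≠ 0 := posPow_ne_zero _ _
  rw [PD, h.regular.phiAux_eq, ← tshift_nu_mul h.regular M,
    show (M + 1).choose 2 = M.choose 1 + M.choose 2 from Nat.choose_succ_succ' _ _,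
    Nat.choose_one_right, pow_add]
  field_simp

/-- Both sides are proportional and equal 1 at the origin, so the constant K never has to be
computed. -/
theorem PD_zero_natCast {l : MIParams} (h : l.Admissible) {d : Fin M → ℕ}
    (hd : ∀ j, d j ∈ l.virtualIndexSet) (hinj : Function.Injective d) (hnd : l.NonDegenerate d)
    (x : ℕ) : l.PD d 0 (x : ℝ) = l.shift.Xi d (x : ℝ) := by
  obtain ⟨K, hK⟩ := exists_w''_zero_eq h d
  have hnd' := hnd.shift h
  have hc := cDn_ne_zero h hd hinj hnd 0
  have hp := (h.regular.phiConst_pos (M + 1)).ne'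
  have key : ∀ y : ℕ, l.PD d 0 (y : ℝ)
      = K * l.shift.cD d * l.shift.phiConst M / (l.cDn d 0 * l.phiConst (M + 1))
        * l.shift.Xi d (y : ℝ) := by
    intro y
    have h1 := hK y
    rw [w''_eq_PD h hd hinj hnd, w_eq_Xi h.shift hinj hnd', h.nu_natCast, rho_shift] at h1
    simp only [RCLike.ofReal_real_eq_id, id] at h1
    have h2 := pow_ne_zero (M.choose 2) (posPow_ne_zero l.rho (y : ℝ))
    have h3 := pow_ne_zero y h.alpha_pos.ne'
    rw [div_mul_eq_mul_div, eq_div_iff (mul_ne_zero hc hp)]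
    refine mul_left_cancel₀ (mul_ne_zero h2 h3) ?_
    linear_combination h1
  have h0 := key 0
  rw [Nat.cast_zero, PD_at_zero_real h hd hinj hnd, Xi_at_zero_real h.shift hinj hnd', mul_one] at h0
  rw [key, ← h0, one_mul]

theorem PD_zero_eq {𝕜 : Type*} [RCLike 𝕜] {l : MIParams} (h : l.Admissible) {d : Fin M → ℕ}
    (hd : ∀ j, d j ∈ l.virtualIndexSet) (hinj : Function.Injective d) (hnd : l.NonDegenerate d)
    (x : 𝕜) : l.PD d 0 x = l.shift.Xi d x := by
  obtain ⟨p, hp, hp'⟩ := exists_PD_poly 𝕜 h d 0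
  obtain ⟨r, hr, hr'⟩ := exists_Xi_poly 𝕜 h.shift.regular d
  have : p = r := by
    refine h.regular.poly_ext fun n => ?_
    have := PD_zero_natCast h hd hinj hnd n
    rw [hp, hr, eta_shift] at this
    simpa using this
  rw [hp', hr', this, eta_shift]

theorem nu_add_one {𝕜 : Type*} [RCLike 𝕜] {l : MIParams} (h : l.Admissible) (x : 𝕜) :
    l.nu (x + 1) = l.nu x * l.alpha := by
  simpa using nu_add_nat h x 1

/-! ### The deformed potentials in terms of Ξ̌_𝒟 at 𝝀 and 𝝀 + 𝜹 -/

section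

variable {𝕜 : Type*} [RCLike 𝕜] {l : MIParams} {d : Fin M → ℕ}

theorem w_div_w (h : l.Admissible) (hinj : Function.Injective d) (hnd : l.NonDegenerate d)
    (x y : 𝕜) : l.w d x / l.w d y
      = (posPow l.rho x ^ M.choose 2 / posPow l.rho y ^ M.choose 2) * (l.Xi d x / l.Xi d y) := by
  have h1 : (l.cD d : 𝕜) ≠ 0 := by exact_mod_cast cD_ne_zero h hinj hnd
  have h2 : (l.phiConst M : 𝕜) ≠ 0 := by exact_mod_cast (h.regular.phiConst_pos M).ne'
  rw [w_eq_Xi h hinj hnd, w_eq_Xi h hinj hnd, mul_div_mul_comm,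
    mul_div_mul_left _ _ (mul_ne_zero h1 h2)]

theorem w''_div_w'' (h : l.Admissible) (hd : ∀ j, d j ∈ l.virtualIndexSet)
    (hinj : Function.Injective d) (hnd : l.NonDegenerate d) (x y : 𝕜) :
    l.w'' d 0 x / l.w'' d 0 y
      = (posPow l.rho x ^ M.choose 2 / posPow l.rho y ^ M.choose 2) * (l.nu x / l.nu y)
        * (l.shift.Xi d x / l.shift.Xi d y) := by
  have h1 : (l.cDn d 0 : 𝕜) ≠ 0 := by exact_mod_cast cDn_ne_zero h hd hinj hnd 0
  have h2 : (l.phiConst (M + 1) : 𝕜) ≠ 0 := by exact_mod_cast (h.regular.phiConst_pos _).ne'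
  rw [w''_eq_PD h hd hinj hnd, w''_eq_PD h hd hinj hnd, PD_zero_eq h hd hinj hnd,
    PD_zero_eq h hd hinj hnd, mul_div_mul_comm, mul_div_mul_comm,
    mul_div_mul_left _ _ (mul_ne_zero h1 h2)]

/-- The powers of ρ from the two determinant quotients cancel, and ν(x+1)/ν(x) supplies the second
factor α that turns αB'(x+M) into B(x+M). -/
theorem BD_eq (h : l.Admissible) (hd : ∀ j, d j ∈ l.virtualIndexSet)
    (hinj : Function.Injective d) (hnd : l.NonDegenerate d) (x : 𝕜) :
    l.BD d x = (l.tshift M).B x * (l.Xi d x / l.Xi d (x + 1))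
      * (l.shift.Xi d (x + 1) / l.shift.Xi d x) := by
  rw [BD, w_div_w h hinj hnd, w''_div_w'' h hd hinj hnd, tshift_B_eq h.regular,
    B_eq_alpha_mul h.regular, nu_add_one h]
  generalize l.Xi d x / l.Xi d (x + 1) = s
  generalize l.shift.Xi d (x + 1) / l.shift.Xi d x = t
  have h1 := posPow_ne_zero l.rho x
  have h2 := posPow_ne_zero l.rho (x + 1)
  have h3 : l.nu x ≠ 0 := posPow_ne_zero _ _
  field_simp

theorem DD_eq (h : l.Admissible) (hd : ∀ j, d j ∈ l.virtualIndexSet)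
    (hinj : Function.Injective d) (hnd : l.NonDegenerate d) (x : 𝕜) :
    l.DD d x = l.D x * (l.Xi d (x + 1) / l.Xi d x)
      * (l.shift.Xi d (x - 1) / l.shift.Xi d x) := by
  have h0 := nu_add_one h (x - 1)
  have h4 := h.regular.posPow_rho_one (𝕜 := 𝕜)
  have h5 := posPow_add l.rho (x - 1) 1
  rw [sub_add_cancel] at h0 h5
  rw [DD, w_div_w h hinj hnd, w''_div_w'' h hd hinj hnd, h0, posPow_add, h4]
  generalize l.Xi d (x + 1) / l.Xi d x = s
  generalize l.shift.Xi d (x - 1) / l.shift.Xi d x = t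
  have h1 := posPow_ne_zero l.rho (x - 1)
  have h3 : l.nu (x - 1) ≠ 0 := posPow_ne_zero _ _
  have h6 : (l.alpha : 𝕜) ≠ 0 := by exact_mod_cast h.alpha_pos.ne'
  have h7 : (l.rho : 𝕜) ≠ 0 := by exact_mod_cast h.regular.rho_pos.ne'
  rw [h5, h4]
  field_simp
  ring

end

variable {l : MIParams} {d : Fin M → ℕ}

theorem tshift_B_pos (h : l.Admissible) (M x : ℕ) : 0 < (l.tshift M).B (x : ℝ) := by
  rw [tshift_B_eq h.regular]
  exact_mod_cast h.B_pos (x + M)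

theorem BD_pos (h : l.Admissible) (hd : ∀ j, d j ∈ l.virtualIndexSet)
    (hinj : Function.Injective d) (hnd : l.NonDegenerate d) (x : ℕ) : 0 < l.BD d (x : ℝ) := by
  have hp := Xi_pos h hd hinj hnd
  have hp' := Xi_pos h.shift (fun j => h.mem_shift (hd j)) hinj (hnd.shift h)
  have h1 := hp (x + 1)
  have h2 := hp' (x + 1)
  push_cast at h1 h2
  rw [BD_eq h hd hinj hnd]
  exact mul_pos (mul_pos (tshift_B_pos h M x) (div_pos (hp x) h1)) (div_pos h2 (hp' x))

theorem DD_zero : l.DD d (0 : ℝ) = 0 := by simp [DD, D_zero]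

theorem DD_succ_pos (h : l.Admissible) (hd : ∀ j, d j ∈ l.virtualIndexSet)
    (hinj : Function.Injective d) (hnd : l.NonDegenerate d) (x : ℕ) :
    0 < l.DD d ((x : ℝ) + 1) := by
  have hp := Xi_pos h hd hinj hnd
  have hp' := Xi_pos h.shift (fun j => h.mem_shift (hd j)) hinj (hnd.shift h)
  have h1 := hp (x + 1)
  have h2 := hp' (x + 1)
  have h3 := hp (x + 1 + 1)
  push_cast at h1 h2 h3
  rw [DD_eq h hd hinj hnd, add_sub_cancel_right]
  exact mul_pos (mul_pos (h.regular.D_pos x) (div_pos h3 h1)) (div_pos (hp' x) h2)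

/-! ### The eigenvalue equation on the lattice -/

/-- The equation of the Casorati determinants `w''_{M,n}` on the lattice. -/
theorem w''_threeTerm_of_succ {m : ℕ} {d : Fin (m + 1) → ℕ} (h : l.Admissible)
    (hd : ∀ j, d j ∈ l.virtualIndexSet)
    (hinj : Function.Injective d) (hnd : l.NonDegenerate d) (n : ℕ) :
    ThreeTerm (fun x => l.upCoeff (x + (m + 1)) * (l.w d (x : ℝ) / l.w d ((x : ℝ) + 1)))
      (fun x => l.downCoeff x * (l.w d ((x : ℝ) + 1) / l.w d (x : ℝ)))
      (fun x => l.hatB d (x : ℝ) + l.hatD d ((x : ℝ) + 1) + l.tE (d (Fin.last m))) (l.E n)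
      (fun x => l.w'' d n (x : ℝ)) := by
  -- Proper initial segments contain only virtual states, so their determinants have constant sign;
  -- only the full determinant contains ν P̌_n, and it may vanish.
  have hne : ∀ (s : ℕ) (hs : s ≤ m + 2) (x : ℕ), s < m + 2 →
      latticeCasoratian (fun k => l.latticeFamily d n (Fin.castLE hs k)) x ≠ 0 := by
    intro s hs x hlt
    have hs' : s ≤ m + 1 := Nat.lt_succ_iff.1 hlt
    have h1 := w_ne_zero h (d := fun k => d (Fin.castLE hs' k)) (fun k => hd _)
      (hinj.comp (Fin.castLE_injective hs')) (hnd.comp (Fin.castLE_injective hs')) x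
    rw [w_natCast] at h1
    convert h1 using 2
    funext k
    have : Fin.castLE hs k = (Fin.castLE hs' k).castSucc := rfl
    rw [this, latticeFamily, Fin.snoc_castSucc]
  have key := latticeCasoratian_threeTerm l.downCoeff_zero (latticeFamily_threeTerm h d n) hne
  have hw : ∀ y : ℕ, latticeCasoratian (fun k => l.latticeFamily d n k.castSucc) y
      = l.w d (y : ℝ) := by
    intro y
    rw [w_natCast]
    simp [latticeFamily]
  have hw0 : ∀ y : ℕ, latticeCasoratian (fun k => l.latticeFamily d n k.castSucc.castSucc) y
      = l.w (fun k : Fin m => d k.castSucc) (y : ℝ) := by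
    intro y
    rw [w_natCast]
    simp [latticeFamily]
  intro x
  have := key x
  simp only [hw, hw0, ← w''_natCast] at this
  simp only [latticeEnergy, Fin.snoc_last, Fin.snoc_castSucc] at this
  simp only [hatB, hatD, add_sub_cancel_right]
  simp only [upCoeff, downCoeff] at this ⊢
  push_cast at this ⊢
  rw [add_assoc (x : ℝ) 1 1, one_add_one_eq_two]
  exact this

theorem w_of_isEmpty {𝕜 : Type*} [RCLike 𝕜] (l : MIParams) (d : Fin 0 → ℕ) (x : 𝕜) :
    l.w d x = 1 := by simp [w, casoratian]

theorem Xi_of_isEmpty {𝕜 : Type*} [RCLike 𝕜] (l : MIParams) (d : Fin 0 → ℕ) (x : 𝕜) :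
    l.Xi d x = 1 := by simp [Xi, w_of_isEmpty, cD, phiAux]

theorem tshift_zero (l : MIParams) : l.tshift 0 = l := by cases l <;> simp [tshift]

theorem BD_of_isEmpty {d : Fin 0 → ℕ} (h : l.Admissible) (x : ℝ) : l.BD d x = l.B x := by
  rw [BD_eq h (fun j => j.elim0) (fun j => j.elim0) (fun j => j.elim0)]
  simp [Xi_of_isEmpty, tshift_zero]

theorem DD_of_isEmpty {d : Fin 0 → ℕ} (h : l.Admissible) (x : ℝ) : l.DD d x = l.D x := by
  rw [DD_eq h (fun j => j.elim0) (fun j => j.elim0) (fun j => j.elim0)]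
  simp [Xi_of_isEmpty]

theorem w''_zero_ne_zero (h : l.Admissible) (hd : ∀ j, d j ∈ l.virtualIndexSet)
    (hinj : Function.Injective d) (hnd : l.NonDegenerate d) (x : ℕ) : l.w'' d 0 (x : ℝ) ≠ 0 := by
  rw [w''_eq_PD h hd hinj hnd, PD_zero_natCast h hd hinj hnd]
  refine mul_ne_zero (mul_ne_zero (mul_ne_zero (mul_ne_zero ?_ ?_) ?_) (posPow_ne_zero _ _)) ?_
  · exact cDn_ne_zero h hd hinj hnd 0
  · exact (h.regular.phiConst_pos _).ne'
  · exact pow_ne_zero _ (posPow_ne_zero _ _)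
  · exact (Xi_pos h.shift (fun j => h.mem_shift (hd j)) hinj (hnd.shift h) x).ne'

/-- The diagonal of the deformed Hamiltonian in its two factorized forms. -/
theorem hatB_add_hatD {m : ℕ} {d : Fin (m + 1) → ℕ} (h : l.Admissible)
    (hd : ∀ j, d j ∈ l.virtualIndexSet)
    (hinj : Function.Injective d) (hnd : l.NonDegenerate d) (x : ℕ) :
    l.hatB d (x : ℝ) + l.hatD d ((x : ℝ) + 1) + l.tE (d (Fin.last m))
      = l.BD d (x : ℝ) + l.DD d (x : ℝ) := by
  -- For n = 0 the energy is zero, so division by w''_{M,0}(x) expresses the diagonal through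
  -- neighbouring ratios; these are B_𝒟 and D_𝒟 by definition.
  have key := w''_threeTerm_of_succ h hd hinj hnd 0 x
  have hne := w''_zero_ne_zero h hd hinj hnd x
  rw [h.regular.E_zero, sub_zero, mul_right_comm (l.downCoeff x),
    downCoeff_mul_pred l (l.w'' d 0)] at key
  refine mul_right_cancel₀ hne (key.symm.trans ?_)
  simp only [BD, DD, upCoeff, downCoeff]
  push_cast
  simp only [RCLike.ofReal_real_eq_id, id]
  rw [add_mul]
  field_simp

theorem w''_threeTerm (h : l.Admissible) (hd : ∀ j, d j ∈ l.virtualIndexSet)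
    (hinj : Function.Injective d) (hnd : l.NonDegenerate d) (n : ℕ) :
    ThreeTerm (fun x => l.upCoeff (x + M) * (l.w d (x : ℝ) / l.w d ((x : ℝ) + 1)))
      (fun x => l.downCoeff x * (l.w d ((x : ℝ) + 1) / l.w d (x : ℝ)))
      (fun x => l.BD d (x : ℝ) + l.DD d (x : ℝ)) (l.E n) (fun x => l.w'' d n (x : ℝ)) := by
  cases M with
  | zero =>
    intro x
    have := h.nu_P_threeTerm n x
    simp only [w''_natCast, latticeCasoratian_one, w_of_isEmpty, BD_of_isEmpty h, DD_of_isEmpty h,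
      div_one, mul_one, add_zero]
    exact this
  | succ m =>
    intro x
    have := w''_threeTerm_of_succ h hd hinj hnd n x
    simp only [hatB_add_hatD h hd hinj hnd] at this
    exact this

/-- The eigenvalue equation of the multi-indexed polynomials on the lattice. -/
theorem PD_eigen_natCast (h : l.Admissible) (hd : ∀ j, d j ∈ l.virtualIndexSet)
    (hinj : Function.Injective d) (hnd : l.NonDegenerate d) (n x : ℕ) :
    (l.tshift M).B (x : ℝ) * (l.Xi d (x : ℝ) / l.Xi d ((x : ℝ) + 1))
        * (l.shift.Xi d ((x : ℝ) + 1) / l.shift.Xi d (x : ℝ) * l.PD d n (x : ℝ)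
          - l.PD d n ((x : ℝ) + 1))
      + l.D (x : ℝ) * (l.Xi d ((x : ℝ) + 1) / l.Xi d (x : ℝ))
        * (l.shift.Xi d ((x : ℝ) - 1) / l.shift.Xi d (x : ℝ) * l.PD d n (x : ℝ)
          - l.PD d n ((x : ℝ) - 1))
      = l.E n * l.PD d n (x : ℝ) := by
  have key := w''_threeTerm h hd hinj hnd n x
  simp only at key
  have h0 := nu_add_one h ((x : ℝ) - 1)
  have h4 := h.regular.posPow_rho_one (𝕜 := ℝ)
  have h5 := posPow_add l.rho ((x : ℝ) - 1) 1
  rw [sub_add_cancel] at h0 h5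
  have hc := cDn_ne_zero h hd hinj hnd n
  have hp := (h.regular.phiConst_pos (M + 1)).ne'
  have hz := posPow_ne_zero l.rho (x : ℝ)
  have hz' := posPow_ne_zero l.rho ((x : ℝ) - 1)
  have hν : l.nu (x : ℝ) ≠ 0 := posPow_ne_zero _ _
  have hν' : l.nu ((x : ℝ) - 1) ≠ 0 := posPow_ne_zero _ _
  have hα := h.alpha_pos.ne'
  have hρ := h.regular.rho_pos.ne'
  simp only [RCLike.ofReal_real_eq_id, id] at h0 h4
  rw [mul_right_comm (l.downCoeff x), downCoeff_mul_pred l (l.w'' d n), w''_eq_PD h hd hinj hnd,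
    w''_eq_PD h hd hinj hnd, w''_eq_PD h hd hinj hnd, w_div_w h hinj hnd, w_div_w h hinj hnd] at key
  push_cast at key
  have hB : l.upCoeff (x + M) = (l.tshift M).B (x : ℝ) / l.alpha := by
    rw [tshift_B_eq h.regular, B_eq_alpha_mul h.regular, upCoeff, eq_div_iff hα]
    push_cast
    simp only [RCLike.ofReal_real_eq_id, id]
    ring
  rw [hB, downCoeff, nu_add_one h, posPow_add, h4, BD_eq h hd hinj hnd, DD_eq h hd hinj hnd] at key
  simp only [RCLike.ofReal_real_eq_id, id] at key
  generalize l.Xi d (x : ℝ) / l.Xi d ((x : ℝ) + 1) = s at *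
  generalize l.Xi d ((x : ℝ) + 1) / l.Xi d (x : ℝ) = s' at *
  generalize l.shift.Xi d ((x : ℝ) + 1) / l.shift.Xi d (x : ℝ) = t at *
  generalize l.shift.Xi d ((x : ℝ) - 1) / l.shift.Xi d (x : ℝ) = t' at *
  rw [h0, h5, h4] at key
  have hz1 := pow_ne_zero (M.choose 2) hz'
  have hz2 := pow_ne_zero (M.choose 2) hρ
  simp only [mul_pow] at key
  refine mul_left_cancel₀ (mul_ne_zero (mul_ne_zero (mul_ne_zero (mul_ne_zero (mul_ne_zero hc hp)
    hz1) hz2) hν') hα) ?_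
  generalize posPow l.rho ((x : ℝ) - 1) ^ M.choose 2 = z at *
  generalize l.rho ^ M.choose 2 = r at *
  field_simp at key ⊢
  linear_combination -key

end MIParams

/-! ### Tridiagonal operators and their factorizations -/

namespace LatticeOp

variable {B D : ℕ → ℝ}

theorem diag_apply (g f : ℕ → ℝ) (x : ℕ) : diag g f x = g x * f x := rfl

theorem up_apply (f : ℕ → ℝ) (x : ℕ) : up f x = f (x + 1) := rfl

theorem down_apply_zero (f : ℕ → ℝ) : down f 0 = 0 := rfl

theorem down_apply_succ (f : ℕ → ℝ) (x : ℕ) : down f (x + 1) = f x := rfl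

theorem diag_mul_diag (g f : ℕ → ℝ) : diag g * diag f = diag (fun x => g x * f x) := by
  ext u x
  simp only [Module.End.mul_apply, diag_apply]
  ring

theorem Adag_mul_A_apply (hB : ∀ x, 0 ≤ B x) (hD : ∀ x, 0 ≤ D x) (hD0 : D 0 = 0) (f : ℕ → ℝ)
    (x : ℕ) : (Adag B D * A B D) f x = (B x + D x) * f x - √(B x * D (x + 1)) * f (x + 1)
      - √(B (x - 1) * D x) * f (x - 1) := by
  rw [Real.sqrt_mul (hB _), Real.sqrt_mul (hB _)]
  have h1 := Real.mul_self_sqrt (hB x)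
  have h2 := Real.mul_self_sqrt (hD x)
  cases x with
  | zero =>
    simp only [Adag, A, Module.End.mul_apply, LinearMap.sub_apply, Pi.sub_apply, diag_apply,
      up_apply, down_apply_zero, hD0, Real.sqrt_zero]
    linear_combination f 0 * h1
  | succ y =>
    simp only [Adag, A, Module.End.mul_apply, LinearMap.sub_apply, Pi.sub_apply, diag_apply,
      up_apply, down_apply_succ, Nat.add_sub_cancel]
    linear_combination f (y + 1) * h1 + f (y + 1) * h2

theorem A_mul_Adag_apply (hB : ∀ x, 0 ≤ B x) (hD : ∀ x, 0 ≤ D x) (hD0 : D 0 = 0) (f : ℕ → ℝ)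
    (x : ℕ) : (A B D * Adag B D) f x = (B x + D (x + 1)) * f x
      - √(B (x + 1) * D (x + 1)) * f (x + 1) - √(B x * D x) * f (x - 1) := by
  rw [Real.sqrt_mul (hB _), Real.sqrt_mul (hB _)]
  have h1 := Real.mul_self_sqrt (hB x)
  have h2 := Real.mul_self_sqrt (hD (x + 1))
  cases x with
  | zero =>
    simp only [Adag, A, Module.End.mul_apply, LinearMap.sub_apply, Pi.sub_apply, diag_apply,
      up_apply, down_apply_zero, down_apply_succ, hD0, Real.sqrt_zero]
    linear_combination f 0 * h1 + f 0 * h2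
  | succ y =>
    simp only [Adag, A, Module.End.mul_apply, LinearMap.sub_apply, Pi.sub_apply, diag_apply,
      up_apply, down_apply_succ, Nat.add_sub_cancel]
    linear_combination f (y + 1) * h1 + f (y + 1) * h2

/-- Two factorizations of the same tridiagonal operator. -/
theorem A_mul_Adag_add_smul_eq {B' D' : ℕ → ℝ} {e : ℝ} (hB : ∀ x, 0 ≤ B x) (hD : ∀ x, 0 ≤ D x)
    (hD0 : D 0 = 0) (hB' : ∀ x, 0 ≤ B' x) (hD' : ∀ x, 0 ≤ D' x) (hD0' : D' 0 = 0)
    (hdiag : ∀ x, B x + D (x + 1) + e = B' x + D' x)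
    (hoff : ∀ x, B (x + 1) * D (x + 1) = B' x * D' (x + 1)) :
    A B D * Adag B D + e • 1 = Adag B' D' * A B' D' := by
  refine LinearMap.ext fun f => funext fun x => ?_
  rw [LinearMap.add_apply, Pi.add_apply, A_mul_Adag_apply hB hD hD0, Adag_mul_A_apply hB' hD' hD0',
    hoff, ← hdiag, LinearMap.smul_apply, Pi.smul_apply, Module.End.one_apply, smul_eq_mul]
  have : B x * D x = B' (x - 1) * D' x := by
    cases x with
    | zero => rw [hD0, hD0', mul_zero, mul_zero]
    | succ y => exact hoff y
  rw [this]
  ring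

end LatticeOp

/-! ### From the lattice to real or complex arguments -/

namespace MIParams

open LatticeOp

variable {M : ℕ} {l : MIParams} {d : Fin M → ℕ}

theorem eta_tshift {𝕜 : Type*} [RCLike 𝕜] (l : MIParams) (M : ℕ) (x : 𝕜) :
    (l.tshift M).eta x = l.eta x := by cases l <;> rfl

theorem rho_tshift (l : MIParams) (M : ℕ) : (l.tshift M).rho = l.rho := by cases l <;> rfl

/-- The eigenvalue equation as a polynomial identity in the sinusoidal coordinate. -/
theorem eigen_iff_aeval {𝕜 : Type*} [RCLike 𝕜] (h : l.Regular) (n : ℕ) {p r g : Polynomial ℝ}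
    (hp : ∀ x : 𝕜, l.Xi d x = Polynomial.aeval (l.eta x) p)
    (hr : ∀ x : 𝕜, l.shift.Xi d x = Polynomial.aeval (l.eta x) r)
    (hg : ∀ x : 𝕜, l.PD d n x = Polynomial.aeval (l.eta x) g) (x : 𝕜)
    (hx : l.Xi d x ≠ 0) (hx1 : l.Xi d (x + 1) ≠ 0) (hs : l.shift.Xi d x ≠ 0)
    {σ τ F : Polynomial ℝ} (hσ : σ = Polynomial.C l.rho * Polynomial.X + Polynomial.C (l.eta 1))
    (hτ : τ = Polynomial.C l.rho⁻¹ * (Polynomial.X - Polynomial.C (l.eta 1)))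
    (hF : F = Polynomial.C (l.tshift M).alpha
        * (Polynomial.C (l.tshift M).slope * Polynomial.X + Polynomial.C (l.tshift M).base)
        * p ^ 2 * (r.comp σ * g - g.comp σ * r)
      + Polynomial.X * (p.comp σ) ^ 2 * (r.comp τ * g - g.comp τ * r)
      - Polynomial.C (l.E n) * g * p * p.comp σ * r
        * (1 - Polynomial.C l.kap * Polynomial.X)) :
    ((l.tshift M).B x * (l.Xi d x / l.Xi d (x + 1))
        * (l.shift.Xi d (x + 1) / l.shift.Xi d x * l.PD d n x - l.PD d n (x + 1))
      + l.D x * (l.Xi d (x + 1) / l.Xi d x)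
        * (l.shift.Xi d (x - 1) / l.shift.Xi d x * l.PD d n x - l.PD d n (x - 1))
      = (l.E n : 𝕜) * l.PD d n x) ↔ Polynomial.aeval (l.eta x) F = 0 := by
  have hρ : (l.rho : 𝕜) ≠ 0 := by exact_mod_cast h.rho_pos.ne'
  have e1 : (1 : 𝕜) = ((1 : ℕ) : 𝕜) := by simp
  have hη1 : l.eta (1 : 𝕜) = ((l.eta (1 : ℝ) : ℝ) : 𝕜) := by
    rw [e1, MIParams.eta_natCast, Nat.cast_one]
  -- The polynomials σ and τ realise x ↦ x + 1 and x ↦ x - 1 in the variable η, and F is the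
  -- equation multiplied by Ξ̌(x) Ξ̌(x+1) ρ^x and the shifted Ξ̌(x).
  have hup : Polynomial.aeval (l.eta x) σ = l.eta (x + 1) := by
    rw [hσ, h.eta_add_one, hη1]
    simp
  have hdown : Polynomial.aeval (l.eta x) τ = l.eta (x - 1) := by
    have := h.eta_add_one (x - 1)
    rw [sub_add_cancel, hη1] at this
    rw [hτ, this]
    simp [hρ]
  have hz := posPow_ne_zero l.rho x
  have hAF : Polynomial.aeval (l.eta x) F
      = (l.tshift M).alpha * ((l.tshift M).slope * l.eta x + (l.tshift M).base)
          * l.Xi d x ^ 2 * (l.shift.Xi d (x + 1) * l.PD d n x - l.PD d n (x + 1) * l.shift.Xi d x)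
        + l.eta x * l.Xi d (x + 1) ^ 2
          * (l.shift.Xi d (x - 1) * l.PD d n x - l.PD d n (x - 1) * l.shift.Xi d x)
        - l.E n * l.PD d n x * l.Xi d x * l.Xi d (x + 1) * l.shift.Xi d x * posPow l.rho x := by
    rw [hF, posPow_rho]
    simp only [map_add, map_sub, map_mul, map_pow, map_one, Polynomial.aeval_C, Polynomial.aeval_X,
      Polynomial.aeval_comp, hup, hdown, ← hp, ← hr, ← hg, RCLike.algebraMap_eq_ofReal]
  rw [hAF, B_eq, D_eq, eta_tshift, rho_tshift, posPow_neg, ← sub_eq_zero]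
  have key : ∀ u v : 𝕜, u * (l.Xi d x * l.Xi d (x + 1) * l.shift.Xi d x * posPow l.rho x) = v →
      (u = 0 ↔ v = 0) := by
    rintro u _ rfl
    exact ⟨fun hu => by rw [hu, zero_mul], fun hu => (mul_eq_zero.1 hu).resolve_right
      (mul_ne_zero (mul_ne_zero (mul_ne_zero hx hx1) hs) hz)⟩
  refine key _ _ ?_
  field_simp

/-- The eigenvalue equation of the multi-indexed polynomials for generic arguments. -/
theorem PD_eigen {𝕜 : Type*} [RCLike 𝕜] (h : l.Admissible) (hd : ∀ j, d j ∈ l.virtualIndexSet)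
    (hinj : Function.Injective d) (hnd : l.NonDegenerate d) (n : ℕ) (x : 𝕜)
    (hx : l.Xi d x ≠ 0) (hx1 : l.Xi d (x + 1) ≠ 0) (hs : l.shift.Xi d x ≠ 0) :
    (l.tshift M).B x * (l.Xi d x / l.Xi d (x + 1))
        * (l.shift.Xi d (x + 1) / l.shift.Xi d x * l.PD d n x - l.PD d n (x + 1))
      + l.D x * (l.Xi d (x + 1) / l.Xi d x)
        * (l.shift.Xi d (x - 1) / l.shift.Xi d x * l.PD d n x - l.PD d n (x - 1))
      = (l.E n : 𝕜) * l.PD d n x := by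
  have hr := h.regular
  obtain ⟨p, hp, hp'⟩ := exists_Xi_poly 𝕜 hr d
  obtain ⟨r, hq, hq'⟩ := exists_Xi_poly 𝕜 h.shift.regular d
  obtain ⟨g, hg, hg'⟩ := exists_PD_poly 𝕜 h d n
  simp only [eta_shift] at hq hq'
  rw [eigen_iff_aeval hr n hp' hq' hg' x hx hx1 hs rfl rfl rfl]
  -- The same real polynomial F arises over ℝ and over 𝕜. It vanishes at every η(y) with y on the
  -- lattice, where all denominators are positive, and therefore it is zero.
  refine (congrArg (Polynomial.aeval (l.eta x)) (hr.poly_ext (r := 0) fun y => ?_)).trans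
    (map_zero _)
  have i1 := Xi_pos h hd hinj hnd (y + 1)
  push_cast at i1
  have := (eigen_iff_aeval hr n hp hq hg (y : ℝ) (Xi_pos h hd hinj hnd y).ne' i1.ne'
    (Xi_pos h.shift (fun j => h.mem_shift (hd j)) hinj (hnd.shift h) y).ne' rfl rfl rfl).1
    (PD_eigen_natCast h hd hinj hnd n y)
  rw [Polynomial.eval_zero, ← this, Polynomial.coe_aeval_eq_eval]

theorem eq_one_at_zero {𝕜 : Type*} [RCLike 𝕜] {p : Polynomial ℝ}
    (hp : Polynomial.aeval (l.eta (0 : ℝ)) p = (1 : ℝ)) :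
    Polynomial.aeval (l.eta (0 : 𝕜)) p = (1 : 𝕜) := by
  rw [eta_zero] at hp ⊢
  have := Polynomial.aeval_algebraMap_apply 𝕜 (0 : ℝ) p
  rwa [map_zero, hp, map_one] at this

theorem Xi_at_zero (𝕜 : Type*) [RCLike 𝕜] (h : l.Admissible) (hinj : Function.Injective d)
    (hnd : l.NonDegenerate d) : l.Xi d (0 : 𝕜) = 1 := by
  obtain ⟨p, hp, hp'⟩ := exists_Xi_poly 𝕜 h.regular d
  rw [hp']
  exact eq_one_at_zero ((hp 0).symm.trans (Xi_at_zero_real h hinj hnd))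

theorem PD_at_zero (𝕜 : Type*) [RCLike 𝕜] (h : l.Admissible) (hd : ∀ j, d j ∈ l.virtualIndexSet)
    (hinj : Function.Injective d) (hnd : l.NonDegenerate d) (n : ℕ) : l.PD d n (0 : 𝕜) = 1 := by
  obtain ⟨p, hp, hp'⟩ := exists_PD_poly 𝕜 h d n
  rw [hp']
  exact eq_one_at_zero ((hp 0).symm.trans (PD_at_zero_real h hd hinj hnd n))

theorem BD_nonneg (h : l.Admissible) (hd : ∀ j, d j ∈ l.virtualIndexSet)
    (hinj : Function.Injective d) (hnd : l.NonDegenerate d) (x : ℕ) : 0 ≤ l.BD d (x : ℝ) :=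
  (BD_pos h hd hinj hnd x).le

theorem DD_nonneg (h : l.Admissible) (hd : ∀ j, d j ∈ l.virtualIndexSet)
    (hinj : Function.Injective d) (hnd : l.NonDegenerate d) (x : ℕ) : 0 ≤ l.DD d (x : ℝ) := by
  cases x with
  | zero => simp [DD_zero]
  | succ y => exact_mod_cast (DD_succ_pos h hd hinj hnd y).le

/-! ### The deformed Hamiltonian and its similarity transform -/

/-- The deformed Hamiltonian in factorized form. -/
theorem HD_eq_Adag_mul_A (h : l.Admissible) (hd : ∀ j, d j ∈ l.virtualIndexSet)
    (hinj : Function.Injective d) (hnd : l.NonDegenerate d) :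
    l.HD d = Adag (fun x => l.BD d (x : ℝ)) (fun x => l.DD d (x : ℝ))
      * A (fun x => l.BD d (x : ℝ)) (fun x => l.DD d (x : ℝ)) := by
  have hD0 : l.DD d ((0 : ℕ) : ℝ) = 0 := by rw [Nat.cast_zero, DD_zero]
  have hBp := BD_nonneg h hd hinj hnd
  have hDp := DD_nonneg h hd hinj hnd
  cases M with
  | zero =>
    refine LinearMap.ext fun f => funext fun x => ?_
    rw [Adag_mul_A_apply hBp hDp hD0, Real.sqrt_mul (hBp _), Real.sqrt_mul (hBp _)]
    simp only [BD_of_isEmpty h, DD_of_isEmpty h, HD, H]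
    cases x with
    | zero =>
      simp only [LinearMap.add_apply, LinearMap.sub_apply, LinearMap.neg_apply, Pi.add_apply,
        Pi.sub_apply, Pi.neg_apply, Module.End.mul_apply, diag_apply, up_apply, down_apply_zero,
        Nat.cast_zero, D_zero, Real.sqrt_zero]
      ring
    | succ y =>
      simp only [LinearMap.add_apply, LinearMap.sub_apply, LinearMap.neg_apply, Pi.add_apply,
        Pi.sub_apply, Pi.neg_apply, Module.End.mul_apply, diag_apply, up_apply, down_apply_succ,
        Nat.add_sub_cancel]
      ring
  | succ m =>
    have hr := h.regular
    have hd' : ∀ j : Fin m, d j.castSucc ∈ l.virtualIndexSet := fun j => hd _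
    have hinj' : Function.Injective fun j : Fin m => d j.castSucc :=
      hinj.comp (Fin.castSucc_injective m)
    have hnd' : l.NonDegenerate fun j : Fin m => d j.castSucc :=
      hnd.comp (Fin.castSucc_injective m)
    have hw := w_div_w_pos h hd hinj hnd
    have hw' := w_div_w_pos h hd' hinj' hnd'
    have hw0 := w_ne_zero h hd hinj hnd
    have hw0' := w_ne_zero h hd' hinj' hnd'
    have hG0 : ∀ y : ℕ, l.w'' d 0 (y : ℝ) ≠ 0 := w''_zero_ne_zero h hd hinj hnd
    rw [HD]
    refine A_mul_Adag_add_smul_eq ?_ ?_ ?_ hBp hDp hD0 ?_ ?_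
    · intro x
      have h1 := hw' x (x + 1)
      have h2 := hw (x + 1) x
      have h3 := (hr.upCoeff_pos (x + m)).le
      rw [upCoeff] at h3
      push_cast at h1 h2 h3
      exact mul_nonneg (mul_nonneg h3 h1.le) h2.le
    · intro x
      cases x with
      | zero => simp [hatD, D_zero]
      | succ y =>
        have h1 := hw' (y + 1 + 1) (y + 1)
        have h2 := hw y (y + 1)
        have h3 := h.downCoeff_nonneg (y + 1)
        rw [downCoeff] at h3
        push_cast at h1 h2 h3 ⊢
        rw [hatD, add_sub_cancel_right]
        exact mul_nonneg (mul_nonneg h3 h1.le) h2.le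
    · simp [hatD, D_zero]
    · intro x
      have := hatB_add_hatD h hd hinj hnd x
      push_cast
      exact this
    -- Off the diagonal the quotients of w_{M-1} cancel in B̂D̂ and those of w''_{M,0} cancel in
    -- B_𝒟D_𝒟. Both products leave w_M(x) w_M(x+2) / w_M(x+1)², and B' is taken at x + 1 + m = x +
    -- M.
    · intro x
      have i0 := hw0 x
      have i1 := hw0 (x + 1)
      have i2 := hw0 (x + 1 + 1)
      have i3 := hw0' (x + 1)
      have i4 := hw0' (x + 1 + 1)
      have i5 := hG0 x
      have i6 := hG0 (x + 1)
      have e : (x : ℝ) + ((m : ℝ) + 1) = (x : ℝ) + 1 + m := by ring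
      push_cast at *
      simp only [hatB, hatD, BD, DD, add_sub_cancel_right]
      push_cast
      rw [e]
      field_simp

/-- The coefficient of `-e^∂` in the similarity transformed Hamiltonian. -/
noncomputable def upRate (l : MIParams) (d : Fin M → ℕ) (x : ℕ) : ℝ :=
  (l.tshift M).B (x : ℝ) * (l.Xi d (x : ℝ) / l.Xi d ((x : ℝ) + 1))

/-- The coefficient of `-e^{-∂}` in the similarity transformed Hamiltonian. -/
noncomputable def downRate (l : MIParams) (d : Fin M → ℕ) (x : ℕ) : ℝ :=
  l.D (x : ℝ) * (l.Xi d ((x : ℝ) + 1) / l.Xi d (x : ℝ))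

theorem upRate_pos (h : l.Admissible) (hd : ∀ j, d j ∈ l.virtualIndexSet)
    (hinj : Function.Injective d) (hnd : l.NonDegenerate d) (x : ℕ) : 0 < l.upRate d x := by
  have h1 := Xi_pos h hd hinj hnd (x + 1)
  push_cast at h1
  exact mul_pos (tshift_B_pos h M x) (div_pos (Xi_pos h hd hinj hnd x) h1)

theorem downRate_succ_pos (h : l.Admissible) (hd : ∀ j, d j ∈ l.virtualIndexSet)
    (hinj : Function.Injective d) (hnd : l.NonDegenerate d) (x : ℕ) :
    0 < l.downRate d (x + 1) := by
  have h1 := Xi_pos h hd hinj hnd (x + 1)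
  have h2 := Xi_pos h hd hinj hnd (x + 1 + 1)
  have h3 := h.regular.D_pos x
  rw [downRate]
  push_cast at h1 h2 ⊢
  exact mul_pos h3 (div_pos h2 h1)

theorem psi_pos (h : l.Admissible) (hd : ∀ j, d j ∈ l.virtualIndexSet)
    (hinj : Function.Injective d) (hnd : l.NonDegenerate d) (x : ℕ) : 0 < l.psi d x := by
  have h0 := Xi_pos h hd hinj hnd 1
  have h1 := Xi_pos h hd hinj hnd x
  have h2 := Xi_pos h hd hinj hnd (x + 1)
  push_cast at h0 h2
  refine mul_pos (Real.sqrt_pos.2 h0) (div_pos (prod_pos fun y _ => Real.sqrt_pos.2 ?_)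
    (Real.sqrt_pos.2 (mul_pos h1 h2)))
  rw [D_tshift]
  exact div_pos (tshift_B_pos h M y) (h.regular.D_pos y)

/-- Detailed balance: ψ_𝒟² is a reversible weight for the rates `upRate` and `downRate`. Conjugation
by ψ_𝒟 therefore turns the symmetric entries √(B_𝒟(x) D_𝒟(x+1)) into these rates. -/
theorem psi_succ (h : l.Admissible) (hd : ∀ j, d j ∈ l.virtualIndexSet)
    (hinj : Function.Injective d) (hnd : l.NonDegenerate d) (x : ℕ) :
    l.psi d (x + 1) = l.psi d x * √(l.upRate d x / l.downRate d (x + 1)) := by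
  have h1 := Xi_pos h hd hinj hnd x
  have h2 := Xi_pos h hd hinj hnd (x + 1)
  have h3 := Xi_pos h hd hinj hnd (x + 1 + 1)
  have h4 := h.regular.D_pos x
  have h5 := tshift_B_pos h M x
  rw [psi, psi, phi0, prod_range_succ, ← phi0, D_tshift, upRate, downRate]
  push_cast at h1 h2 h3 ⊢
  have key : √((l.tshift M).B (x : ℝ) / l.D ((x : ℝ) + 1))
        / √(l.Xi d ((x : ℝ) + 1) * l.Xi d ((x : ℝ) + 1 + 1))
      = √((l.tshift M).B (x : ℝ) * (l.Xi d (x : ℝ) / l.Xi d ((x : ℝ) + 1))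
          / (l.D ((x : ℝ) + 1) * (l.Xi d ((x : ℝ) + 1 + 1) / l.Xi d ((x : ℝ) + 1))))
        / √(l.Xi d (x : ℝ) * l.Xi d ((x : ℝ) + 1)) := by
    rw [← Real.sqrt_div' _ (mul_pos h2 h3).le, ← Real.sqrt_div' _ (mul_pos h1 h2).le]
    congr 1
    field_simp
  rw [mul_div_assoc, key]
  ring

theorem BD_mul_DD_succ (h : l.Admissible) (hd : ∀ j, d j ∈ l.virtualIndexSet)
    (hinj : Function.Injective d) (hnd : l.NonDegenerate d) (x : ℕ) :
    l.BD d (x : ℝ) * l.DD d ((x + 1 : ℕ) : ℝ) = l.upRate d x * l.downRate d (x + 1) := by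
  have h2 := Xi_pos h.shift (fun j => h.mem_shift (hd j)) hinj (hnd.shift h) x
  have h3 := Xi_pos h.shift (fun j => h.mem_shift (hd j)) hinj (hnd.shift h) (x + 1)
  rw [BD_eq h hd hinj hnd, DD_eq h hd hinj hnd, upRate, downRate]
  push_cast at h3 ⊢
  rw [add_sub_cancel_right]
  field_simp

theorem sqrt_BD_mul_DD_up (h : l.Admissible) (hd : ∀ j, d j ∈ l.virtualIndexSet)
    (hinj : Function.Injective d) (hnd : l.NonDegenerate d) (x : ℕ) :
    √(l.BD d (x : ℝ) * l.DD d ((x + 1 : ℕ) : ℝ)) * l.psi d (x + 1) = l.upRate d x * l.psi d x := by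
  have h1 := upRate_pos h hd hinj hnd x
  have h2 := downRate_succ_pos h hd hinj hnd x
  rw [BD_mul_DD_succ h hd hinj hnd, psi_succ h hd hinj hnd, mul_left_comm,
    ← Real.sqrt_mul (mul_pos h1 h2).le,
    show l.upRate d x * l.downRate d (x + 1) * (l.upRate d x / l.downRate d (x + 1))
      = l.upRate d x * l.upRate d x by field_simp, Real.sqrt_mul_self h1.le, mul_comm]

theorem sqrt_BD_mul_DD_down (h : l.Admissible) (hd : ∀ j, d j ∈ l.virtualIndexSet)
    (hinj : Function.Injective d) (hnd : l.NonDegenerate d) (x : ℕ) :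
    √(l.BD d (x : ℝ) * l.DD d ((x + 1 : ℕ) : ℝ)) * l.psi d x
      = l.downRate d (x + 1) * l.psi d (x + 1) := by
  have h1 := upRate_pos h hd hinj hnd x
  have h2 := downRate_succ_pos h hd hinj hnd x
  rw [BD_mul_DD_succ h hd hinj hnd, psi_succ h hd hinj hnd,
    show l.upRate d x * l.downRate d (x + 1)
      = (l.downRate d (x + 1)) ^ 2 * (l.upRate d x / l.downRate d (x + 1)) by field_simp,
    Real.sqrt_mul (sq_nonneg _), Real.sqrt_sq h2.le]
  ring

theorem HtD_apply (h : l.Admissible) (hd : ∀ j, d j ∈ l.virtualIndexSet)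
    (hinj : Function.Injective d) (hnd : l.NonDegenerate d) (f : ℕ → ℝ) (x : ℕ) :
    l.HtD d f x = (l.BD d (x : ℝ) + l.DD d (x : ℝ)) * f x - l.upRate d x * f (x + 1)
      - l.downRate d x * f (x - 1) := by
  have hp := (psi_pos h hd hinj hnd x).ne'
  have hD0 : l.DD d ((0 : ℕ) : ℝ) = 0 := by rw [Nat.cast_zero, DD_zero]
  have h1 := sqrt_BD_mul_DD_up h hd hinj hnd x
  have h2 : √(l.BD d ((x - 1 : ℕ) : ℝ) * l.DD d (x : ℝ)) * l.psi d (x - 1)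
      = l.downRate d x * l.psi d x := by
    cases x with
    | zero => simp [DD_zero, downRate, D_zero]
    | succ y => exact sqrt_BD_mul_DD_down h hd hinj hnd y
  rw [HtD, HD_eq_Adag_mul_A h hd hinj hnd, Module.End.mul_apply, Module.End.mul_apply, diag_apply,
    Adag_mul_A_apply (BD_nonneg h hd hinj hnd) (DD_nonneg h hd hinj hnd) hD0]
  simp only [diag_apply]
  rw [inv_mul_eq_iff_eq_mul₀ hp]
  linear_combination -f (x + 1) * h1 - f (x - 1) * h2

/-- In the product the factors ψ_𝒟 at 𝝀 + 𝜹 meet and cancel, as do the two constants √B_𝒟(0),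
leaving the conjugate of 𝒜_𝒟†𝒜_𝒟. -/
theorem HtD_eq_backward_mul_forward (h : l.Admissible) (hd : ∀ j, d j ∈ l.virtualIndexSet)
    (hinj : Function.Injective d) (hnd : l.NonDegenerate d) :
    l.HtD d = l.backwardD d * l.forwardD d := by
  have h1 : √(l.BD d (0 : ℝ)) ≠ 0 := by
    have := BD_pos h hd hinj hnd 0
    rw [Nat.cast_zero] at this
    exact (Real.sqrt_pos.2 this).ne'
  have h2 : diag (l.shift.psi d) * diag (fun x => (l.shift.psi d x)⁻¹) = 1 := by
    rw [diag_mul_diag]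
    refine LinearMap.ext fun f => funext fun x => ?_
    rw [diag_apply, mul_inv_cancel₀, one_mul, Module.End.one_apply]
    exact (psi_pos h.shift (fun j => h.mem_shift (hd j)) hinj (hnd.shift h) x).ne'
  rw [HtD, HD_eq_Adag_mul_A h hd hinj hnd, backwardD, forwardD, smul_mul_smul_comm,
    one_div_mul_cancel h1, one_smul]
  simp only [mul_assoc]
  rw [← mul_assoc (diag (l.shift.psi d)), h2, one_mul]

theorem HtD_eq_difference (h : l.Admissible) (hd : ∀ j, d j ∈ l.virtualIndexSet)
    (hinj : Function.Injective d) (hnd : l.NonDegenerate d) :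
    l.HtD d =
      diag (fun x => (l.tshift M).B (x : ℝ) * (l.Xi d (x : ℝ) / l.Xi d ((x : ℝ) + 1)))
        * (diag (fun x => l.shift.Xi d ((x : ℝ) + 1) / l.shift.Xi d (x : ℝ)) - up)
      + diag (fun x => l.D (x : ℝ) * (l.Xi d ((x : ℝ) + 1) / l.Xi d (x : ℝ)))
        * (diag (fun x => l.shift.Xi d ((x : ℝ) - 1) / l.shift.Xi d (x : ℝ)) - down) := by
  refine LinearMap.ext fun f => funext fun x => ?_
  rw [HtD_apply h hd hinj hnd, BD_eq h hd hinj hnd, DD_eq h hd hinj hnd, upRate, downRate]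
  simp only [LinearMap.add_apply, LinearMap.sub_apply, Pi.add_apply, Pi.sub_apply,
    Module.End.mul_apply, diag_apply, up_apply]
  cases x with
  | zero => simp only [Nat.cast_zero, D_zero, zero_mul]; ring
  | succ y => rw [down_apply_succ, Nat.add_sub_cancel]; ring

theorem HtD_PD (h : l.Admissible) (hd : ∀ j, d j ∈ l.virtualIndexSet)
    (hinj : Function.Injective d) (hnd : l.NonDegenerate d) (n : ℕ) :
    l.HtD d (fun x : ℕ => l.PD d n (x : ℝ)) = l.E n • fun x : ℕ => l.PD d n (x : ℝ) := by
  funext x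
  have key := PD_eigen_natCast h hd hinj hnd n x
  rw [HtD_apply h hd hinj hnd, BD_eq h hd hinj hnd, DD_eq h hd hinj hnd, upRate, downRate,
    Pi.smul_apply, smul_eq_mul, ← key]
  cases x with
  | zero => simp only [Nat.cast_zero, D_zero, zero_mul, zero_add]; push_cast; ring
  | succ y => simp only [Nat.add_sub_cancel]; push_cast; rw [add_sub_cancel_right]; ring

end MIParams

/-! ### The main theorem -/

theorem mainTheorem6 {𝕜 : Type*} [RCLike 𝕜] (l : MIParams) (hl : l.Admissible)
    {M : ℕ} (d : Fin M → ℕ) (hd : ∀ j, d j ∈ l.virtualIndexSet)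
    (hinj : Function.Injective d) (hnd : l.NonDegenerate d) :
    -- the denominators do not vanish on the lattice
    (∀ x : ℕ, 0 < l.Xi d (x : ℝ) ∧ 0 < l.shift.Xi d (x : ℝ)) ∧
    -- the functions are polynomials in the sinusoidal coordinate
    (∃ p : Polynomial ℝ, ∀ x : 𝕜, l.Xi d x = Polynomial.aeval (l.eta x) p) ∧
    (∀ n : ℕ, ∃ p : Polynomial ℝ, ∀ x : 𝕜, l.PD d n x = Polynomial.aeval (l.eta x) p) ∧
    l.Xi d (0 : 𝕜) = 1 ∧ (∀ n : ℕ, l.PD d n (0 : 𝕜) = 1) ∧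
    -- the deformed potential functions
    (∀ x : 𝕜, l.Xi d (x + 1) ≠ 0 → l.shift.Xi d x ≠ 0 →
      l.BD d x = (l.tshift M).B x * (l.Xi d x / l.Xi d (x + 1))
        * (l.shift.Xi d (x + 1) / l.shift.Xi d x)) ∧
    (∀ x : 𝕜, l.Xi d x ≠ 0 → l.shift.Xi d x ≠ 0 →
      l.DD d x = l.D x * (l.Xi d (x + 1) / l.Xi d x)
        * (l.shift.Xi d (x - 1) / l.shift.Xi d x)) ∧
    -- the similarity transformed Hamiltonian
    l.HtD d = l.backwardD d * l.forwardD d ∧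
    l.HtD d =
      LatticeOp.diag (fun x => (l.tshift M).B (x : ℝ)
          * (l.Xi d (x : ℝ) / l.Xi d ((x : ℝ) + 1)))
        * (LatticeOp.diag (fun x => l.shift.Xi d ((x : ℝ) + 1) / l.shift.Xi d (x : ℝ))
            - LatticeOp.up)
      + LatticeOp.diag (fun x => l.D (x : ℝ) * (l.Xi d ((x : ℝ) + 1) / l.Xi d (x : ℝ)))
        * (LatticeOp.diag (fun x => l.shift.Xi d ((x : ℝ) - 1) / l.shift.Xi d (x : ℝ))
            - LatticeOp.down) ∧
    -- the eigenvalue equation, on the lattice and for generic real or complex arguments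
    (∀ n : ℕ, l.HtD d (fun x : ℕ => l.PD d n (x : ℝ))
      = l.E n • fun x : ℕ => l.PD d n (x : ℝ)) ∧
    (∀ (n : ℕ) (x : 𝕜), l.Xi d x ≠ 0 → l.Xi d (x + 1) ≠ 0 → l.shift.Xi d x ≠ 0 →
      (l.tshift M).B x * (l.Xi d x / l.Xi d (x + 1))
          * (l.shift.Xi d (x + 1) / l.shift.Xi d x * l.PD d n x - l.PD d n (x + 1))
        + l.D x * (l.Xi d (x + 1) / l.Xi d x)
          * (l.shift.Xi d (x - 1) / l.shift.Xi d x * l.PD d n x - l.PD d n (x - 1))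
        = (l.E n : 𝕜) * l.PD d n x) := by
  refine ⟨fun x => ⟨MIParams.Xi_pos hl hd hinj hnd x, MIParams.Xi_pos hl.shift
    (fun j => hl.mem_shift (hd j)) hinj (hnd.shift hl) x⟩, ?_, fun n => ?_,
    MIParams.Xi_at_zero 𝕜 hl hinj hnd, MIParams.PD_at_zero 𝕜 hl hd hinj hnd,
    fun x _ _ => MIParams.BD_eq hl hd hinj hnd x, fun x _ _ => MIParams.DD_eq hl hd hinj hnd x,
    MIParams.HtD_eq_backward_mul_forward hl hd hinj hnd,
    MIParams.HtD_eq_difference hl hd hinj hnd, MIParams.HtD_PD hl hd hinj hnd,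
    MIParams.PD_eigen hl hd hinj hnd⟩
  · obtain ⟨p, -, hp⟩ := MIParams.exists_Xi_poly 𝕜 hl.regular d
    exact ⟨p, hp⟩
  · obtain ⟨p, -, hp⟩ := MIParams.exists_PD_poly 𝕜 hl d n
    exact ⟨p, hp⟩
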